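/- Let $W$ be a compact smooth manifold of dimension $n\ge 3$ with boundary $M=\partial W\neq\emptyset$. For a smooth Riemannian metric $\bar g$ on $W$ let $R_{\bar g}$ be its scalar curvature, $d\sigma_{\bar g}$ its volume measure, $H_{\bar g}$ the mean curvature of $M$ with respect to the outward unit normal, and $[\bar g]$ its conformal class. The relative Yamabe constant is $$Y_{[\bar g]}(W,M;[\bar g|_M])=\inf\Big\{\frac{\int_W R_{\tilde g}\,d\sigma_{\tilde g}}{\mathrm{Vol}_{\tilde g}(W)^{\frac{n-2}{n}}}\ :\ \tilde g\in[\bar g],\ H_{\tilde g}\equiv 0\Big\},$$ and $\bar g$ is called a Yamabe metric if $H_{\bar g}\equiv 0$, $\mathrm{Vol}_{\bar g}(W)=1$ and $R_{\bar g}\equiv Y_{[\bar g]}(W,M;[\bar g|_M])$. Let $\bar g_t$, $t\in[0,T)$, be smooth Riemannian metrics on $W$ that form a classical solution (smooth on $W\times(0,T)$, and continuous in $t\in[0,T)$ with respect to the $C^2$ topology on $W$) of the Ricci flow with boundary conditions $$\partial_t\bar g_t=-2\,\mathrm{Ric}_{\bar g_t},\qquad H_{\bar g_t}\equiv 0,\qquad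 \bar g_t|_M\in C_0:=[\bar g_0|_M],$$ whose initial metric $\bar g_0$ is a Yamabe metric. Assume that for some $\epsilon\in(0,T]$ there is a $C^1$ family $u(t)$, $t\in[0,\epsilon)$, of positive smooth functions on $W$ ($C^1$ in $t$ with respect to the $C^2$ topology on $W$) with $u(0)=1$ such that $u(t)^{\frac{4}{n-2}}\bar g_t$ is a Yamabe metric for every $t\in[0,\epsilon)$. Then $t\mapsto Y_{[\bar g_t]}(W,M;C_0)$ has a one-sided derivative at $t=0$, $$\frac{d}{dt}\Big|_{t=0}Y_{[\bar g_t]}(W,M;C_0)=2\int_W|\mathrm{Ric}^0_{\bar g_0}|^2\,d\sigma_{\bar g_0}\ \ge 0,$$ where $\mathrm{Ric}^0=\mathrm{Ric}-\frac{R}{n}\bar g$ is the traceless Ricci tensor, and the derivative is $0$ if and only if $\bar g_0$ is an Einstein metric. -/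

import Mathlib

open Set Filter MeasureTheory Topology
open scoped Manifold ContDiff

noncomputable section

/-- Smooth Riemannian metrics on a smooth `n`-manifold with (possibly empty) boundary. -/
abbrev SmoothMetric (n : ℕ) [NeZero n] (W : Type*) [TopologicalSpace W]
    [ChartedSpace (EuclideanHalfSpace n) W] [IsManifold (𝓡∂ n) ∞ W] :=
  Bundle.ContMDiffRiemannianMetric (𝓡∂ n) ∞ (EuclideanSpace ℝ (Fin n))
    (fun x : W => TangentSpace (𝓡∂ n) x)

namespace RelYamabe

variable {n : ℕ} [NeZero n] {W : Type*} [TopologicalSpace W]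
  [ChartedSpace (EuclideanHalfSpace n) W] [IsManifold (𝓡∂ n) ∞ W]

/-! ### Local coordinates

`extChartAt (𝓡∂ n) c` is the coordinate chart around `c`; its target is relatively open in the
half space `{y | 0 ≤ y 0} = range (𝓡∂ n)`, and boundary points have `y 0 = 0`. All derivatives are
taken within the half space, i.e. they are one-sided at boundary points. -/

/-- The partial derivative `∂ᵢ f` at a point of the half space. -/
def pderiv (f : EuclideanSpace ℝ (Fin n) → ℝ) (i : Fin n) (y : EuclideanSpace ℝ (Fin n)) : ℝ :=
  fderivWithin ℝ f (range (𝓡∂ n)) y (EuclideanSpace.single i 1)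

/-- The coordinate vector field `∂ᵢ` of the chart around `c`, at the point with coordinates `y`. -/
def coordVec (c : W) (i : Fin n) (y : EuclideanSpace ℝ (Fin n)) :
    TangentSpace (𝓡∂ n) ((extChartAt (𝓡∂ n) c).symm y) :=
  mfderivWithin 𝓘(ℝ, EuclideanSpace ℝ (Fin n)) (𝓡∂ n) (extChartAt (𝓡∂ n) c).symm
    (range (𝓡∂ n)) y (EuclideanSpace.single i (1 : ℝ) : EuclideanSpace ℝ (Fin n))

/-- The coefficients `g_ij = g(∂ᵢ, ∂ⱼ)` of a metric in the chart around `c`. -/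
def gram (g : SmoothMetric n W) (c : W) (y : EuclideanSpace ℝ (Fin n)) :
    Matrix (Fin n) (Fin n) ℝ :=
  Matrix.of fun i j => g.inner ((extChartAt (𝓡∂ n) c).symm y) (coordVec c i y) (coordVec c j y)

/-- The coefficients `g^ij` of the inverse matrix. -/
def gramInv (g : SmoothMetric n W) (c : W) (y : EuclideanSpace ℝ (Fin n)) :
    Matrix (Fin n) (Fin n) ℝ :=
  (gram g c y)⁻¹

/-- The Christoffel symbols `Γᵏᵢⱼ = ½ ∑ₗ gᵏˡ (∂ᵢ gⱼₗ + ∂ⱼ gᵢₗ - ∂ₗ gᵢⱼ)` of the Levi-Civita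
connection. -/
def christoffel (g : SmoothMetric n W) (c : W) (k i j : Fin n)
    (y : EuclideanSpace ℝ (Fin n)) : ℝ :=
  (1 / 2) * ∑ l, gramInv g c y k l *
    (pderiv (fun z => gram g c z j l) i y + pderiv (fun z => gram g c z i l) j y
      - pderiv (fun z => gram g c z i j) l y)

/-- The coefficients `Ricᵢⱼ = ∑ₖ (∂ₖ Γᵏᵢⱼ - ∂ⱼ Γᵏᵢₖ) + ∑ₖₗ (Γᵏₖₗ Γˡᵢⱼ - Γᵏⱼₗ Γˡᵢₖ)` of the Ricci
tensor in the chart around `c`. -/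
def ricciCoeff (g : SmoothMetric n W) (c : W) (y : EuclideanSpace ℝ (Fin n)) (i j : Fin n) : ℝ :=
  ∑ k, (pderiv (christoffel g c k i j) k y - pderiv (christoffel g c k i k) j y)
    + ∑ k, ∑ l, (christoffel g c k k l y * christoffel g c l i j y
        - christoffel g c k j l y * christoffel g c l i k y)

/-! ### Curvature

Each tensor is evaluated at `x` in the chart around `x` itself; a tangent vector
`v : TangentSpace (𝓡∂ n) x` is its coordinate vector in that chart. -/

/-- The `i`-th component of a tangent vector at `x` in the chart around `x`. -/
def comp {x : W} (v : TangentSpace (𝓡∂ n) x) (i : Fin n) : ℝ :=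
  (show EuclideanSpace ℝ (Fin n) from v) i

/-- The Ricci tensor `Ric_g(v, w)`. -/
def ricci (g : SmoothMetric n W) (x : W) (v w : TangentSpace (𝓡∂ n) x) : ℝ :=
  ∑ i, ∑ j, ricciCoeff g x (extChartAt (𝓡∂ n) x x) i j * comp v i * comp w j

/-- The scalar curvature `R_g = ∑ᵢⱼ gⁱʲ Ricᵢⱼ`. -/
def scalarCurv (g : SmoothMetric n W) (x : W) : ℝ :=
  ∑ i, ∑ j, gramInv g x (extChartAt (𝓡∂ n) x x) i j * ricciCoeff g x (extChartAt (𝓡∂ n) x x) i j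

/-- The coefficients of the traceless Ricci tensor `Ric⁰ = Ric - (R / n) g`. -/
def tracelessRicciCoeff (g : SmoothMetric n W) (x : W) (i j : Fin n) : ℝ :=
  ricciCoeff g x (extChartAt (𝓡∂ n) x x) i j
    - scalarCurv g x / n * gram g x (extChartAt (𝓡∂ n) x x) i j

/-- `|Ric⁰|² = ∑ gⁱᵏ gʲˡ Ric⁰ᵢⱼ Ric⁰ₖₗ`. -/
def tracelessRicciNormSq (g : SmoothMetric n W) (x : W) : ℝ :=
  ∑ i, ∑ j, ∑ k, ∑ l, gramInv g x (extChartAt (𝓡∂ n) x x) i k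
    * gramInv g x (extChartAt (𝓡∂ n) x x) j l
    * tracelessRicciCoeff g x i j * tracelessRicciCoeff g x k l

/-- `g` is an Einstein metric: `Ric_g = a g` for a constant `a`. -/
def IsEinstein (g : SmoothMetric n W) : Prop :=
  ∃ a : ℝ, ∀ (x : W) (v w : TangentSpace (𝓡∂ n) x), ricci g x v w = a * g.inner x v w

/-! ### Boundary geometry -/

/-- Components `νⁱ = -gⁱ⁰ / √g⁰⁰` of the outward unit normal vector at a boundary point `x`
(in the chart around `x` the manifold is `{y | 0 ≤ y 0}`, so `ν = -∇y⁰ / |∇y⁰|`). -/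
def outwardNormal (g : SmoothMetric n W) (x : W) (i : Fin n) : ℝ :=
  - gramInv g x (extChartAt (𝓡∂ n) x x) i 0 / √(gramInv g x (extChartAt (𝓡∂ n) x x) 0 0)

/-- Coefficients of the second fundamental form with respect to the outward unit normal:
`A(∂ᵢ, ∂ⱼ) = g(∇ᵢ ν, ∂ⱼ) = -g(ν, ∇ᵢ ∂ⱼ)` for `∂ᵢ, ∂ⱼ` tangent to the boundary. -/
def secondFundCoeff (g : SmoothMetric n W) (x : W) (i j : Fin n) : ℝ :=
  - ∑ k, ∑ l, gram g x (extChartAt (𝓡∂ n) x x) k l * outwardNormal g x k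
    * christoffel g x l i j (extChartAt (𝓡∂ n) x x)

/-- The mean curvature of the boundary at `x`, the trace of the second fundamental form over the
tangent space of the boundary; the matrix `gⁱʲ - νⁱ νʲ` vanishes when `i = 0` or `j = 0`, and its
remaining block is the inverse of the induced metric `(gᵢⱼ)_{i, j ≠ 0}`. -/
def meanCurv (g : SmoothMetric n W) (x : W) : ℝ :=
  ∑ i, ∑ j, (gramInv g x (extChartAt (𝓡∂ n) x x) i j - outwardNormal g x i * outwardNormal g x j)
    * secondFundCoeff g x i j

/-- The boundary has mean curvature `H_g ≡ 0`. -/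
def MinimalBoundary (g : SmoothMetric n W) : Prop :=
  ∀ x ∈ (𝓡∂ n).boundary W, meanCurv g x = 0

/-- `g|_M ∈ [g₀|_M]`: the metrics induced on the boundary `M` are conformal. A tangent vector `v`
at a boundary point is tangent to `M` when `comp v 0 = 0`. (The factor is a quotient of smooth
functions, so it is smooth on `M`.) -/
def BoundaryConformal (g g₀ : SmoothMetric n W) : Prop :=
  ∃ f : W → ℝ, ∀ x ∈ (𝓡∂ n).boundary W, 0 < f x ∧
    ∀ v w : TangentSpace (𝓡∂ n) x, comp v 0 = 0 → comp w 0 = 0 →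
      g.inner x v w = f x * g₀.inner x v w

/-! ### Volume -/

/-- The Riemannian volume measure on the domain of the chart around `c` (and zero outside of it):
Lebesgue measure with density `√det(g_ij)`, transported by the chart. -/
def chartVolume [MeasurableSpace W] (g : SmoothMetric n W) (c : W) : Measure W :=
  (((volume : Measure (EuclideanSpace ℝ (Fin n))).restrict (extChartAt (𝓡∂ n) c).target).withDensity
    (fun y => ENNReal.ofReal √((gram g c y).det))).map (extChartAt (𝓡∂ n) c).symm

/-- The Riemannian volume measure: the least measure that dominates the volume of every chart.
The chart volumes agree on overlaps, so each of them is the restriction of this measure to the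
domain of the chart. -/
def riemVolume [MeasurableSpace W] (g : SmoothMetric n W) : Measure W :=
  ⨆ c : W, chartVolume g c

/-! ### The relative Yamabe constant -/

/-- `g' = f g`. -/
def IsMultiple (f : W → ℝ) (g g' : SmoothMetric n W) : Prop :=
  ∀ (x : W) (v w : TangentSpace (𝓡∂ n) x), g'.inner x v w = f x * g.inner x v w

/-- `g' ∈ [g]`: the metrics are conformal, with a smooth positive factor. -/
def Conformal (g g' : SmoothMetric n W) : Prop :=
  ∃ f : W → ℝ, ContMDiff (𝓡∂ n) 𝓘(ℝ, ℝ) ∞ f ∧ (∀ x, 0 < f x) ∧ IsMultiple f g g'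

/-- The normalized Einstein-Hilbert functional `∫ R_g dσ_g / Vol_g(W)^((n-2)/n)`. -/
def einsteinHilbert [MeasurableSpace W] (g : SmoothMetric n W) : ℝ :=
  (∫ x, scalarCurv g x ∂(riemVolume g)) / (riemVolume g).real univ ^ (((n : ℝ) - 2) / n)

/-- The relative Yamabe constant of the conformal class `[g]`: the infimum of the normalized
Einstein-Hilbert functional over the metrics in `[g]` with minimal boundary. -/
def yamabeConstant [MeasurableSpace W] (g : SmoothMetric n W) : ℝ :=
  sInf (einsteinHilbert '' {g' : SmoothMetric n W | Conformal g g' ∧ MinimalBoundary g'})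

/-- `g` is a Yamabe metric: minimal boundary, unit volume, and constant scalar curvature equal to
the relative Yamabe constant of `[g]`. In particular `g` minimizes the normalized Einstein-Hilbert
functional in its conformal class. -/
structure IsYamabeMetric [MeasurableSpace W] (g : SmoothMetric n W) : Prop where
  minimalBoundary : MinimalBoundary g
  unitVolume : riemVolume g univ = 1
  scalarCurv_eq : ∀ x, scalarCurv g x = yamabeConstant g

/-! ### Families depending on time -/

/-- `t ↦ φ t` is continuous for the `C^k` topology: in every chart, the spatial derivatives of order
at most `k` of `φ (t, y)` (coordinate expression, possibly dependent on the chart) are jointly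
continuous in `(t, y)` for `t ∈ J`. -/
def ContFamily (k : ℕ) (J : Set ℝ) (φ : W → ℝ → EuclideanSpace ℝ (Fin n) → ℝ) : Prop :=
  ∀ c : W, ∀ m ≤ k, ContinuousOn
    (fun p : ℝ × EuclideanSpace ℝ (Fin n) =>
      iteratedFDerivWithin ℝ m (φ c p.1) (range (𝓡∂ n)) p.2)
    (J ×ˢ (extChartAt (𝓡∂ n) c).target)

/-- The coordinate expressions of a family of functions. -/
def coordExpr (u : ℝ → W → ℝ) (c : W) (t : ℝ) (y : EuclideanSpace ℝ (Fin n)) : ℝ :=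
  u t ((extChartAt (𝓡∂ n) c).symm y)

/-- A `C^1` family `u(t)`, `t ∈ J`, of functions on `W`: `t ↦ u(t)` has a time derivative, and both
are continuous in `t` for the `C²` topology on `W`. -/
def IsC1Family (n : ℕ) [NeZero n] {W : Type*} [TopologicalSpace W]
    [ChartedSpace (EuclideanHalfSpace n) W] [IsManifold (𝓡∂ n) ∞ W]
    (J : Set ℝ) (u : ℝ → W → ℝ) : Prop :=
  ∃ h : ℝ → W → ℝ,
    (∀ t ∈ J, ContMDiff (𝓡∂ n) 𝓘(ℝ, ℝ) 2 (h t)) ∧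
    (∀ t ∈ J, ∀ x, HasDerivWithinAt (fun s => u s x) (h t x) J t) ∧
    ContFamily (n := n) 2 J (coordExpr u) ∧ ContFamily (n := n) 2 J (coordExpr h)

/-- `g t`, `t ∈ [0, T)`, is a classical solution of the Ricci flow `∂ₜ g = -2 Ric` with boundary
conditions `H ≡ 0` and `g t |_M ∈ [g 0 |_M]`: it is smooth on `W × (0, T)`, and continuous on
`[0, T)` for the `C²` topology on `W`. -/
structure IsRicciFlow (T : ℝ) (g : ℝ → SmoothMetric n W) : Prop where
  smooth : ∀ (c : W) (i j : Fin n), ContDiffOn ℝ ∞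
    (fun p : ℝ × EuclideanSpace ℝ (Fin n) => gram (g p.1) c p.2 i j)
    (Ioo 0 T ×ˢ (extChartAt (𝓡∂ n) c).target)
  contC2 : ∀ i j : Fin n, ContFamily 2 (Ico 0 T) (fun c t y => gram (g t) c y i j)
  evolution : ∀ t ∈ Ico 0 T, ∀ (x : W) (v w : TangentSpace (𝓡∂ n) x),
    HasDerivWithinAt (fun s => (g s).inner x v w) (-2 * ricci (g t) x v w) (Ico 0 T) t
  minimalBoundary : ∀ t ∈ Ico 0 T, MinimalBoundary (g t)
  boundaryConformal : ∀ t ∈ Ico 0 T, BoundaryConformal (g t) (g 0)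

end RelYamabe

end

open scoped Matrix

set_option linter.unusedSectionVars false
set_option linter.unusedVariables false

noncomputable section

namespace RelYamabe

/-! Let `Y(t)` be the relative Yamabe constant of `[g t]`. It depends only on the conformal class,
and `gY t` is a Yamabe metric of that class, so `Y(t)` is the scalar curvature of `gY t` and can be
differentiated at any point of `W`. If `h` is the time derivative of `gY`, the linearized scalar
curvature is `-⟨h, Ric⟩ + div X`, where `X` is a contraction of the time derivative of the
Christoffel symbols (`MetricFam.hasDerivAt_scal`). The left side `Y'` is constant on `W` and the
volume is one, so integration gives `Y' = -∫ ⟨h, Ric⟩` once `∫ div X = 0` is known. At `t = 0` the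
flow equation and `u 0 = 1` give `h = w g - 2 Ric` for a function `w`, hence `⟨h, Ric⟩ = (R / n) tr
h - 2 |Ric⁰|²` (`IsLocalMetric.frob_ric_variation`). Constancy of the volume in time forces `∫ tr h
= 0`, and `R` is constant, so only `2 ∫ |Ric⁰|²` remains. It vanishes exactly when `Ric⁰` does,
which for constant `R` is the Einstein condition.

The delicate point is `∫ div X = 0`, because `W` has a boundary (`GlobalFam.integral_eq_zero`). The
metrics `gY t` have minimal boundary and induce conformal metrics there, so the symbols `Γ⁰ᵢⱼ` of
each of them have zero trace over the boundary with respect to every other. Differentiating this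
relation in its two times shows that the normal component of `X` is a tangential divergence on the
boundary (`MetricFam.scalVec_zero_eq`). It is the normal component of `div B` for an antisymmetric
tensor `B`, built from a global defining function `p` of the boundary, its gradient and the time
derivative of that gradient. As `div div B = 0`, the field `X` may be replaced by `X - div B`, which
is tangent to the boundary; the divergence theorem then needs no boundary integral.

This is globalized with a partition of unity `ρ`. Testing against `ρ a` in the chart `a` produces
the scalar `⟨X, dρ a⟩ - div (B (dρ a))`. The transformation laws of the metric, the Christoffel
symbols and the divergence show that it does not depend on coordinates, and the sum over `a`
vanishes since the functions `ρ a` add up to one.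

Regularity at `t = 0` is avoided. The derivative of `Y` is computed for `t > 0`, where the flow is
jointly smooth and time and space derivatives commute. Up to `t = 0` only `Y` and the integrals have
to be continuous, for which continuity in the `C²` topology is enough; the one-sided derivative is
then the limit of the derivatives (`NormalizedFlow.hasDerivWithinAt_const_scal`). -/

/-- The coordinate space. -/
abbrev Coord (n : ℕ) := EuclideanSpace ℝ (Fin n)

/-- The closed half space `{y | 0 ≤ y 0}`. -/
def halfSpace (n : ℕ) [NeZero n] : Set (Coord n) := range (𝓡∂ n)

/-- `Ω` is relatively open in the half space. -/
def RelOpen {n : ℕ} [NeZero n] (Ω : Set (Coord n)) : Prop :=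
  ∃ U : Set (Coord n), IsOpen U ∧ Ω = U ∩ halfSpace n

/-! ### Calculus within the half space -/

section PartialDerivatives

variable {n : ℕ} [NeZero n] {Ω : Set (Coord n)} {f f' : Coord n → ℝ} {y : Coord n}

theorem pderiv_def (f : Coord n → ℝ) (i : Fin n) (y : Coord n) :
    pderiv f i y = fderivWithin ℝ f (halfSpace n) y (EuclideanSpace.single i 1) := rfl

theorem mem_halfSpace : y ∈ halfSpace n ↔ 0 ≤ y 0 := by
  rw [halfSpace, range_modelWithCornersEuclideanHalfSpace]; rfl

theorem uniqueDiffOn_halfSpace : UniqueDiffOn ℝ (halfSpace n) := (𝓡∂ n).uniqueDiffOn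

theorem isClosed_halfSpace : IsClosed (halfSpace n) := (𝓡∂ n).isClosed_range

theorem convex_halfSpace : Convex ℝ (halfSpace n) := by
  rw [halfSpace, range_modelWithCornersEuclideanHalfSpace]
  exact EuclideanHalfSpace.convex

theorem interior_halfSpace_eq : interior (halfSpace n) = {y | 0 < y 0} :=
  interior_range_modelWithCornersEuclideanHalfSpace n

theorem RelOpen.subset (h : RelOpen Ω) : Ω ⊆ halfSpace n := by
  obtain ⟨U, -, rfl⟩ := h; exact inter_subset_right

theorem RelOpen.mem_nhdsWithin (h : RelOpen Ω) (hy : y ∈ Ω) : Ω ∈ 𝓝[halfSpace n] y := by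
  obtain ⟨U, hU, rfl⟩ := h
  exact inter_mem (mem_nhdsWithin_of_mem_nhds (hU.mem_nhds hy.1)) self_mem_nhdsWithin

theorem RelOpen.nhdsWithin_eq (h : RelOpen Ω) (hy : y ∈ Ω) : 𝓝[Ω] y = 𝓝[halfSpace n] y :=
  le_antisymm (nhdsWithin_mono _ h.subset) (by
    exact nhdsWithin_le_of_mem (h.mem_nhdsWithin hy))

theorem RelOpen.uniqueDiffOn (h : RelOpen Ω) : UniqueDiffOn ℝ Ω := by
  obtain ⟨U, hU, rfl⟩ := h
  rw [inter_comm]; exact uniqueDiffOn_halfSpace.inter hU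

theorem RelOpen.measurableSet (h : RelOpen Ω) : MeasurableSet Ω := by
  obtain ⟨U, hU, rfl⟩ := h
  exact hU.measurableSet.inter isClosed_halfSpace.measurableSet

/-- The geometric quantities use derivatives within the half space, whereas smoothness is known on
charts. Relative openness makes both derivatives agree, boundary points included. -/
theorem RelOpen.fderivWithin_eq {F : Type*} [NormedAddCommGroup F] [NormedSpace ℝ F]
    (h : RelOpen Ω) (hy : y ∈ Ω) (f : Coord n → F) :
    fderivWithin ℝ f (halfSpace n) y = fderivWithin ℝ f Ω y := by
  obtain ⟨U, hU, rfl⟩ := h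
  rw [inter_comm]
  exact (fderivWithin_inter (hU.mem_nhds hy.1)).symm

/-- A convex set with nonempty interior lies in the closure of its interior. Second derivatives
within a set are symmetric at such points, so partial derivatives commute also at the boundary. -/
theorem RelOpen.subset_closure_interior (h : RelOpen Ω) : Ω ⊆ closure (interior Ω) := by
  obtain ⟨U, hU, rfl⟩ := h
  rw [interior_inter, hU.interior_eq]
  intro y hy
  refine hU.inter_closure ⟨hy.1, ?_⟩
  rw [convex_halfSpace.closure_interior_eq_closure_of_nonempty_interior
    (𝓡∂ n).nonempty_interior]
  exact subset_closure hy.2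

theorem differentiableWithinAt_of_contDiffOn {F : Type*} [NormedAddCommGroup F]
    [NormedSpace ℝ F] {f : Coord n → F} {k : WithTop ℕ∞} (hf : ContDiffOn ℝ k f Ω)
    (h : RelOpen Ω) (hk : k ≠ 0) (hy : y ∈ Ω) :
    DifferentiableWithinAt ℝ f (halfSpace n) y :=
  ((hf.differentiableOn hk) y hy).mono_of_mem_nhdsWithin (h.mem_nhdsWithin hy)

theorem fderivWithin_apply_eq_sum (f : Coord n → ℝ) (v : Coord n) :
    fderivWithin ℝ f (halfSpace n) y v = ∑ i, v i * pderiv f i y := by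
  conv_lhs => rw [← (EuclideanSpace.basisFun (Fin n) ℝ).sum_repr v]
  simp [pderiv_def]

theorem pderiv_congr (h : RelOpen Ω) (hy : y ∈ Ω) (hf : EqOn f f' Ω) (i : Fin n) :
    pderiv f i y = pderiv f' i y := by
  simp only [pderiv_def]
  rw [Filter.EventuallyEq.fderivWithin_eq
    (Filter.eventuallyEq_of_mem (h.mem_nhdsWithin hy) hf) (hf hy)]

theorem pderiv_const (c : ℝ) (i : Fin n) : pderiv (fun _ => c) i y = 0 := by
  simp [pderiv_def]

theorem pderiv_add (hy : y ∈ halfSpace n) (hf : DifferentiableWithinAt ℝ f (halfSpace n) y)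
    (hf' : DifferentiableWithinAt ℝ f' (halfSpace n) y) (i : Fin n) :
    pderiv (fun z => f z + f' z) i y = pderiv f i y + pderiv f' i y := by
  simp only [pderiv_def]
  rw [fderivWithin_fun_add (uniqueDiffOn_halfSpace y hy) hf hf']; rfl

theorem pderiv_sub (hy : y ∈ halfSpace n) (hf : DifferentiableWithinAt ℝ f (halfSpace n) y)
    (hf' : DifferentiableWithinAt ℝ f' (halfSpace n) y) (i : Fin n) :
    pderiv (fun z => f z - f' z) i y = pderiv f i y - pderiv f' i y := by
  simp only [pderiv_def]
  rw [fderivWithin_fun_sub (uniqueDiffOn_halfSpace y hy) hf hf']; rfl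

theorem pderiv_neg (hy : y ∈ halfSpace n) (i : Fin n) :
    pderiv (fun z => - f z) i y = - pderiv f i y := by
  simp only [pderiv_def]
  rw [fderivWithin_fun_neg (uniqueDiffOn_halfSpace y hy)]; rfl

theorem pderiv_mul (hy : y ∈ halfSpace n) (hf : DifferentiableWithinAt ℝ f (halfSpace n) y)
    (hf' : DifferentiableWithinAt ℝ f' (halfSpace n) y) (i : Fin n) :
    pderiv (fun z => f z * f' z) i y = pderiv f i y * f' y + f y * pderiv f' i y := by
  simp only [pderiv_def]
  rw [fderivWithin_fun_mul (uniqueDiffOn_halfSpace y hy) hf hf']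
  simp; ring

theorem pderiv_sum {ι : Type*} (s : Finset ι) {F : ι → Coord n → ℝ} (hy : y ∈ halfSpace n)
    (hF : ∀ j ∈ s, DifferentiableWithinAt ℝ (F j) (halfSpace n) y) (i : Fin n) :
    pderiv (fun z => ∑ j ∈ s, F j z) i y = ∑ j ∈ s, pderiv (F j) i y := by
  simp only [pderiv_def]
  rw [fderivWithin_fun_sum (uniqueDiffOn_halfSpace y hy) hF]
  simp

theorem pderiv_comp {φ : Coord n → Coord n} (h : RelOpen Ω) (hy : y ∈ Ω)
    (hφ : MapsTo φ Ω (halfSpace n)) (hφd : DifferentiableWithinAt ℝ φ (halfSpace n) y)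
    (hf : DifferentiableWithinAt ℝ f (halfSpace n) (φ y)) (a : Fin n) :
    pderiv (fun z => f (φ z)) a y
      = ∑ i, pderiv (fun z => φ z i) a y * pderiv f i (φ y) := by
  have e : pderiv (fun z => f (φ z)) a y
      = fderivWithin ℝ f (halfSpace n) (φ y)
        (fderivWithin ℝ φ (halfSpace n) y (EuclideanSpace.single a 1)) := by
    simp only [pderiv_def]
    have hd : DifferentiableWithinAt ℝ φ Ω y := hφd.mono h.subset
    have := fderivWithin_comp y hf hd hφ (h.uniqueDiffOn y hy)
    rw [show (fun z => f (φ z)) = f ∘ φ from rfl, h.fderivWithin_eq hy, this,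
      h.fderivWithin_eq hy]
    rfl
  rw [e, fderivWithin_apply_eq_sum]
  refine Finset.sum_congr rfl fun i _ => ?_
  congr 1
  have := (hasFDerivWithinAt_euclidean.1 hφd.hasFDerivWithinAt i).fderivWithin
    (uniqueDiffOn_halfSpace y (h.subset hy))
  simp only [pderiv_def]
  rw [this]; rfl

theorem contDiffOn_pderiv {k m : WithTop ℕ∞} (hf : ContDiffOn ℝ k f Ω) (h : RelOpen Ω)
    (hk : m + 1 ≤ k) (i : Fin n) : ContDiffOn ℝ m (pderiv f i) Ω := by
  have := (hf.fderivWithin h.uniqueDiffOn hk).clm_apply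
    (contDiffOn_const (c := (EuclideanSpace.single i 1 : Coord n)))
  refine this.congr fun y hy => ?_
  rw [pderiv_def]
  rw [← h.fderivWithin_eq hy]

theorem pderiv_comm (hf : ContDiffOn ℝ 2 f Ω) (h : RelOpen Ω) (hy : y ∈ Ω) (i j : Fin n) :
    pderiv (pderiv f i) j y = pderiv (pderiv f j) i y := by
  have key : ∀ i j : Fin n, pderiv (pderiv f i) j y
      = fderivWithin ℝ (fderivWithin ℝ f Ω) Ω y (EuclideanSpace.single j 1)
        (EuclideanSpace.single i 1) := by
    intro i j
    have h1 : pderiv (pderiv f i) j y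
        = pderiv (fun z => fderivWithin ℝ f Ω z (EuclideanSpace.single i 1)) j y := by
      refine pderiv_congr h hy (fun z hz => ?_) j
      simp only [pderiv_def]
      rw [← h.fderivWithin_eq hz]
    rw [h1]
    simp only [pderiv_def]
    rw [h.fderivWithin_eq hy]
    have hd : DifferentiableWithinAt ℝ (fderivWithin ℝ f Ω) Ω y :=
      (hf.fderivWithin h.uniqueDiffOn (m := 1) (by norm_num)).differentiableOn (by simp) y hy
    rw [fderivWithin_clm_apply (h.uniqueDiffOn y hy) hd (differentiableWithinAt_const _)]
    simp
  rw [key, key]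
  exact (hf y hy).isSymmSndFDerivWithinAt (by simp) h.uniqueDiffOn
    (h.subset_closure_interior hy) hy _ _

/-- Partial derivative of a matrix valued function. -/
def mderiv {p q : Type*} (M : Coord n → Matrix p q ℝ) (a : Fin n) (y : Coord n) : Matrix p q ℝ :=
  Matrix.of fun i j => pderiv (fun z => M z i j) a y

theorem mderiv_apply {p q : Type*} (M : Coord n → Matrix p q ℝ) (a : Fin n) (i : p) (j : q) :
    mderiv M a y i j = pderiv (fun z => M z i j) a y := rfl

/-- Entrywise differentiability within the half space. -/
def MatDiff {p q : Type*} (M : Coord n → Matrix p q ℝ) (y : Coord n) : Prop :=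
  ∀ i j, DifferentiableWithinAt ℝ (fun z => M z i j) (halfSpace n) y

section Matrices

variable {p q r : Type*} {M : Coord n → Matrix p q ℝ} {N : Coord n → Matrix q r ℝ}

theorem MatDiff.mul [Fintype q] (hM : MatDiff M y) (hN : MatDiff N y) : MatDiff (fun z => M z * N z) y := by
  intro i j
  simp only [Matrix.mul_apply]
  exact DifferentiableWithinAt.fun_sum fun k _ => (hM i k).mul (hN k j)

theorem MatDiff.transpose (hM : MatDiff M y) :
    MatDiff (fun z => (M z).transpose) y :=
  fun i j => hM j i

theorem mderiv_mul [Fintype q] (hy : y ∈ halfSpace n) (hM : MatDiff M y) (hN : MatDiff N y) (a : Fin n) :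
    mderiv (fun z => M z * N z) a y = mderiv M a y * N y + M y * mderiv N a y := by
  ext i j
  simp only [mderiv_apply, Matrix.mul_apply, Matrix.add_apply]
  rw [pderiv_sum _ hy fun k _ => (hM i k).fun_mul (hN k j), ← Finset.sum_add_distrib]
  exact Finset.sum_congr rfl fun k _ => pderiv_mul hy (hM i k) (hN k j) a

theorem mderiv_add (hy : y ∈ halfSpace n) {N : Coord n → Matrix p q ℝ} (hM : MatDiff M y)
    (hN : MatDiff N y) (a : Fin n) :
    mderiv (fun z => M z + N z) a y = mderiv M a y + mderiv N a y := by
  ext i j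
  exact pderiv_add hy (hM i j) (hN i j) a

theorem mderiv_smul (hy : y ∈ halfSpace n) {c : Coord n → ℝ} (hM : MatDiff M y)
    (hc : DifferentiableWithinAt ℝ c (halfSpace n) y) (a : Fin n) :
    mderiv (fun z => c z • M z) a y = pderiv c a y • M y + c y • mderiv M a y := by
  ext i j
  exact pderiv_mul hy hc (hM i j) a

theorem mderiv_sum {ι : Type*} (s : Finset ι) (hy : y ∈ halfSpace n)
    {M : ι → Coord n → Matrix p q ℝ} (hM : ∀ j ∈ s, MatDiff (M j) y) (a : Fin n) :
    mderiv (fun z => ∑ j ∈ s, M j z) a y = ∑ j ∈ s, mderiv (M j) a y := by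
  ext i k
  simp only [mderiv_apply, Matrix.sum_apply]
  exact pderiv_sum s hy (fun j hj => hM j hj i k) a

theorem mderiv_transpose (a : Fin n) :
    mderiv (fun z => (M z).transpose) a y = (mderiv M a y).transpose := rfl

theorem mderiv_congr (h : RelOpen Ω) (hy : y ∈ Ω) {N : Coord n → Matrix p q ℝ} (hf : EqOn M N Ω)
    (a : Fin n) : mderiv M a y = mderiv N a y := by
  ext i j
  exact pderiv_congr h hy (fun z hz => by simp [hf hz]) a

theorem mderiv_comp {φ : Coord n → Coord n} (h : RelOpen Ω) (hy : y ∈ Ω)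
    (hφ : MapsTo φ Ω (halfSpace n)) (hφd : DifferentiableWithinAt ℝ φ (halfSpace n) y)
    (hM : MatDiff M (φ y)) (a : Fin n) :
    mderiv (fun z => M (φ z)) a y
      = ∑ i, pderiv (fun z => φ z i) a y • mderiv M i (φ y) := by
  ext i j
  simp only [mderiv_apply, Matrix.sum_apply, Matrix.smul_apply, smul_eq_mul]
  exact pderiv_comp h hy hφ hφd (hM i j) a

end Matrices

end PartialDerivatives

/-! ### Derivatives of determinants and inverse matrices -/

section MatrixCalculus

variable {n : ℕ}

theorem contDiffOn_det {X : Type*} [NormedAddCommGroup X] [NormedSpace ℝ X] {k : WithTop ℕ∞}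
    {Ω : Set X} {M : X → Matrix (Fin n) (Fin n) ℝ}
    (hM : ∀ i j, ContDiffOn ℝ k (fun y => M y i j) Ω) :
    ContDiffOn ℝ k (fun y => (M y).det) Ω := by
  simp only [Matrix.det_apply]
  refine ContDiffOn.sum fun σ _ => ContDiffOn.const_smul _ ?_
  exact contDiffOn_prod fun i _ => hM _ _

theorem contDiffOn_adjugate {X : Type*} [NormedAddCommGroup X] [NormedSpace ℝ X]
    {k : WithTop ℕ∞} {Ω : Set X} {M : X → Matrix (Fin n) (Fin n) ℝ}
    (hM : ∀ i j, ContDiffOn ℝ k (fun y => M y i j) Ω) (i j : Fin n) :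
    ContDiffOn ℝ k (fun y => (M y).adjugate i j) Ω := by
  simp only [Matrix.adjugate_apply]
  refine contDiffOn_det fun a b => ?_
  by_cases h : a = j
  · subst h; simpa using contDiffOn_const
  · simpa [Matrix.updateRow_ne h] using hM a b

theorem inv_apply_eq (M : Matrix (Fin n) (Fin n) ℝ) (i j : Fin n) :
    M⁻¹ i j = M.det⁻¹ * M.adjugate i j := by
  rw [Matrix.inv_def, Ring.inverse_eq_inv', Matrix.smul_apply, smul_eq_mul]

theorem contDiffOn_inv {X : Type*} [NormedAddCommGroup X] [NormedSpace ℝ X]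
    {k : WithTop ℕ∞} {Ω : Set X} {M : X → Matrix (Fin n) (Fin n) ℝ}
    (hM : ∀ i j, ContDiffOn ℝ k (fun y => M y i j) Ω) (hdet : ∀ y ∈ Ω, (M y).det ≠ 0)
    (i j : Fin n) : ContDiffOn ℝ k (fun y => (M y)⁻¹ i j) Ω := by
  simp only [inv_apply_eq]
  exact ((contDiffOn_det hM).inv hdet).mul (contDiffOn_adjugate hM i j)

/-- Jacobi's formula for the derivative of the determinant. -/
theorem hasFDerivWithinAt_det {X : Type*} [NormedAddCommGroup X] [NormedSpace ℝ X] {s : Set X}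
    {y : X} {M : X → Matrix (Fin n) (Fin n) ℝ} {M' : Fin n → Fin n → X →L[ℝ] ℝ}
    (hM : ∀ i j, HasFDerivWithinAt (fun z => M z i j) (M' i j) s y) (hdet : (M y).det ≠ 0) :
    HasFDerivWithinAt (fun z => (M z).det)
      ((M y).det • ∑ i, ∑ j, (M y)⁻¹ j i • M' i j) s y := by
  set D : (Fin n → Fin n → ℝ) → ℝ := fun A => (Matrix.of A).det with hD
  have hdiff : Differentiable ℝ D := by
    have : ContDiffOn ℝ 1 D univ := contDiffOn_det fun i j => by
      simp only [Matrix.of_apply]; fun_prop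
    exact (contDiffOn_univ.1 this).differentiable (by simp)
  set P : X → Fin n → Fin n → ℝ := fun z i j => M z i j with hP
  have hPd : HasFDerivWithinAt P
      (ContinuousLinearMap.pi fun i => ContinuousLinearMap.pi fun j => M' i j) s y := by
    rw [hasFDerivWithinAt_pi]
    intro i
    rw [hasFDerivWithinAt_pi]
    exact fun j => hM i j
  have hc := (hdiff (P y)).hasFDerivAt.comp_hasFDerivWithinAt y hPd
  -- The determinant is known to be differentiable, so its differential can be read off on lines:
  -- `det (A + r N) = det A * det (1 + r A⁻¹ N)`, which is `det A * (1 + r tr (A⁻¹ N))` up to terms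
  -- in `r²`.
  have hL : ∀ N : Fin n → Fin n → ℝ,
      fderiv ℝ D (P y) N = (M y).det * ((M y)⁻¹ * Matrix.of N).trace := by
    intro N
    have hline : HasDerivAt (fun r : ℝ => D (P y + r • N)) (fderiv ℝ D (P y) N) 0 := by
      have h1 : HasDerivAt (fun r : ℝ => P y + r • N) N 0 := by
        simpa using ((hasDerivAt_id (0 : ℝ)).smul_const N).const_add (P y)
      have h2 : HasFDerivAt D (fderiv ℝ D (P y)) (P y + (0 : ℝ) • N) := by
        simpa using (hdiff (P y)).hasFDerivAt
      exact h2.comp_hasDerivAt (0 : ℝ) h1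
    have heq : (fun r : ℝ => D (P y + r • N)) = fun r => (M y).det
        * (1 + ((M y)⁻¹ * Matrix.of N).trace * r
          + Polynomial.eval r (1 + (Polynomial.X : Polynomial ℝ)
            • ((M y)⁻¹ * Matrix.of N).map Polynomial.C).det.divX.divX * r ^ 2) := by
      funext r
      rw [← Matrix.det_one_add_smul, ← Matrix.det_mul, Matrix.mul_add, Matrix.mul_one,
        Matrix.mul_smul, Matrix.mul_nonsing_inv_cancel_left _ _ (isUnit_iff_ne_zero.2 hdet)]
      rfl
    rw [heq] at hline
    refine hline.unique ?_
    set q := (1 + (Polynomial.X : Polynomial ℝ)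
            • ((M y)⁻¹ * Matrix.of N).map Polynomial.C).det.divX.divX
    have h3 := (((hasDerivAt_id (0 : ℝ)).const_mul ((M y)⁻¹ * Matrix.of N).trace).const_add
      1).add ((q.hasDerivAt 0).mul ((hasDerivAt_id (0 : ℝ)).pow 2))
    have h4 := h3.const_mul (M y).det
    simp only [id] at h4
    refine h4.congr_deriv ?_
    simp
  refine hc.congr_fderiv ?_
  ext v
  simp only [ContinuousLinearMap.comp_apply]
  rw [hL]
  simp only [Matrix.trace, Matrix.diag, Matrix.mul_apply, Matrix.of_apply,
    ContinuousLinearMap.pi_apply, _root_.smul_apply, _root_.sum_apply,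
    smul_eq_mul]
  rw [Finset.sum_comm]

end MatrixCalculus

/-! ### Levi-Civita connection, curvature and volume density in coordinates -/

section LocalGeometry

variable {n : ℕ} [NeZero n] {Ω : Set (Coord n)} {y : Coord n}
  {G : Coord n → Matrix (Fin n) (Fin n) ℝ}

/-- Christoffel symbols of the metric with coefficients `G`. -/
def chr (G : Coord n → Matrix (Fin n) (Fin n) ℝ) (k i j : Fin n) (y : Coord n) : ℝ :=
  (1 / 2) * ∑ l, (G y)⁻¹ k l *
    (pderiv (fun z => G z j l) i y + pderiv (fun z => G z i l) j y
      - pderiv (fun z => G z i j) l y)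

/-- Ricci coefficients of the metric with coefficients `G`. -/
def ric (G : Coord n → Matrix (Fin n) (Fin n) ℝ) (y : Coord n) (i j : Fin n) : ℝ :=
  ∑ k, (pderiv (chr G k i j) k y - pderiv (chr G k i k) j y)
    + ∑ k, ∑ l, (chr G k k l y * chr G l i j y - chr G k j l y * chr G l i k y)

/-- The coefficients of a Riemannian metric of class `C²` on a relatively open subset of the half
space. -/
structure IsLocalMetric (Ω : Set (Coord n)) (G : Coord n → Matrix (Fin n) (Fin n) ℝ) : Prop where
  relOpen : RelOpen Ω
  contDiffOn : ∀ i j, ContDiffOn ℝ 2 (fun y => G y i j) Ω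
  posDef : ∀ y ∈ Ω, (G y).PosDef

/-- The connection matrices `(A_a)ᵏ_b = Γᵏ_ab`. -/
def conn (G : Coord n → Matrix (Fin n) (Fin n) ℝ) (a : Fin n) (y : Coord n) :
    Matrix (Fin n) (Fin n) ℝ :=
  Matrix.of fun k b => chr G k a b y

theorem conn_apply (a k b : Fin n) : conn G a y k b = chr G k a b y := rfl

/-- The curvature matrices of the Levi-Civita connection. -/
def curv (G : Coord n → Matrix (Fin n) (Fin n) ℝ) (a b : Fin n) (y : Coord n) :
    Matrix (Fin n) (Fin n) ℝ :=
  mderiv (conn G b) a y - mderiv (conn G a) b y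
    + (conn G a y * conn G b y - conn G b y * conn G a y)

namespace IsLocalMetric

theorem det_pos (h : IsLocalMetric Ω G) (hy : y ∈ Ω) : 0 < (G y).det := (h.posDef y hy).det_pos

theorem det_ne_zero (h : IsLocalMetric Ω G) (hy : y ∈ Ω) : (G y).det ≠ 0 := (h.det_pos hy).ne'

theorem isUnit_det (h : IsLocalMetric Ω G) (hy : y ∈ Ω) : IsUnit (G y).det :=
  isUnit_iff_ne_zero.2 (h.det_ne_zero hy)

theorem transpose_eq (h : IsLocalMetric Ω G) (hy : y ∈ Ω) : (G y).transpose = G y := by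
  have := (h.posDef y hy).1
  rwa [Matrix.IsHermitian, Matrix.conjTranspose_eq_transpose_of_trivial] at this

theorem symm (h : IsLocalMetric Ω G) (hy : y ∈ Ω) (i j : Fin n) : G y i j = G y j i := by
  conv_lhs => rw [← h.transpose_eq hy]
  rfl

theorem inv_transpose (h : IsLocalMetric Ω G) (hy : y ∈ Ω) :
    ((G y)⁻¹).transpose = (G y)⁻¹ := by
  rw [Matrix.transpose_nonsing_inv, h.transpose_eq hy]

theorem inv_symm (h : IsLocalMetric Ω G) (hy : y ∈ Ω) (i j : Fin n) :
    (G y)⁻¹ i j = (G y)⁻¹ j i := by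
  conv_lhs => rw [← h.inv_transpose hy]
  rfl

theorem mem_half (h : IsLocalMetric Ω G) (hy : y ∈ Ω) : y ∈ halfSpace n := h.relOpen.subset hy

theorem matDiff (h : IsLocalMetric Ω G) (hy : y ∈ Ω) : MatDiff G y := fun i j =>
  differentiableWithinAt_of_contDiffOn (h.contDiffOn i j) h.relOpen (by simp) hy

theorem contDiffOn_inv (h : IsLocalMetric Ω G) (i j : Fin n) :
    ContDiffOn ℝ 2 (fun y => (G y)⁻¹ i j) Ω :=
  RelYamabe.contDiffOn_inv h.contDiffOn (fun _ hy => h.det_ne_zero hy) i j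

theorem matDiff_inv (h : IsLocalMetric Ω G) (hy : y ∈ Ω) : MatDiff (fun z => (G z)⁻¹) y :=
  fun i j => differentiableWithinAt_of_contDiffOn (h.contDiffOn_inv i j) h.relOpen (by simp) hy

theorem contDiffOn_chr (h : IsLocalMetric Ω G) (k i j : Fin n) :
    ContDiffOn ℝ 1 (chr G k i j) Ω := by
  have hp : ∀ a b c, ContDiffOn ℝ 1 (pderiv (fun z => G z a b) c) Ω := fun a b c =>
    contDiffOn_pderiv (h.contDiffOn a b) h.relOpen (by norm_num) c
  unfold chr
  refine contDiffOn_const.mul (ContDiffOn.sum fun l _ => ?_)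
  exact ((h.contDiffOn_inv k l).of_le (by norm_num)).mul (((hp _ _ _).add (hp _ _ _)).sub
    (hp _ _ _))

theorem matDiff_conn (h : IsLocalMetric Ω G) (hy : y ∈ Ω) (a : Fin n) : MatDiff (conn G a) y :=
  fun k b => differentiableWithinAt_of_contDiffOn (h.contDiffOn_chr k a b) h.relOpen (by simp) hy

theorem pderiv_symm (h : IsLocalMetric Ω G) (hy : y ∈ Ω) (i j k : Fin n) :
    pderiv (fun z => G z i j) k y = pderiv (fun z => G z j i) k y :=
  pderiv_congr h.relOpen hy (fun _ hz => h.symm hz i j) k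

theorem chr_symm (h : IsLocalMetric Ω G) (hy : y ∈ Ω) (k i j : Fin n) :
    chr G k i j y = chr G k j i y := by
  unfold chr
  congr 1
  refine Finset.sum_congr rfl fun l _ => ?_
  rw [h.pderiv_symm hy i j]; ring

/-- Lowering the upper index cancels the inverse metric and leaves Christoffel symbols of the first
kind, which involve only derivatives of `G`. -/
theorem sum_mul_chr (h : IsLocalMetric Ω G) (hy : y ∈ Ω) (c a b : Fin n) :
    ∑ k, G y c k * chr G k a b y = (1 / 2) * (pderiv (fun z => G z b c) a y
      + pderiv (fun z => G z a c) b y - pderiv (fun z => G z a b) c y) := by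
  set v : Fin n → ℝ := fun l => (1 / 2) * (pderiv (fun z => G z b l) a y
      + pderiv (fun z => G z a l) b y - pderiv (fun z => G z a b) l y) with hv
  have h1 : (fun k => chr G k a b y) = (G y)⁻¹.mulVec v := by
    funext k
    simp only [chr, Matrix.mulVec, dotProduct, hv, Finset.mul_sum]
    exact Finset.sum_congr rfl fun l _ => by ring
  have h2 : (G y).mulVec ((G y)⁻¹.mulVec v) = v := by
    rw [Matrix.mulVec_mulVec, Matrix.mul_nonsing_inv _ (h.isUnit_det hy), Matrix.one_mulVec]
  rw [← h1] at h2
  exact congrFun h2 c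

/-- This is `∇g = 0`: in the sum of the two lowered symbols all derivatives cancel except one,
counted twice with weight one half. -/
theorem mderiv_eq (h : IsLocalMetric Ω G) (hy : y ∈ Ω) (a : Fin n) :
    mderiv G a y = (conn G a y).transpose * G y + G y * conn G a y := by
  ext c b
  simp only [mderiv_apply, Matrix.add_apply, Matrix.mul_apply, Matrix.transpose_apply, conn_apply]
  rw [h.sum_mul_chr hy c a b]
  have : ∑ k, chr G k a c y * G y k b = ∑ k, G y b k * chr G k a c y :=
    Finset.sum_congr rfl fun k _ => by rw [h.symm hy k b]; ring
  rw [this, h.sum_mul_chr hy b a c, h.pderiv_symm hy b c, h.pderiv_symm hy a b,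
    h.pderiv_symm hy a c]
  ring

/-- The Levi-Civita connection is the unique torsion free metric connection. -/
theorem conn_unique (h : IsLocalMetric Ω G) (hy : y ∈ Ω)
    {C : Fin n → Matrix (Fin n) (Fin n) ℝ} (htor : ∀ k a b, C a k b = C b k a)
    (hmet : ∀ a, mderiv G a y = (C a).transpose * G y + G y * C a) (a : Fin n) :
    C a = conn G a y := by
  -- Koszul's argument: the metric equation for three arrangements of the indices, combined with the
  -- symmetry `htor`, isolates the lowered connection coefficient.
  have key : ∀ c a b, (G y * C a) c b = (G y * conn G a y) c b := by
    intro c a b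
    have e : (G y * conn G a y) c b = ∑ k, G y c k * chr G k a b y := rfl
    rw [e, h.sum_mul_chr hy c a b]
    have hs : ∀ a c b, pderiv (fun z => G z c b) a y = (G y * C a) b c + (G y * C a) c b := by
      intro a c b
      have := congrFun (congrFun (hmet a) c) b
      rw [mderiv_apply, Matrix.add_apply] at this
      rw [this]
      congr 1
      simp only [Matrix.mul_apply, Matrix.transpose_apply]
      exact Finset.sum_congr rfl fun k _ => by rw [h.symm hy k b]; ring
    have ht : ∀ c a b, (G y * C a) c b = (G y * C b) c a := fun c a b => by
      simp only [Matrix.mul_apply]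
      exact Finset.sum_congr rfl fun k _ => by rw [htor k a b]
    rw [hs, hs, hs, ht b c a, ht c b a, ht a c b]
    ring
  have : G y * C a = G y * conn G a y := by ext c b; exact key c a b
  have h2 := congrArg (fun M => (G y)⁻¹ * M) this
  simpa [Matrix.nonsing_inv_mul_cancel_left _ _ (h.isUnit_det hy)] using h2

/-- This is `∇g⁻¹ = 0`, obtained by differentiating `G⁻¹ G = 1` and inserting `∇g = 0`. -/
theorem mderiv_inv (h : IsLocalMetric Ω G) (hy : y ∈ Ω) (a : Fin n) :
    mderiv (fun z => (G z)⁻¹) a y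
      = -(conn G a y * (G y)⁻¹) - (G y)⁻¹ * (conn G a y).transpose := by
  have h1 : mderiv (fun z => (G z)⁻¹ * G z) a y = 0 := by
    rw [mderiv_congr h.relOpen hy (N := fun _ => 1)
      (fun z hz => Matrix.nonsing_inv_mul _ (h.isUnit_det hz))]
    ext i j
    simp [mderiv_apply, pderiv_const]
  rw [mderiv_mul (h.mem_half hy) (h.matDiff_inv hy) (h.matDiff hy), h.mderiv_eq hy] at h1
  have h2 := congrArg (fun M => M * (G y)⁻¹) h1
  simp only [Matrix.add_mul, Matrix.mul_add, Matrix.zero_mul] at h2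
  rw [Matrix.mul_nonsing_inv_cancel_right _ _ (h.isUnit_det hy),
    Matrix.nonsing_inv_mul_cancel_left _ _ (h.isUnit_det hy), Matrix.mul_assoc (G y)⁻¹,
    Matrix.mul_nonsing_inv_cancel_right _ _ (h.isUnit_det hy)] at h2
  rw [eq_neg_of_add_eq_zero_left h2]
  abel

/-- Written as a contraction of curvature matrices, the Ricci tensor inherits its transformation law
from the conjugation law of the latter. -/
theorem ric_eq_sum_curv (h : IsLocalMetric Ω G) (hy : y ∈ Ω) (i j : Fin n) :
    ric G y i j = ∑ k, curv G k j y k i := by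
  have hs : ∀ k a b c, pderiv (chr G k a b) c y = pderiv (chr G k b a) c y := fun k a b c =>
    pderiv_congr h.relOpen hy (fun z hz => h.chr_symm hz k a b) c
  unfold ric curv
  rw [← Finset.sum_add_distrib]
  refine Finset.sum_congr rfl fun k _ => ?_
  simp only [Matrix.add_apply, Matrix.sub_apply, mderiv_apply, Matrix.mul_apply, conn_apply,
    ← Finset.sum_sub_distrib]
  have e1 : pderiv (fun z => chr G k j i z) k y = pderiv (chr G k i j) k y := hs k j i k
  have e2 : pderiv (fun z => chr G k k i z) j y = pderiv (chr G k i k) j y := hs k k i j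
  rw [e1, e2]
  congr 1
  exact Finset.sum_congr rfl fun l _ => by rw [h.chr_symm hy l j i, h.chr_symm hy l k i]

/-- The Riemannian volume density. -/
def _root_.RelYamabe.density (G : Coord n → Matrix (Fin n) (Fin n) ℝ) (y : Coord n) : ℝ :=
  √(G y).det

theorem density_pos (h : IsLocalMetric Ω G) (hy : y ∈ Ω) : 0 < density G y :=
  Real.sqrt_pos.2 (h.det_pos hy)

theorem contDiffOn_density (h : IsLocalMetric Ω G) : ContDiffOn ℝ 2 (density G) Ω :=
  (contDiffOn_det h.contDiffOn).sqrt fun _ hy => h.det_ne_zero hy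

/-- Jacobi's formula gives half of `tr (G⁻¹ ∂ₐG)`, and by `∇g = 0` this trace is twice the trace of
the connection matrix. -/
theorem pderiv_density (h : IsLocalMetric Ω G) (hy : y ∈ Ω) (a : Fin n) :
    pderiv (density G) a y = density G y * ∑ k, chr G k a k y := by
  have hd := hasFDerivWithinAt_det (fun i j => (h.matDiff hy i j).hasFDerivWithinAt)
    (h.det_ne_zero hy)
  have h1 := (hd.sqrt (h.det_ne_zero hy)).fderivWithin
    (uniqueDiffOn_halfSpace y (h.mem_half hy))
  have h2 : ∑ i, ∑ j, (G y)⁻¹ j i * pderiv (fun z => G z i j) a y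
      = 2 * ∑ k, chr G k a k y := by
    have e1 : ∑ i, ∑ j, (G y)⁻¹ j i * pderiv (fun z => G z i j) a y
        = ((G y)⁻¹ * mderiv G a y).trace := by
      rw [Finset.sum_comm]; rfl
    have e2 : ∑ k, chr G k a k y = (conn G a y).trace := rfl
    rw [e1, e2, h.mderiv_eq hy, Matrix.mul_add, Matrix.trace_add,
      Matrix.nonsing_inv_mul_cancel_left _ _ (h.isUnit_det hy), ← Matrix.mul_assoc,
      Matrix.trace_mul_comm, ← Matrix.mul_assoc, Matrix.mul_nonsing_inv _ (h.isUnit_det hy),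
      Matrix.one_mul, Matrix.trace_transpose]
    ring
  rw [pderiv_def]
  change fderivWithin ℝ (fun z => √(G z).det) (halfSpace n) y _ = _
  rw [h1]
  simp only [_root_.smul_apply, _root_.sum_apply, smul_eq_mul,
    ← pderiv_def]
  rw [h2, density]
  have hs := Real.sq_sqrt (h.det_pos hy).le
  have hp : √(G y).det ≠ 0 := (Real.sqrt_pos.2 (h.det_pos hy)).ne'
  field_simp
  rw [hs]

end IsLocalMetric

end LocalGeometry

/-! ### Behaviour of tensors, divergence and mean curvature under changes of coordinates -/

section Transition

variable {n : ℕ} [NeZero n] {Ω Ω' : Set (Coord n)} {y : Coord n} {φ : Coord n → Coord n}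
  {G G' : Coord n → Matrix (Fin n) (Fin n) ℝ}

theorem sum_comm₄ {ι : Type*} [Fintype ι] (f : ι → ι → ι → ι → ℝ) :
    ∑ i, ∑ j, ∑ a, ∑ b, f i j a b = ∑ a, ∑ b, ∑ i, ∑ j, f i j a b := by
  calc ∑ i, ∑ j, ∑ a, ∑ b, f i j a b = ∑ i, ∑ a, ∑ j, ∑ b, f i j a b :=
        Finset.sum_congr rfl fun i _ => Finset.sum_comm
    _ = ∑ a, ∑ i, ∑ b, ∑ j, f i j a b := by
        rw [Finset.sum_comm]
        exact Finset.sum_congr rfl fun a _ => Finset.sum_congr rfl fun i _ => Finset.sum_comm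
    _ = ∑ a, ∑ b, ∑ i, ∑ j, f i j a b := Finset.sum_congr rfl fun a _ => Finset.sum_comm

/-- The Jacobian matrix. -/
def jac (φ : Coord n → Coord n) (y : Coord n) : Matrix (Fin n) (Fin n) ℝ :=
  Matrix.of fun i a => pderiv (fun z => φ z i) a y

theorem jac_apply (i a : Fin n) : jac φ y i a = pderiv (fun z => φ z i) a y := rfl

/-- A change of coordinates between relatively open subsets of the half space. -/
structure IsTransition (Ω Ω' : Set (Coord n)) (φ : Coord n → Coord n) : Prop where
  relOpen : RelOpen Ω
  relOpen' : RelOpen Ω'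
  contDiffOn : ContDiffOn ℝ 3 φ Ω
  mapsTo : MapsTo φ Ω Ω'
  det_ne_zero : ∀ y ∈ Ω, (jac φ y).det ≠ 0
  boundary : ∀ y ∈ Ω, y 0 = 0 → φ y 0 = 0

/-- Two functions that agree on the boundary hyperplane have the same tangential derivatives. -/
theorem pderiv_congr_boundary {f f' : Coord n → ℝ} (h : RelOpen Ω) (hy : y ∈ Ω) (hy0 : y 0 = 0)
    (hf : DifferentiableWithinAt ℝ f (halfSpace n) y)
    (hf' : DifferentiableWithinAt ℝ f' (halfSpace n) y)
    (he : ∀ z ∈ Ω, z 0 = 0 → f z = f' z) {a : Fin n} (ha : a ≠ 0) :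
    pderiv f a y = pderiv f' a y := by
  -- Since `a ≠ 0`, this line stays in the boundary hyperplane for both signs of `s`, so derivatives
  -- along it are two-sided.
  set γ : ℝ → Coord n := fun s => y + s • EuclideanSpace.single a (1 : ℝ) with hγ
  have hγd : HasDerivAt γ (EuclideanSpace.single a (1 : ℝ)) 0 := by
    simpa [hγ] using ((hasDerivAt_id (0 : ℝ)).smul_const
      (EuclideanSpace.single a (1 : ℝ) : Coord n)).const_add y
  have hγ0 : ∀ s, γ s 0 = 0 := fun s => by simp [hγ, hy0, ha.symm]
  have hγH : ∀ s, γ s ∈ halfSpace n := fun s => mem_halfSpace.2 (hγ0 s).ge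
  have h0 : γ 0 = y := by simp [hγ]
  have key : ∀ F : Coord n → ℝ, DifferentiableWithinAt ℝ F (halfSpace n) y →
      HasDerivAt (fun s => F (γ s)) (pderiv F a y) 0 := by
    intro F hF
    have h1 : HasFDerivWithinAt F (fderivWithin ℝ F (halfSpace n) y) (halfSpace n) (γ 0) := by
      rw [h0]; exact hF.hasFDerivWithinAt
    have := h1.comp_hasDerivWithinAt (s := univ) 0 hγd.hasDerivWithinAt (fun s _ => hγH s)
    rwa [hasDerivWithinAt_univ] at this
  refine (key f hf).unique ((key f' hf').congr_of_eventuallyEq ?_)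
  have hc : Tendsto γ (𝓝 0) (𝓝[halfSpace n] y) := by
    refine tendsto_nhdsWithin_iff.2 ⟨?_, Eventually.of_forall hγH⟩
    have := hγd.continuousAt.tendsto
    rwa [h0] at this
  filter_upwards [hc (h.mem_nhdsWithin hy)] with s hs
  exact he _ hs (hγ0 s)

namespace IsTransition

theorem mem_half (h : IsTransition Ω Ω' φ) (hy : y ∈ Ω) : y ∈ halfSpace n := h.relOpen.subset hy

theorem contDiffOn_comp (h : IsTransition Ω Ω' φ) (i : Fin n) :
    ContDiffOn ℝ 3 (fun y => φ y i) Ω := by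
  have := h.contDiffOn
  exact contDiffOn_euclidean.1 this i

theorem differentiableWithinAt (h : IsTransition Ω Ω' φ) (hy : y ∈ Ω) :
    DifferentiableWithinAt ℝ φ (halfSpace n) y :=
  differentiableWithinAt_of_contDiffOn h.contDiffOn h.relOpen (by simp) hy

theorem mapsTo_half (h : IsTransition Ω Ω' φ) : MapsTo φ Ω (halfSpace n) :=
  h.mapsTo.mono_right h.relOpen'.subset

theorem contDiffOn_jac (h : IsTransition Ω Ω' φ) (i a : Fin n) :
    ContDiffOn ℝ 2 (fun y => jac φ y i a) Ω :=
  contDiffOn_pderiv (h.contDiffOn_comp i) h.relOpen (by norm_num) a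

theorem matDiff_jac (h : IsTransition Ω Ω' φ) (hy : y ∈ Ω) : MatDiff (jac φ) y := fun i a =>
  differentiableWithinAt_of_contDiffOn (h.contDiffOn_jac i a) h.relOpen (by simp) hy

theorem contDiffOn_mderiv_jac (h : IsTransition Ω Ω' φ) (a i b : Fin n) :
    ContDiffOn ℝ 1 (fun y => mderiv (jac φ) a y i b) Ω :=
  contDiffOn_pderiv (h.contDiffOn_jac i b) h.relOpen (by norm_num) a

theorem matDiff_mderiv_jac (h : IsTransition Ω Ω' φ) (hy : y ∈ Ω) (a : Fin n) :
    MatDiff (mderiv (jac φ) a) y := fun i b =>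
  differentiableWithinAt_of_contDiffOn (h.contDiffOn_mderiv_jac a i b) h.relOpen (by simp) hy

theorem mderiv_jac_symm (h : IsTransition Ω Ω' φ) (hy : y ∈ Ω) (i a b : Fin n) :
    mderiv (jac φ) a y i b = mderiv (jac φ) b y i a :=
  pderiv_comm ((h.contDiffOn_comp i).of_le (by norm_num)) h.relOpen hy b a

theorem mderiv_mderiv_jac_symm (h : IsTransition Ω Ω' φ) (hy : y ∈ Ω) (a b : Fin n) :
    mderiv (mderiv (jac φ) a) b y = mderiv (mderiv (jac φ) b) a y := by
  ext i c
  exact pderiv_comm (h.contDiffOn_jac i c) h.relOpen hy a b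

theorem isUnit_det (h : IsTransition Ω Ω' φ) (hy : y ∈ Ω) : IsUnit (jac φ y).det :=
  isUnit_iff_ne_zero.2 (h.det_ne_zero y hy)

/-- The pullback of the connection matrices. -/
def _root_.RelYamabe.pullConn (φ : Coord n → Coord n) (G' : Coord n → Matrix (Fin n) (Fin n) ℝ)
    (a : Fin n) (y : Coord n) : Matrix (Fin n) (Fin n) ℝ :=
  ∑ i, jac φ y i a • conn G' i (φ y)

theorem _root_.RelYamabe.pullConn_mul_apply (M : Matrix (Fin n) (Fin n) ℝ) (a m b : Fin n) :
    (pullConn φ G' a y * M) m b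
      = ∑ i, ∑ j, jac φ y i a * chr G' m i j (φ y) * M j b := by
  simp only [pullConn, Matrix.mul_apply, Matrix.sum_apply, Matrix.smul_apply, smul_eq_mul,
    conn_apply, Finset.sum_mul]
  exact Finset.sum_comm

/-- The transformation law of the Christoffel symbols. -/
theorem jac_mul_conn (h : IsTransition Ω Ω' φ) (hG : IsLocalMetric Ω G)
    (hG' : IsLocalMetric Ω' G')
    (hGG' : ∀ y ∈ Ω, G y = (jac φ y).transpose * G' (φ y) * jac φ y) (hy : y ∈ Ω) (a : Fin n) :
    jac φ y * conn G a y = mderiv (jac φ) a y + pullConn φ G' a y * jac φ y := by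
  have hu := h.isUnit_det hy
  have hy' := h.mapsTo hy
  have hH := h.mem_half hy
  set J := jac φ y with hJ
  -- The candidate connection is `J⁻¹ * N a`. It is torsion free by symmetry of the second
  -- derivatives of `φ`, and metric by differentiating `Jᵀ G' J`; uniqueness of the Levi-Civita
  -- connection identifies it with `conn G a`.
  set N : Fin n → Matrix (Fin n) (Fin n) ℝ := fun a =>
    mderiv (jac φ) a y + pullConn φ G' a y * J with hN
  have hNs : ∀ m a b, N a m b = N b m a := by
    intro m a b
    simp only [hN, Matrix.add_apply]
    rw [h.mderiv_jac_symm hy]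
    congr 1
    rw [pullConn_mul_apply, pullConn_mul_apply, Finset.sum_comm]
    refine Finset.sum_congr rfl fun i _ => Finset.sum_congr rfl fun j _ => ?_
    rw [hG'.chr_symm hy' m j i]; ring
  have hdiffG' : MatDiff (fun z => G' (φ z)) y := fun i j =>
    ((differentiableWithinAt_of_contDiffOn (hG'.contDiffOn i j) hG'.relOpen (by simp)
      hy').comp y ((h.differentiableWithinAt hy).mono h.relOpen.subset)
      h.mapsTo_half).mono_of_mem_nhdsWithin (h.relOpen.mem_nhdsWithin hy)
  have hmet : ∀ a, mderiv G a y = (J⁻¹ * N a).transpose * G y + G y * (J⁻¹ * N a) := by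
    intro a
    rw [mderiv_congr h.relOpen hy (fun z hz => hGG' z hz),
      mderiv_mul hH ((h.matDiff_jac hy).transpose.mul hdiffG') (h.matDiff_jac hy),
      mderiv_mul hH (h.matDiff_jac hy).transpose hdiffG', mderiv_transpose, hGG' y hy,
      mderiv_comp h.relOpen hy h.mapsTo_half (h.differentiableWithinAt hy) (hG'.matDiff hy')]
    have e1 : ∑ i, pderiv (fun z => φ z i) a y • mderiv G' i (φ y)
        = (pullConn φ G' a y).transpose * G' (φ y) + G' (φ y) * pullConn φ G' a y := by
      simp only [pullConn, Matrix.transpose_sum, Matrix.sum_mul, Matrix.mul_sum,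
        Matrix.transpose_smul, Matrix.smul_mul, Matrix.mul_smul, ← Finset.sum_add_distrib]
      refine Finset.sum_congr rfl fun i _ => ?_
      rw [hG'.mderiv_eq hy', smul_add, jac_apply]
    have e2 : J * (J⁻¹ * N a) = N a := Matrix.mul_nonsing_inv_cancel_left _ _ hu
    have e3 : (J⁻¹ * N a).transpose * J.transpose = (N a).transpose := by
      rw [← Matrix.transpose_mul, e2]
    rw [e1, ← hJ]
    have e4 : (J⁻¹ * N a).transpose * (J.transpose * G' (φ y) * J)
        = (N a).transpose * (G' (φ y) * J) := by
      rw [Matrix.mul_assoc J.transpose, ← Matrix.mul_assoc, e3]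
    have e5 : J.transpose * G' (φ y) * J * (J⁻¹ * N a) = J.transpose * G' (φ y) * N a := by
      rw [Matrix.mul_assoc, e2]
    rw [e4, e5]
    simp only [hN, Matrix.transpose_add, Matrix.transpose_mul]
    noncomm_ring
  have := hG.conn_unique hy (C := fun a => J⁻¹ * N a) (fun k a b => by
    simp only [Matrix.mul_apply]
    exact Finset.sum_congr rfl fun m _ => by rw [hNs]) hmet a
  rw [← this, Matrix.mul_nonsing_inv_cancel_left _ _ hu]

/-- The transformation law of the curvature matrices. -/
theorem jac_mul_curv (h : IsTransition Ω Ω' φ) (hG : IsLocalMetric Ω G)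
    (hG' : IsLocalMetric Ω' G')
    (hGG' : ∀ y ∈ Ω, G y = (jac φ y).transpose * G' (φ y) * jac φ y) (hy : y ∈ Ω) (a b : Fin n) :
    jac φ y * curv G a b y
      = (∑ i, ∑ j, (jac φ y i a * jac φ y j b) • curv G' i j (φ y)) * jac φ y := by
  have hy' := h.mapsTo hy
  have hH := h.mem_half hy
  have hconn : ∀ i, MatDiff (fun z => conn G' i (φ z)) y := fun i k l =>
    ((hG'.matDiff_conn hy' i k l).comp y ((h.differentiableWithinAt hy).mono h.relOpen.subset)
      h.mapsTo_half).mono_of_mem_nhdsWithin (h.relOpen.mem_nhdsWithin hy)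
  have hterm : ∀ i b, MatDiff (fun z => jac φ z i b • conn G' i (φ z)) y := fun i b k l =>
    (h.matDiff_jac hy i b).mul (hconn i k l)
  have hpull : ∀ b, MatDiff (pullConn φ G' b) y := fun b k l => by
    simp only [pullConn, Matrix.sum_apply]
    exact DifferentiableWithinAt.fun_sum fun i _ => hterm i b k l
  -- The derivative of the pulled back connection splits into `S`, which carries second derivatives
  -- of `φ` and is symmetric in `a, b`, and `D`, which carries derivatives of `conn G'`.
  -- Antisymmetrization in `a, b` removes `S` and the third derivatives of `φ`.
  set S : Fin n → Fin n → Matrix (Fin n) (Fin n) ℝ := fun a b =>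
    ∑ i, mderiv (jac φ) a y i b • conn G' i (φ y) with hS
  set D : Fin n → Fin n → Matrix (Fin n) (Fin n) ℝ := fun a b =>
    ∑ i, ∑ l, (jac φ y l a * jac φ y i b) • mderiv (conn G' i) l (φ y) with hD
  have hSs : ∀ a b, S a b = S b a := fun a b => by
    simp only [hS]; exact Finset.sum_congr rfl fun i _ => by rw [h.mderiv_jac_symm hy]
  have hdp : ∀ a b, mderiv (pullConn φ G' b) a y = S a b + D a b := by
    intro a b
    have e : mderiv (pullConn φ G' b) a y
        = ∑ i, mderiv (fun z => jac φ z i b • conn G' i (φ z)) a y :=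
      mderiv_sum _ hH (fun i _ => hterm i b) a
    rw [e]
    simp only [hS, hD, ← Finset.sum_add_distrib]
    refine Finset.sum_congr rfl fun i _ => ?_
    rw [mderiv_smul hH (hconn i) (h.matDiff_jac hy i b),
      mderiv_comp h.relOpen hy h.mapsTo_half (h.differentiableWithinAt hy)
        (hG'.matDiff_conn hy' i), Finset.smul_sum]
    congr 1
    exact Finset.sum_congr rfl fun l _ => by rw [smul_smul, mul_comm]; rfl
  have hdiff : ∀ a b, mderiv (jac φ) a y * conn G b y + jac φ y * mderiv (conn G b) a y
      = mderiv (mderiv (jac φ) b) a y + ((S a b + D a b) * jac φ y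
        + pullConn φ G' b y * mderiv (jac φ) a y) := by
    intro a b
    have := mderiv_congr h.relOpen hy (fun z hz => h.jac_mul_conn hG hG' hGG' hz b) a
    rwa [mderiv_mul hH (h.matDiff_jac hy) (hG.matDiff_conn hy b),
      mderiv_add hH (h.matDiff_mderiv_jac hy b) ((hpull b).mul (h.matDiff_jac hy)),
      mderiv_mul hH (hpull b) (h.matDiff_jac hy), hdp] at this
  have hF : ∑ i, ∑ j, (jac φ y i a * jac φ y j b) • curv G' i j (φ y)
      = D a b - D b a + (pullConn φ G' a y * pullConn φ G' b y
        - pullConn φ G' b y * pullConn φ G' a y) := by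
    have e1 : D a b = ∑ i, ∑ j, (jac φ y i a * jac φ y j b) • mderiv (conn G' j) i (φ y) := by
      simp only [hD]; exact Finset.sum_comm
    have e2 : D b a = ∑ i, ∑ j, (jac φ y i a * jac φ y j b) • mderiv (conn G' i) j (φ y) := by
      simp only [hD]
      exact Finset.sum_congr rfl fun i _ => Finset.sum_congr rfl fun j _ => by
        rw [mul_comm (jac φ y j b)]
    have e3 : pullConn φ G' a y * pullConn φ G' b y
        = ∑ i, ∑ j, (jac φ y i a * jac φ y j b) • (conn G' i (φ y) * conn G' j (φ y)) := by
      simp only [pullConn, Finset.sum_mul_sum, smul_mul_smul_comm]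
    have e4 : pullConn φ G' b y * pullConn φ G' a y
        = ∑ i, ∑ j, (jac φ y i a * jac φ y j b) • (conn G' j (φ y) * conn G' i (φ y)) := by
      simp only [pullConn, Finset.sum_mul_sum, smul_mul_smul_comm]
      rw [Finset.sum_comm]
      exact Finset.sum_congr rfl fun i _ => Finset.sum_congr rfl fun j _ => by
        rw [mul_comm (jac φ y j b)]
    rw [e1, e2, e3, e4]
    simp only [← Finset.sum_sub_distrib, ← Finset.sum_add_distrib, curv, ← smul_sub, ← smul_add]
  rw [hF, curv]
  have hab := eq_sub_of_add_eq' (hdiff a b)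
  have hba := eq_sub_of_add_eq' (hdiff b a)
  have ha := h.jac_mul_conn hG hG' hGG' hy a
  have hb := h.jac_mul_conn hG hG' hGG' hy b
  rw [h.mderiv_mderiv_jac_symm hy, hSs] at hab
  rw [Matrix.mul_add, Matrix.mul_sub, Matrix.mul_sub, hab, hba, ← Matrix.mul_assoc, ha,
    ← Matrix.mul_assoc, hb, Matrix.add_mul (mderiv (jac φ) a y),
    Matrix.add_mul (mderiv (jac φ) b y), Matrix.mul_assoc _ _ (conn G b y),
    Matrix.mul_assoc _ _ (conn G a y), ha, hb]
  noncomm_ring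

/-- The Ricci matrix. -/
def _root_.RelYamabe.ricMat (G : Coord n → Matrix (Fin n) (Fin n) ℝ) (y : Coord n) :
    Matrix (Fin n) (Fin n) ℝ :=
  Matrix.of (ric G y)

/-- The Ricci tensor is a tensor. -/
theorem ricMat_eq (h : IsTransition Ω Ω' φ) (hG : IsLocalMetric Ω G)
    (hG' : IsLocalMetric Ω' G')
    (hGG' : ∀ y ∈ Ω, G y = (jac φ y).transpose * G' (φ y) * jac φ y) (hy : y ∈ Ω) :
    ricMat G y = (jac φ y).transpose * ricMat G' (φ y) * jac φ y := by
  have hu := h.isUnit_det hy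
  have hcurv : ∀ a b, curv G a b y = (jac φ y)⁻¹
      * ((∑ i, ∑ j, (jac φ y i a * jac φ y j b) • curv G' i j (φ y)) * jac φ y) := fun a b => by
    rw [← h.jac_mul_curv hG hG' hGG' hy, Matrix.nonsing_inv_mul_cancel_left _ _ hu]
  ext r j
  change ric G y r j = _
  rw [hG.ric_eq_sum_curv hy]
  simp only [hcurv]
  have hinv : ∀ i m, ∑ k, jac φ y i k * (jac φ y)⁻¹ k m = if i = m then 1 else 0 := fun i m => by
    rw [← Matrix.mul_apply, Matrix.mul_nonsing_inv _ hu, Matrix.one_apply]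
  have hr : ∀ p q, (ricMat G' (φ y)) p q = ∑ k, curv G' k q (φ y) k p := fun p q =>
    hG'.ric_eq_sum_curv (h.mapsTo hy) p q
  calc ∑ k, ((jac φ y)⁻¹
      * ((∑ i, ∑ q, (jac φ y i k * jac φ y q j) • curv G' i q (φ y)) * jac φ y)) k r
      = ∑ k, ∑ m, ∑ p, ∑ i, ∑ q, (jac φ y i k * (jac φ y)⁻¹ k m)
          * (jac φ y q j * curv G' i q (φ y) m p * jac φ y p r) := by
        refine Finset.sum_congr rfl fun k _ => ?_
        rw [Matrix.mul_apply]
        refine Finset.sum_congr rfl fun m _ => ?_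
        rw [Matrix.mul_apply, Finset.mul_sum]
        refine Finset.sum_congr rfl fun p _ => ?_
        simp only [Matrix.sum_apply, Matrix.smul_apply, smul_eq_mul, Finset.sum_mul,
          Finset.mul_sum]
        exact Finset.sum_congr rfl fun i _ => Finset.sum_congr rfl fun q _ => by ring
    _ = ∑ m, ∑ p, ∑ i, ∑ q, (∑ k, jac φ y i k * (jac φ y)⁻¹ k m)
          * (jac φ y q j * curv G' i q (φ y) m p * jac φ y p r) := by
        rw [Finset.sum_comm]
        refine Finset.sum_congr rfl fun m _ => ?_
        rw [Finset.sum_comm]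
        refine Finset.sum_congr rfl fun p _ => ?_
        rw [Finset.sum_comm]
        refine Finset.sum_congr rfl fun i _ => ?_
        rw [Finset.sum_comm]
        exact Finset.sum_congr rfl fun q _ => by rw [Finset.sum_mul]
    _ = ∑ m, ∑ p, ∑ q, jac φ y q j * curv G' m q (φ y) m p * jac φ y p r := by
        refine Finset.sum_congr rfl fun m _ => Finset.sum_congr rfl fun p _ => ?_
        simp [hinv, Finset.sum_ite_eq']
    _ = ((jac φ y).transpose * ricMat G' (φ y) * jac φ y) r j := by
        rw [Matrix.mul_assoc, Matrix.mul_apply]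
        simp only [Matrix.mul_apply, Matrix.transpose_apply, hr, Finset.mul_sum, Finset.sum_mul]
        rw [Finset.sum_comm]
        refine Finset.sum_congr rfl fun p _ => ?_
        rw [Finset.sum_comm]
        exact Finset.sum_congr rfl fun q _ => Finset.sum_congr rfl fun m _ => by ring

theorem inv_eq (h : IsTransition Ω Ω' φ)
    (hGG' : ∀ y ∈ Ω, G y = (jac φ y).transpose * G' (φ y) * jac φ y) (hy : y ∈ Ω) :
    (G' (φ y))⁻¹ = jac φ y * (G y)⁻¹ * (jac φ y).transpose := by
  have hu := h.isUnit_det hy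
  have hu' : IsUnit (jac φ y).transpose.det := by rwa [Matrix.det_transpose]
  rw [hGG' y hy, Matrix.mul_inv_rev, Matrix.mul_inv_rev, Matrix.mul_nonsing_inv_cancel_left _ _ hu,
    Matrix.nonsing_inv_mul_cancel_right _ _ hu']

end IsTransition

/-- The divergence of a vector field with components `U`. -/
def divg (G : Coord n → Matrix (Fin n) (Fin n) ℝ) (U : Fin n → Coord n → ℝ) (y : Coord n) : ℝ :=
  ∑ k, (pderiv (U k) k y + ∑ l, chr G l k l y * U k y)

theorem IsLocalMetric.density_mul_divg (hG : IsLocalMetric Ω G) {U : Fin n → Coord n → ℝ}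
    (hy : y ∈ Ω) (hU : ∀ k, DifferentiableWithinAt ℝ (U k) (halfSpace n) y) :
    ∑ k, pderiv (fun z => density G z * U k z) k y = density G y * divg G U y := by
  rw [divg, Finset.mul_sum]
  refine Finset.sum_congr rfl fun k _ => ?_
  rw [pderiv_mul (hG.mem_half hy) (differentiableWithinAt_of_contDiffOn hG.contDiffOn_density
    hG.relOpen (by simp) hy) (hU k), hG.pderiv_density hy, ← Finset.sum_mul]
  ring

/-- Symmetry of the connection turns the divergence into the trace of the matrix of `∇U`. The
matrices of `∇U` in two charts are conjugate by the Jacobian, so their traces agree. -/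
theorem IsLocalMetric.divg_eq_trace (hG : IsLocalMetric Ω G) {U : Fin n → Coord n → ℝ}
    (hy : y ∈ Ω) :
    divg G U y = ∑ k, (pderiv (U k) k y + ∑ l, chr G k k l y * U l y) := by
  simp only [divg, Finset.sum_add_distrib]
  congr 1
  rw [Finset.sum_comm]
  exact Finset.sum_congr rfl fun k _ => Finset.sum_congr rfl fun l _ => by
    rw [hG.chr_symm hy k l k]

/-- The divergence is independent of the coordinates. -/
theorem IsTransition.divg_eq (h : IsTransition Ω Ω' φ) (hG : IsLocalMetric Ω G)
    (hG' : IsLocalMetric Ω' G')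
    (hGG' : ∀ y ∈ Ω, G y = (jac φ y).transpose * G' (φ y) * jac φ y)
    {U U' : Fin n → Coord n → ℝ} (hU : ∀ k, ContDiffOn ℝ 1 (U k) Ω)
    (hU' : ∀ k, ContDiffOn ℝ 1 (U' k) Ω')
    (hUU' : ∀ y ∈ Ω, ∀ m, U' m (φ y) = ∑ k, jac φ y m k * U k y) (hy : y ∈ Ω) :
    divg G' U' (φ y) = divg G U y := by
  have hy' := h.mapsTo hy
  have hH := h.mem_half hy
  set u : Coord n → Matrix (Fin n) (Fin 1) ℝ := fun z => Matrix.of fun k _ => U k z with hu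
  set u' : Coord n → Matrix (Fin n) (Fin 1) ℝ := fun z => Matrix.of fun k _ => U' k z with hu'
  have hud : MatDiff u y := fun k _ =>
    differentiableWithinAt_of_contDiffOn (hU k) h.relOpen (by simp) hy
  have hud' : MatDiff u' (φ y) := fun k _ =>
    differentiableWithinAt_of_contDiffOn (hU' k) h.relOpen' (by simp) hy'
  have huu : EqOn (fun z => u' (φ z)) (fun z => jac φ z * u z) Ω := fun z hz => by
    ext m j
    simp only [hu, hu', Matrix.of_apply, Matrix.mul_apply]
    exact hUU' z hz m
  set N : Matrix (Fin n) (Fin n) ℝ := Matrix.of fun k a => (mderiv u a y + conn G a y * u y) k 0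
  set N' : Matrix (Fin n) (Fin n) ℝ := Matrix.of fun k a =>
    (mderiv u' a (φ y) + conn G' a (φ y) * u' (φ y)) k 0
  have hcol : ∀ a, jac φ y * (mderiv u a y + conn G a y * u y)
      = ∑ i, jac φ y i a • (mderiv u' i (φ y) + conn G' i (φ y) * u' (φ y)) := by
    intro a
    have h1 := mderiv_congr h.relOpen hy huu a
    rw [mderiv_comp h.relOpen hy h.mapsTo_half (h.differentiableWithinAt hy) hud',
      mderiv_mul hH (h.matDiff_jac hy) hud] at h1
    simp only [smul_add, Finset.sum_add_distrib, jac_apply]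
    rw [h1, Matrix.mul_add, ← Matrix.mul_assoc, h.jac_mul_conn hG hG' hGG' hy, Matrix.add_mul,
      Matrix.mul_assoc, show u' (φ y) = jac φ y * u y from huu hy]
    simp only [pullConn, Matrix.sum_mul, Matrix.smul_mul, jac_apply]
    abel
  have hN : jac φ y * N = N' * jac φ y := by
    ext m a
    rw [show (jac φ y * N) m a = (jac φ y * (mderiv u a y + conn G a y * u y)) m 0 from rfl,
      hcol a, Matrix.mul_apply, Matrix.sum_apply]
    exact Finset.sum_congr rfl fun i _ => mul_comm _ _
  have ht : divg G U y = N.trace := hG.divg_eq_trace hy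
  have ht' : divg G' U' (φ y) = N'.trace := hG'.divg_eq_trace hy'
  have hi := h.isUnit_det hy
  rw [ht, ht', ← Matrix.nonsing_inv_mul_cancel_left (jac φ y) N hi, hN, Matrix.trace_mul_comm,
    Matrix.mul_nonsing_inv_cancel_right _ _ hi]

/-- The inverse of the induced metric on the hypersurfaces `y 0 = const`. -/
def tanInv (G : Coord n → Matrix (Fin n) (Fin n) ℝ) (y : Coord n) : Matrix (Fin n) (Fin n) ℝ :=
  Matrix.of fun i j => (G y)⁻¹ i j - (G y)⁻¹ i 0 * (G y)⁻¹ j 0 / (G y)⁻¹ 0 0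

/-- A positive multiple of the mean curvature. -/
def hsum (G : Coord n → Matrix (Fin n) (Fin n) ℝ) (y : Coord n) : ℝ :=
  ∑ i, ∑ j, tanInv G y i j * chr G 0 i j y

theorem IsLocalMetric.inv_zero_zero_pos (hG : IsLocalMetric Ω G) (hy : y ∈ Ω) :
    0 < (G y)⁻¹ 0 0 := (hG.posDef y hy).inv.diag_pos

theorem IsLocalMetric.tanInv_zero_right (hG : IsLocalMetric Ω G) (hy : y ∈ Ω) (i : Fin n) :
    tanInv G y i 0 = 0 := by
  have := (hG.inv_zero_zero_pos hy).ne'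
  simp [tanInv, this]

theorem IsLocalMetric.tanInv_symm (hG : IsLocalMetric Ω G) (hy : y ∈ Ω) (i j : Fin n) :
    tanInv G y i j = tanInv G y j i := by
  simp [tanInv, hG.inv_symm hy i j, mul_comm]

theorem IsLocalMetric.tanInv_zero_left (hG : IsLocalMetric Ω G) (hy : y ∈ Ω) (i : Fin n) :
    tanInv G y 0 i = 0 := by
  rw [hG.tanInv_symm hy, hG.tanInv_zero_right hy]

namespace IsTransition

/-- The component `φ⁰` vanishes along the boundary, and with it all its tangential derivatives. -/
theorem jac_zero_of_boundary (h : IsTransition Ω Ω' φ) (hy : y ∈ Ω) (hy0 : y 0 = 0) {a : Fin n}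
    (ha : a ≠ 0) : jac φ y 0 a = 0 := by
  have := pderiv_congr_boundary h.relOpen hy hy0 (f := fun z => φ z 0) (f' := fun _ => 0)
    (differentiableWithinAt_of_contDiffOn (h.contDiffOn_comp 0) h.relOpen (by simp) hy)
    (differentiableWithinAt_const 0) (fun z hz hz0 => h.boundary z hz hz0) ha
  rw [jac_apply, this, pderiv_const]

theorem jac_zero_zero_ne_zero (h : IsTransition Ω Ω' φ) (hy : y ∈ Ω) (hy0 : y 0 = 0) :
    jac φ y 0 0 ≠ 0 := by
  intro h0
  refine h.det_ne_zero y hy (Matrix.det_eq_zero_of_row_eq_zero 0 fun a => ?_)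
  by_cases ha : a = 0
  · rw [ha, h0]
  · exact h.jac_zero_of_boundary hy hy0 ha

theorem mderiv_jac_zero_of_boundary (h : IsTransition Ω Ω' φ) (hy : y ∈ Ω) (hy0 : y 0 = 0)
    {a b : Fin n} (ha : a ≠ 0) (hb : b ≠ 0) : mderiv (jac φ) a y 0 b = 0 := by
  have := pderiv_congr_boundary h.relOpen hy hy0 (f := fun z => jac φ z 0 b) (f' := fun _ => 0)
    (h.matDiff_jac hy 0 b) (differentiableWithinAt_const 0)
    (fun z hz hz0 => h.jac_zero_of_boundary hz hz0 hb) ha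
  rw [mderiv_apply, this, pderiv_const]

theorem inv_zero_eq (h : IsTransition Ω Ω' φ)
    (hGG' : ∀ y ∈ Ω, G y = (jac φ y).transpose * G' (φ y) * jac φ y) (hy : y ∈ Ω)
    (hy0 : y 0 = 0) (i : Fin n) :
    (G' (φ y))⁻¹ i 0 = jac φ y 0 0 * ∑ a, jac φ y i a * (G y)⁻¹ a 0 := by
  rw [h.inv_eq hGG' hy, Matrix.mul_apply, Finset.sum_eq_single 0]
  · rw [Matrix.transpose_apply, Matrix.mul_apply, mul_comm]
  · intro b _ hb
    rw [Matrix.transpose_apply, h.jac_zero_of_boundary hy hy0 hb, mul_zero]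
  · simp

theorem tanInv_eq (h : IsTransition Ω Ω' φ) (hG : IsLocalMetric Ω G)
    (hG' : IsLocalMetric Ω' G')
    (hGG' : ∀ y ∈ Ω, G y = (jac φ y).transpose * G' (φ y) * jac φ y) (hy : y ∈ Ω)
    (hy0 : y 0 = 0) (i j : Fin n) :
    tanInv G' (φ y) i j = ∑ a, ∑ b, jac φ y i a * jac φ y j b * tanInv G y a b := by
  have hl := h.jac_zero_zero_ne_zero hy hy0
  have hp := (hG.inv_zero_zero_pos hy).ne'
  have h00 : (G' (φ y))⁻¹ 0 0 = jac φ y 0 0 ^ 2 * (G y)⁻¹ 0 0 := by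
    rw [h.inv_zero_eq hGG' hy hy0, Finset.sum_eq_single 0]
    · ring
    · intro b _ hb
      rw [h.jac_zero_of_boundary hy hy0 hb, zero_mul]
    · simp
  have e : (G' (φ y))⁻¹ i j = ∑ a, ∑ b, jac φ y i a * jac φ y j b * (G y)⁻¹ a b := by
    rw [h.inv_eq hGG' hy, Matrix.mul_apply]
    simp only [Matrix.mul_apply, Matrix.transpose_apply, Finset.sum_mul]
    rw [Finset.sum_comm]
    exact Finset.sum_congr rfl fun a _ => Finset.sum_congr rfl fun b _ => by ring
  simp only [tanInv, Matrix.of_apply]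
  rw [e, h00, h.inv_zero_eq hGG' hy hy0, h.inv_zero_eq hGG' hy hy0]
  have e2 : ∑ a, ∑ b, jac φ y i a * jac φ y j b
        * ((G y)⁻¹ a b - (G y)⁻¹ a 0 * (G y)⁻¹ b 0 / (G y)⁻¹ 0 0)
      = ∑ a, ∑ b, jac φ y i a * jac φ y j b * (G y)⁻¹ a b
        - (∑ a, jac φ y i a * (G y)⁻¹ a 0) * (∑ b, jac φ y j b * (G y)⁻¹ b 0) / (G y)⁻¹ 0 0 := by
    rw [Finset.sum_mul_sum, Finset.sum_div, ← Finset.sum_sub_distrib]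
    refine Finset.sum_congr rfl fun a _ => ?_
    rw [Finset.sum_div, ← Finset.sum_sub_distrib]
    exact Finset.sum_congr rfl fun b _ => by ring
  rw [e2]
  congr 1
  field_simp

/-- The vanishing of the mean curvature is independent of the coordinates. -/
theorem hsum_eq (h : IsTransition Ω Ω' φ) (hG : IsLocalMetric Ω G)
    (hG' : IsLocalMetric Ω' G')
    (hGG' : ∀ y ∈ Ω, G y = (jac φ y).transpose * G' (φ y) * jac φ y) (hy : y ∈ Ω)
    (hy0 : y 0 = 0) : hsum G' (φ y) = jac φ y 0 0 * hsum G y := by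
  have hc : ∀ a b, ∑ i, ∑ j, jac φ y i a * jac φ y j b * chr G' 0 i j (φ y)
      = jac φ y 0 0 * chr G 0 a b y - mderiv (jac φ) a y 0 b := by
    intro a b
    have := congrFun (congrFun (h.jac_mul_conn hG hG' hGG' hy a) 0) b
    rw [Matrix.mul_apply, Finset.sum_eq_single 0 (fun k _ hk => by
      rw [h.jac_zero_of_boundary hy hy0 hk, zero_mul]) (by simp), Matrix.add_apply] at this
    rw [← conn_apply, this, add_sub_cancel_left]
    rw [pullConn_mul_apply]
    exact Finset.sum_congr rfl fun i _ => Finset.sum_congr rfl fun j _ => by ring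
  -- The inhomogeneous term of the Christoffel law does not contribute: `tanInv` only sees
  -- tangential indices, and the tangential second derivatives of `φ⁰` vanish on the boundary.
  have hz : ∀ a b, tanInv G y a b * mderiv (jac φ) a y 0 b = 0 := by
    intro a b
    by_cases ha : a = 0
    · rw [ha, hG.tanInv_zero_left hy, zero_mul]
    by_cases hb : b = 0
    · rw [hb, hG.tanInv_zero_right hy, zero_mul]
    rw [h.mderiv_jac_zero_of_boundary hy hy0 ha hb, mul_zero]
  calc hsum G' (φ y)
      = ∑ i, ∑ j, ∑ a, ∑ b, tanInv G y a b
          * (jac φ y i a * jac φ y j b * chr G' 0 i j (φ y)) := by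
        unfold hsum
        refine Finset.sum_congr rfl fun i _ => Finset.sum_congr rfl fun j _ => ?_
        rw [h.tanInv_eq hG hG' hGG' hy hy0, Finset.sum_mul]
        refine Finset.sum_congr rfl fun a _ => ?_
        rw [Finset.sum_mul]
        exact Finset.sum_congr rfl fun b _ => by ring
    _ = ∑ a, ∑ b, tanInv G y a b
          * ∑ i, ∑ j, jac φ y i a * jac φ y j b * chr G' 0 i j (φ y) := by
        simp only [Finset.mul_sum]
        exact sum_comm₄ _
    _ = jac φ y 0 0 * hsum G y := by
        unfold hsum
        rw [Finset.mul_sum]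
        refine Finset.sum_congr rfl fun a _ => ?_
        rw [Finset.mul_sum]
        refine Finset.sum_congr rfl fun b _ => ?_
        rw [hc, mul_sub, hz]; ring

end IsTransition

end Transition

theorem RelOpen.inter_preimage {n : ℕ} [NeZero n] {Ω : Set (Coord n)} (h : RelOpen Ω)
    {X : Type*} [TopologicalSpace X] {f : Coord n → X} (hf : ContinuousOn f Ω) {V : Set X}
    (hV : IsOpen V) : RelOpen (Ω ∩ f ⁻¹' V) := by
  obtain ⟨U, hU, hU'⟩ := continuousOn_iff'.1 hf V hV
  obtain ⟨U₀, hU₀, rfl⟩ := h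
  refine ⟨U ∩ U₀, hU.inter hU₀, ?_⟩
  rw [inter_comm, hU', inter_assoc]

theorem RelOpen.mem_interior_iff {n : ℕ} [NeZero n] {Ω : Set (Coord n)} (h : RelOpen Ω)
    {y : Coord n} (hy : y ∈ Ω) : y ∈ interior Ω ↔ 0 < y 0 := by
  obtain ⟨U, hU, rfl⟩ := h
  rw [interior_inter, hU.interior_eq, interior_halfSpace_eq]
  exact ⟨fun h => h.2, fun h => ⟨hy.1, h⟩⟩

theorem jac_comp {n : ℕ} [NeZero n] {Ω : Set (Coord n)} {φ ψ : Coord n → Coord n} {y : Coord n}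
    (h : RelOpen Ω) (hy : y ∈ Ω)
    (hφ : MapsTo φ Ω (halfSpace n)) (hφd : DifferentiableWithinAt ℝ φ (halfSpace n) y)
    (hψ : DifferentiableWithinAt ℝ ψ (halfSpace n) (φ y)) :
    jac (fun z => ψ (φ z)) y = jac ψ (φ y) * jac φ y := by
  ext i a
  rw [jac_apply, Matrix.mul_apply]
  have hψi : DifferentiableWithinAt ℝ (fun z => ψ z i) (halfSpace n) (φ y) :=
    (hasFDerivWithinAt_euclidean.1 hψ.hasFDerivWithinAt i).differentiableWithinAt
  rw [pderiv_comp h hy hφ hφd hψi]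
  exact Finset.sum_congr rfl fun k _ => mul_comm _ _

theorem jac_congr {n : ℕ} [NeZero n] {Ω : Set (Coord n)} {φ ψ : Coord n → Coord n} {y : Coord n}
    (h : RelOpen Ω) (hy : y ∈ Ω) (he : EqOn φ ψ Ω) : jac φ y = jac ψ y := by
  ext i a
  exact pderiv_congr h hy (fun z hz => by simp [he hz]) a

theorem jac_id {n : ℕ} [NeZero n] {y : Coord n} (hy : y ∈ halfSpace n) :
    jac (fun z : Coord n => z) y = 1 := by
  ext i a
  rw [jac_apply, pderiv_def]
  have h1 : HasFDerivWithinAt (fun z : Coord n => z i) (PiLp.proj 2 (fun _ => ℝ) i :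
      Coord n →L[ℝ] ℝ) (halfSpace n) y :=
    (PiLp.proj 2 (fun _ : Fin n => ℝ) i : Coord n →L[ℝ] ℝ).hasFDerivWithinAt
  rw [h1.fderivWithin (uniqueDiffOn_halfSpace y hy)]
  simp [Matrix.one_apply]

theorem fderivWithin_single {n : ℕ} [NeZero n] {φ : Coord n → Coord n} {y : Coord n}
    (hy : y ∈ halfSpace n) (hφ : DifferentiableWithinAt ℝ φ (halfSpace n) y) (i k : Fin n) :
    fderivWithin ℝ φ (halfSpace n) y (EuclideanSpace.single i 1) k = jac φ y k i := by
  have := (hasFDerivWithinAt_euclidean.1 hφ.hasFDerivWithinAt k).fderivWithin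
    (uniqueDiffOn_halfSpace y hy)
  rw [jac_apply, pderiv_def, this]; rfl

/-! ### Charts of the manifold and metric coefficients -/

section Charts

variable {n : ℕ} [NeZero n] {W : Type*} [TopologicalSpace W]
  [ChartedSpace (EuclideanHalfSpace n) W]

/-- The change of coordinates between the charts around `c` and `c'`. -/
def trans (c c' : W) (y : Coord n) : Coord n :=
  extChartAt (𝓡∂ n) c' ((extChartAt (𝓡∂ n) c).symm y)

/-- The domain of the change of coordinates. -/
def overlap (c c' : W) : Set (Coord n) :=
  (extChartAt (𝓡∂ n) c).target ∩ (extChartAt (𝓡∂ n) c).symm ⁻¹' (extChartAt (𝓡∂ n) c').source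

theorem relOpen_target (c : W) : RelOpen (extChartAt (𝓡∂ n) c).target := by
  rw [extChartAt_target]
  exact ⟨_, (chartAt (EuclideanHalfSpace n) c).open_target.preimage (𝓡∂ n).continuous_symm, rfl⟩

theorem overlap_eq_source (c c' : W) :
    overlap (n := n) c c'
      = ((extChartAt (𝓡∂ n) c).symm.trans (extChartAt (𝓡∂ n) c')).source := by
  rw [PartialEquiv.trans_source, PartialEquiv.symm_source]; rfl

theorem relOpen_overlap (c c' : W) : RelOpen (overlap (n := n) c c') :=
  (relOpen_target c).inter_preimage (continuousOn_extChartAt_symm c) (isOpen_extChartAt_source c')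

theorem mem_overlap {c c' x : W} (hc : x ∈ (extChartAt (𝓡∂ n) c).source)
    (hc' : x ∈ (extChartAt (𝓡∂ n) c').source) : extChartAt (𝓡∂ n) c x ∈ overlap c c' :=
  ⟨(extChartAt (𝓡∂ n) c).map_source hc, by
    rw [mem_preimage, (extChartAt (𝓡∂ n) c).left_inv hc]; exact hc'⟩

theorem trans_mem {c c' : W} {y : Coord n} (hy : y ∈ overlap c c') :
    trans c c' y ∈ overlap c' c :=
  mem_overlap hy.2 ((extChartAt (𝓡∂ n) c).map_target hy.1)

theorem symm_trans {c c' : W} {y : Coord n} (hy : y ∈ overlap c c') :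
    (extChartAt (𝓡∂ n) c').symm (trans c c' y) = (extChartAt (𝓡∂ n) c).symm y :=
  (extChartAt (𝓡∂ n) c').left_inv hy.2

theorem trans_trans_self {c c' : W} {y : Coord n} (hy : y ∈ overlap c c') :
    trans c' c (trans c c' y) = y := by
  rw [trans, symm_trans hy]
  exact (extChartAt (𝓡∂ n) c).right_inv hy.1

theorem trans_trans {c c' c'' : W} {y : Coord n} (hy : y ∈ overlap c c') :
    trans c' c'' (trans c c' y) = trans c c'' y := by
  rw [trans, symm_trans hy]; rfl

theorem mapsTo_trans (c c' : W) : MapsTo (trans c c') (overlap c c') (halfSpace n) := fun _ hy =>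
  (relOpen_overlap c' c).subset (trans_mem hy)

theorem jac_trans_self {c : W} {y : Coord n} (hy : y ∈ (extChartAt (𝓡∂ n) c).target) :
    jac (trans c c) y = 1 := by
  have e : EqOn (trans c c) (fun z => z) (extChartAt (𝓡∂ n) c).target :=
    fun z hz => (extChartAt (𝓡∂ n) c).right_inv hz
  rw [jac_congr (relOpen_target c) hy e, jac_id ((relOpen_target c).subset hy)]

variable [IsManifold (𝓡∂ n) ∞ W]

theorem contDiffOn_trans (c c' : W) : ContDiffOn ℝ ∞ (trans (n := n) c c') (overlap c c') := by
  rw [overlap_eq_source]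
  exact contDiffOn_ext_coord_change c' c

/-- Boundary points are defined through the preferred chart at `x`; invariance of interior points
for a smooth structure allows any chart containing `x` to detect them. -/
theorem mem_boundary_iff {c x : W} (hx : x ∈ (extChartAt (𝓡∂ n) c).source) :
    x ∈ (𝓡∂ n).boundary W ↔ extChartAt (𝓡∂ n) c x 0 = 0 := by
  have h1 := (𝓡∂ n).isInteriorPoint_iff_of_mem_atlas (n := ∞) (by simp)
    (chart_mem_atlas (EuclideanHalfSpace n) c) (x := x) (by rwa [extChartAt_source] at hx)
  have h2 := (relOpen_target c).mem_interior_iff ((extChartAt (𝓡∂ n) c).map_source hx)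
  have h3 : 0 ≤ extChartAt (𝓡∂ n) c x 0 :=
    mem_halfSpace.1 ((relOpen_target c).subset ((extChartAt (𝓡∂ n) c).map_source hx))
  change (𝓡∂ n).IsBoundaryPoint x ↔ _
  rw [← not_iff_not, ← ModelWithCorners.isInteriorPoint_iff_not_isBoundaryPoint, h1]
  change extChartAt (𝓡∂ n) c x ∈ interior (extChartAt (𝓡∂ n) c).target ↔ _
  rw [h2]
  exact ⟨fun h => h.ne', fun h => lt_of_le_of_ne h3 (Ne.symm h)⟩

theorem differentiableWithinAt_trans {c c' : W} {y : Coord n} (hy : y ∈ overlap c c') :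
    DifferentiableWithinAt ℝ (trans c c') (halfSpace n) y :=
  differentiableWithinAt_of_contDiffOn (contDiffOn_trans c c') (relOpen_overlap c c') (by simp) hy

theorem jac_trans_mul {c c' c'' : W} {y : Coord n} (hy : y ∈ overlap c c')
    (hy' : y ∈ overlap c c'') :
    jac (trans c c'') y = jac (trans c' c'') (trans c c' y) * jac (trans c c') y := by
  have hy'' : trans c c' y ∈ overlap c' c'' :=
    ⟨(trans_mem hy).1, by rw [mem_preimage, symm_trans hy]; exact hy'.2⟩
  rw [← jac_comp (relOpen_overlap c c') hy (mapsTo_trans c c') (differentiableWithinAt_trans hy)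
    (differentiableWithinAt_trans hy'')]
  exact jac_congr (relOpen_overlap c c') hy (fun z hz => (trans_trans hz).symm)

theorem jac_trans_mul_inv {c c' : W} {y : Coord n} (hy : y ∈ overlap c c') :
    jac (trans c' c) (trans c c' y) * jac (trans c c') y = 1 := by
  rw [← jac_trans_mul hy ⟨hy.1, (extChartAt (𝓡∂ n) c).map_target hy.1⟩, jac_trans_self hy.1]

theorem isTransition (c c' : W) :
    IsTransition (overlap c c') (extChartAt (𝓡∂ n) c').target (trans c c') where
  relOpen := relOpen_overlap c c'
  relOpen' := relOpen_target c'
  contDiffOn := (contDiffOn_trans c c').of_le (by norm_cast)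
  mapsTo := fun _ hy => (trans_mem hy).1
  det_ne_zero := fun y hy h0 => by
    have := congrArg Matrix.det (jac_trans_mul_inv hy)
    rw [Matrix.det_mul, h0, mul_zero, Matrix.det_one] at this
    exact zero_ne_one this
  boundary := fun y hy hy0 => by
    rw [trans, ← mem_boundary_iff hy.2,
      mem_boundary_iff ((extChartAt (𝓡∂ n) c).map_target hy.1),
      (extChartAt (𝓡∂ n) c).right_inv hy.1, hy0]

/-- The inner product at `x` in terms of components in the chart around `x`. -/
def inn (g : SmoothMetric n W) (x : W) : Coord n →L[ℝ] Coord n →L[ℝ] ℝ := g.inner x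

/-- A tangent vector at `x` is stored by its components in the preferred chart at `x`. The
differential of the inverse chart around `c` is therefore a differential of the transition map from
`c` to `x`. -/
theorem coordVec_eq (c : W) (i : Fin n) {y : Coord n} (hy : y ∈ (extChartAt (𝓡∂ n) c).target) :
    (coordVec c i y : Coord n) = fderivWithin ℝ (trans c ((extChartAt (𝓡∂ n) c).symm y))
      (halfSpace n) y (EuclideanSpace.single i 1) := by
  have hm : MDifferentiableWithinAt 𝓘(ℝ, Coord n) (𝓡∂ n) (extChartAt (𝓡∂ n) c).symm
      (range (𝓡∂ n)) y := by
    have := ((contMDiffOn_extChartAt_symm (I := 𝓡∂ n) (n := ∞) c) y hy).mdifferentiableWithinAt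
      (by simp)
    exact this.mono_of_mem_nhdsWithin ((relOpen_target c).mem_nhdsWithin hy)
  have h1 := congrArg (fun L : Coord n →L[ℝ] Coord n => L (EuclideanSpace.single i 1))
    hm.mfderivWithin
  refine h1.trans ?_
  simp only [writtenInExtChartAt, mfld_simps]
  rfl

theorem gram_eq (g : SmoothMetric n W) (c : W) {y : Coord n}
    (hy : y ∈ (extChartAt (𝓡∂ n) c).target) (i j : Fin n) :
    gram g c y i j = inn g ((extChartAt (𝓡∂ n) c).symm y)
      (fderivWithin ℝ (trans c ((extChartAt (𝓡∂ n) c).symm y)) (halfSpace n) y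
        (EuclideanSpace.single i 1))
      (fderivWithin ℝ (trans c ((extChartAt (𝓡∂ n) c).symm y)) (halfSpace n) y
        (EuclideanSpace.single j 1)) := by
  rw [← coordVec_eq c i hy, ← coordVec_eq c j hy]; rfl

/-- The matrix of the inner product at `x` in the chart around `x`. -/
def innMat (g : SmoothMetric n W) (x : W) : Matrix (Fin n) (Fin n) ℝ :=
  Matrix.of fun k l => inn g x (EuclideanSpace.single k 1) (EuclideanSpace.single l 1)

theorem inn_eq_sum (g : SmoothMetric n W) (x : W) (v w : Coord n) :
    inn g x v w = ∑ k, ∑ l, v k * innMat g x k l * w l := by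
  conv_lhs => rw [← (EuclideanSpace.basisFun (Fin n) ℝ).sum_repr v,
    ← (EuclideanSpace.basisFun (Fin n) ℝ).sum_repr w]
  simp only [map_sum, map_smul, sum_apply, smul_apply, EuclideanSpace.basisFun_repr,
    EuclideanSpace.basisFun_apply, smul_eq_mul, innMat, Matrix.of_apply, Finset.mul_sum]
  rw [Finset.sum_comm]
  exact Finset.sum_congr rfl fun k _ => Finset.sum_congr rfl fun l _ => by ring

/-- The chart around `c` is compared with the preferred chart at `x`. Two such comparisons at the
same point give the transformation law between arbitrary charts. -/
theorem gram_eq_innMat (g : SmoothMetric n W) {c x : W} (hx : x ∈ (extChartAt (𝓡∂ n) c).source) :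
    gram g c (extChartAt (𝓡∂ n) c x) = (jac (trans c x) (extChartAt (𝓡∂ n) c x)).transpose
      * innMat g x * jac (trans c x) (extChartAt (𝓡∂ n) c x) := by
  have hy := (extChartAt (𝓡∂ n) c).map_source hx
  ext i j
  rw [gram_eq g c hy, inn_eq_sum, (extChartAt (𝓡∂ n) c).left_inv hx, Matrix.mul_assoc,
    Matrix.mul_apply]
  have hd := differentiableWithinAt_trans (mem_overlap hx (mem_extChartAt_source (I := 𝓡∂ n) x))
  refine Finset.sum_congr rfl fun k _ => ?_
  rw [Matrix.mul_apply, Finset.mul_sum]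
  refine Finset.sum_congr rfl fun l _ => ?_
  rw [fderivWithin_single ((relOpen_target c).subset hy) hd,
    fderivWithin_single ((relOpen_target c).subset hy) hd, Matrix.transpose_apply]
  ring

theorem gram_self (g : SmoothMetric n W) (x : W) :
    gram g x (extChartAt (𝓡∂ n) x x) = innMat g x := by
  rw [gram_eq_innMat g (mem_extChartAt_source x), jac_trans_self (mem_extChartAt_target x)]
  simp

/-- The transformation law of the metric coefficients. -/
theorem gram_trans (g : SmoothMetric n W) {c c' : W} {y : Coord n} (hy : y ∈ overlap c c') :
    gram g c y = (jac (trans c c') y).transpose * gram g c' (trans c c' y)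
      * jac (trans c c') y := by
  set x := (extChartAt (𝓡∂ n) c).symm y with hx
  have hxc : x ∈ (extChartAt (𝓡∂ n) c).source := (extChartAt (𝓡∂ n) c).map_target hy.1
  have hxc' : x ∈ (extChartAt (𝓡∂ n) c').source := hy.2
  have e : extChartAt (𝓡∂ n) c x = y := (extChartAt (𝓡∂ n) c).right_inv hy.1
  have e' : extChartAt (𝓡∂ n) c' x = trans c c' y := rfl
  have h1 := gram_eq_innMat g hxc
  have h2 := gram_eq_innMat g hxc'
  rw [e] at h1
  rw [e'] at h2
  have h3 : y ∈ overlap c x := ⟨hy.1, mem_extChartAt_source (I := 𝓡∂ n) x⟩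
  rw [h1, h2, jac_trans_mul hy h3, Matrix.transpose_mul]
  simp only [Matrix.mul_assoc]

theorem innMat_posDef (g : SmoothMetric n W) (x : W) : (innMat g x).PosDef := by
  refine Matrix.PosDef.of_dotProduct_mulVec_pos ?_ fun v hv => ?_
  · ext i j
    exact g.symm x _ _
  · have h1 : star v ⬝ᵥ (innMat g x).mulVec v = inn g x (WithLp.toLp 2 v) (WithLp.toLp 2 v) := by
      rw [inn_eq_sum]
      simp only [dotProduct, Matrix.mulVec, Finset.mul_sum, Pi.star_apply, star_trivial]
      exact Finset.sum_congr rfl fun k _ => Finset.sum_congr rfl fun l _ => by ring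
    rw [h1]
    refine g.pos x _ fun h => hv ?_
    have : (WithLp.toLp 2 v : Coord n) = 0 := h
    simpa using this

theorem gram_posDef (g : SmoothMetric n W) {c : W} {y : Coord n}
    (hy : y ∈ (extChartAt (𝓡∂ n) c).target) : (gram g c y).PosDef := by
  set x := (extChartAt (𝓡∂ n) c).symm y with hx
  have hxc : x ∈ (extChartAt (𝓡∂ n) c).source := (extChartAt (𝓡∂ n) c).map_target hy
  have e : extChartAt (𝓡∂ n) c x = y := (extChartAt (𝓡∂ n) c).right_inv hy
  have h1 := gram_eq_innMat g hxc
  have h3 : y ∈ overlap c x := ⟨hy, mem_extChartAt_source (I := 𝓡∂ n) x⟩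
  rw [e] at h1
  rw [h1, ← Matrix.conjTranspose_eq_transpose_of_trivial]
  refine (innMat_posDef g x).conjTranspose_mul_mul_same ?_
  exact Matrix.mulVec_injective_iff_isUnit.2
    ((Matrix.isUnit_iff_isUnit_det _).2 ((isTransition c x).isUnit_det h3))

/-- The tangent map of the inverse chart makes the coordinate fields smooth sections of the tangent
bundle, and the metric is a smooth section of bilinear forms; the coefficients are its values on
those sections. -/
theorem contDiffOn_gram (g : SmoothMetric n W) (c : W) (i j : Fin n) :
    ContDiffOn ℝ ∞ (fun y => gram g c y i j) (extChartAt (𝓡∂ n) c).target := by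
  have hv : ∀ i : Fin n, ContMDiffOn 𝓘(ℝ, Coord n) (𝓡∂ n).tangent ∞
      (fun y => (⟨(extChartAt (𝓡∂ n) c).symm y, coordVec c i y⟩ : TangentBundle (𝓡∂ n) W))
      (extChartAt (𝓡∂ n) c).target := by
    intro i
    have h1 := (contMDiffOn_extChartAt_symm (I := 𝓡∂ n) (n := ∞) c).contMDiffOn_tangentMapWithin
      (m := ∞) (by simp) (relOpen_target c).uniqueDiffOn.uniqueMDiffOn
    have h2 : ContMDiffOn 𝓘(ℝ, Coord n) 𝓘(ℝ, Coord n).tangent ∞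
        (fun y : Coord n => (⟨y, (EuclideanSpace.single i 1 : Coord n)⟩ :
          TangentBundle 𝓘(ℝ, Coord n) (Coord n))) (extChartAt (𝓡∂ n) c).target := fun y _ =>
      (contMDiffWithinAt_vectorSpace_iff_contDiffWithinAt
        (V := fun _ : Coord n => (EuclideanSpace.single i 1 : Coord n))).2
        contDiffWithinAt_const
    refine (h1.comp h2 fun y hy => hy).congr fun y hy => ?_
    have h3 : fderivWithin ℝ (trans c ((extChartAt (𝓡∂ n) c).symm y))
        (extChartAt (𝓡∂ n) c).target y = mfderivWithin 𝓘(ℝ, Coord n) (𝓡∂ n)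
        (extChartAt (𝓡∂ n) c).symm (extChartAt (𝓡∂ n) c).target y := by
      have := ((contMDiffOn_extChartAt_symm (I := 𝓡∂ n) (n := ∞) c) y hy).mdifferentiableWithinAt
        (by simp)
      refine Eq.symm (Eq.trans this.mfderivWithin ?_)
      simp only [writtenInExtChartAt, mfld_simps]
      rfl
    simp only [tangentMapWithin, Function.comp_apply]
    congr 1
    refine (coordVec_eq c i hy).trans ?_
    rw [(relOpen_target c).fderivWithin_eq hy, h3]
    rfl
  intro y hy
  have key : ContMDiffWithinAt 𝓘(ℝ, Coord n) 𝓘(ℝ, ℝ) ∞ (fun y => gram g c y i j)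
      (extChartAt (𝓡∂ n) c).target y := by
    have : ContMDiffWithinAt 𝓘(ℝ, Coord n) ((𝓡∂ n).prod 𝓘(ℝ, ℝ)) ∞
        (fun y => Bundle.TotalSpace.mk' ℝ (E := Bundle.Trivial W ℝ)
          ((extChartAt (𝓡∂ n) c).symm y) (gram g c y i j)) (extChartAt (𝓡∂ n) c).target y := by
      apply ContMDiffWithinAt.clm_bundle_apply₂ (F₁ := Coord n) (F₂ := Coord n)
      · exact g.contMDiff.contMDiffAt.comp_contMDiffWithinAt y (contMDiffOn_extChartAt_symm c y hy)
      · exact hv i y hy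
      · exact hv j y hy
    rw [Bundle.contMDiffWithinAt_totalSpace] at this
    exact this.2
  exact contMDiffWithinAt_iff_contDiffWithinAt.1 key

theorem isLocalMetric_gram (g : SmoothMetric n W) (c : W) :
    IsLocalMetric (extChartAt (𝓡∂ n) c).target (gram g c) where
  relOpen := relOpen_target c
  contDiffOn i j := (contDiffOn_gram g c i j).of_le (by norm_cast)
  posDef _ hy := gram_posDef g hy

theorem IsLocalMetric.mono {Ω Ω' : Set (Coord n)} {G : Coord n → Matrix (Fin n) (Fin n) ℝ}
    (h : IsLocalMetric Ω G) (h' : RelOpen Ω') (hs : Ω' ⊆ Ω) : IsLocalMetric Ω' G where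
  relOpen := h'
  contDiffOn i j := (h.contDiffOn i j).mono hs
  posDef y hy := h.posDef y (hs hy)

theorem isLocalMetric_gram_overlap (g : SmoothMetric n W) (c c' : W) :
    IsLocalMetric (overlap c c') (gram g c) :=
  (isLocalMetric_gram g c).mono (relOpen_overlap c c') inter_subset_left

end Charts

/-! ### Contractions of bilinear forms with a metric -/

section Contractions

variable {n : ℕ}

/-- The inner product of two bilinear forms with respect to the metric `G`. -/
def frob (G P Q : Matrix (Fin n) (Fin n) ℝ) : ℝ := (G⁻¹ * P * G⁻¹ * Q.transpose).trace

/-- The trace of a bilinear form with respect to the metric `G`. -/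
def mtr (G P : Matrix (Fin n) (Fin n) ℝ) : ℝ := (G⁻¹ * P).trace

theorem mtr_conj {G G' P P' J : Matrix (Fin n) (Fin n) ℝ}
    (hG : G'⁻¹ = J * G⁻¹ * J.transpose) (hP : P = J.transpose * P' * J) :
    mtr G' P' = mtr G P := by
  rw [mtr, mtr, hG, hP, Matrix.mul_assoc, Matrix.mul_assoc, Matrix.trace_mul_comm]
  simp only [Matrix.mul_assoc]

theorem frob_conj {G G' P P' Q Q' J : Matrix (Fin n) (Fin n) ℝ}
    (hG : G'⁻¹ = J * G⁻¹ * J.transpose) (hP : P = J.transpose * P' * J)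
    (hQ : Q = J.transpose * Q' * J) : frob G' P' Q' = frob G P Q := by
  rw [frob, frob, hG, hP, hQ]
  simp only [Matrix.transpose_mul, Matrix.transpose_transpose]
  rw [Matrix.mul_assoc, Matrix.mul_assoc, Matrix.mul_assoc, Matrix.mul_assoc,
    Matrix.trace_mul_comm]
  simp only [Matrix.mul_assoc]

theorem mtr_eq_sum {G P : Matrix (Fin n) (Fin n) ℝ} (hG : G.transpose = G) :
    mtr G P = ∑ i, ∑ j, G⁻¹ i j * P i j := by
  have hs : ∀ i j, G⁻¹ i j = G⁻¹ j i := fun i j => by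
    conv_lhs => rw [← hG, ← Matrix.transpose_nonsing_inv]
    rfl
  simp only [mtr, Matrix.trace, Matrix.diag, Matrix.mul_apply]
  rw [Finset.sum_comm]
  exact Finset.sum_congr rfl fun i _ => Finset.sum_congr rfl fun j _ => by rw [hs]

theorem mtr_self {G : Matrix (Fin n) (Fin n) ℝ} (hG : G.det ≠ 0) : mtr G G = n := by
  rw [mtr, Matrix.nonsing_inv_mul _ (isUnit_iff_ne_zero.2 hG)]
  simp

theorem mtr_transpose {G P : Matrix (Fin n) (Fin n) ℝ} (hG : G.transpose = G) :
    mtr G P.transpose = mtr G P := by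
  rw [mtr, mtr, ← Matrix.trace_transpose, Matrix.transpose_mul, Matrix.transpose_transpose,
    Matrix.transpose_nonsing_inv, hG, Matrix.trace_mul_comm]

theorem frob_self_left {G Q : Matrix (Fin n) (Fin n) ℝ} (hG : G.transpose = G)
    (hd : G.det ≠ 0) : frob G G Q = mtr G Q := by
  rw [frob, Matrix.nonsing_inv_mul _ (isUnit_iff_ne_zero.2 hd), Matrix.one_mul]
  exact mtr_transpose hG

theorem frob_add_left (G P P' Q : Matrix (Fin n) (Fin n) ℝ) :
    frob G (P + P') Q = frob G P Q + frob G P' Q := by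
  simp [frob, Matrix.mul_add, Matrix.add_mul]

theorem frob_smul_left (c : ℝ) (G P Q : Matrix (Fin n) (Fin n) ℝ) :
    frob G (c • P) Q = c * frob G P Q := by
  simp [frob]

theorem frob_comm {G P Q : Matrix (Fin n) (Fin n) ℝ} (hG : G.transpose = G) :
    frob G P Q = frob G Q P := by
  have hi : G⁻¹.transpose = G⁻¹ := by rw [Matrix.transpose_nonsing_inv, hG]
  rw [frob, frob, ← Matrix.trace_transpose]
  simp only [Matrix.transpose_mul, Matrix.transpose_transpose, hi]
  rw [Matrix.trace_mul_comm, ← Matrix.mul_assoc,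
    Matrix.mul_assoc (G⁻¹ * P.transpose), Matrix.trace_mul_comm]
  simp only [Matrix.mul_assoc]

/-- With a factorization `G⁻¹ = Bᵀ B` the contraction becomes the squared Hilbert-Schmidt norm of `B
P Bᵀ`, and `B` is invertible. -/
theorem frob_self_nonneg {G P : Matrix (Fin n) (Fin n) ℝ} (hG : G.PosDef) :
    0 ≤ frob G P P ∧ (frob G P P = 0 → P = 0) := by
  obtain ⟨B, hB, hGB⟩ : ∃ B : Matrix (Fin n) (Fin n) ℝ, IsUnit B ∧ G⁻¹ = B.conjTranspose * B := by
    open scoped MatrixOrder in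
    have h := Matrix.isStrictlyPositive_iff_posDef.2 hG.inv
    exact (CStarAlgebra.isStrictlyPositive_iff_eq_star_mul_self).1 h
  rw [Matrix.conjTranspose_eq_transpose_of_trivial] at hGB
  set Q := B * P * B.transpose with hQ
  have h1 : frob G P P = (Q.conjTranspose * Q).trace := by
    rw [Matrix.trace_mul_comm, Matrix.conjTranspose_eq_transpose_of_trivial, frob, hGB, hQ]
    simp only [Matrix.transpose_mul, Matrix.transpose_transpose]
    rw [Matrix.mul_assoc, Matrix.mul_assoc, Matrix.mul_assoc, Matrix.mul_assoc,
      Matrix.trace_mul_comm]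
    simp only [Matrix.mul_assoc]
  rw [h1]
  refine ⟨(Matrix.posSemidef_conjTranspose_mul_self Q).trace_nonneg, fun h => ?_⟩
  have h2 : Q = 0 := Matrix.trace_conjTranspose_mul_self_eq_zero_iff.1 h
  have hd := (Matrix.isUnit_iff_isUnit_det B).1 hB
  have hdt : IsUnit B.transpose.det := by rwa [Matrix.det_transpose]
  calc P = B⁻¹ * (B * P * B.transpose) * B.transpose⁻¹ := by
        rw [Matrix.mul_assoc, Matrix.mul_assoc, Matrix.mul_assoc, Matrix.mul_nonsing_inv _ hdt,
          Matrix.mul_one, Matrix.nonsing_inv_mul_cancel_left _ _ hd]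
    _ = 0 := by rw [← hQ, h2]; simp

end Contractions

/-! ### Curvature and boundary conditions in an arbitrary chart -/

section Geometry

variable {n : ℕ} [NeZero n] {W : Type*} [TopologicalSpace W]
  [ChartedSpace (EuclideanHalfSpace n) W] [IsManifold (𝓡∂ n) ∞ W]

theorem christoffel_eq (g : SmoothMetric n W) (c : W) (k i j : Fin n) :
    christoffel g c k i j = chr (gram g c) k i j := rfl

theorem ricciCoeff_eq (g : SmoothMetric n W) (c : W) (y : Coord n) (i j : Fin n) :
    ricciCoeff g c y i j = ricMat (gram g c) y i j := rfl

theorem gram_trans' (g : SmoothMetric n W) (c c' : W) : ∀ y ∈ overlap c c',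
    gram g c y = (jac (trans c c') y).transpose * gram g c' (trans c c' y)
      * jac (trans c c') y :=
  fun _ hy => gram_trans g hy

theorem gramInv_trans (g : SmoothMetric n W) {c c' : W} {y : Coord n} (hy : y ∈ overlap c c') :
    (gram g c' (trans c c' y))⁻¹ = jac (trans c c') y * (gram g c y)⁻¹
      * (jac (trans c c') y).transpose :=
  (isTransition c c').inv_eq (gram_trans' g c c') hy

theorem ricMat_trans (g : SmoothMetric n W) {c c' : W} {y : Coord n} (hy : y ∈ overlap c c') :
    ricMat (gram g c) y = (jac (trans c c') y).transpose * ricMat (gram g c') (trans c c' y)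
      * jac (trans c c') y :=
  (isTransition c c').ricMat_eq (isLocalMetric_gram_overlap g c c') (isLocalMetric_gram g c')
    (gram_trans' g c c') hy

/-- The scalar curvature of a metric with coefficients `G`. -/
def scal (G : Coord n → Matrix (Fin n) (Fin n) ℝ) (y : Coord n) : ℝ := mtr (G y) (ricMat G y)

theorem scal_trans (g : SmoothMetric n W) {c c' : W} {y : Coord n} (hy : y ∈ overlap c c') :
    scal (gram g c') (trans c c' y) = scal (gram g c) y :=
  mtr_conj (gramInv_trans g hy) (ricMat_trans g hy)

theorem scalarCurv_eq_scal_self (g : SmoothMetric n W) (x : W) :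
    scalarCurv g x = scal (gram g x) (extChartAt (𝓡∂ n) x x) :=
  (mtr_eq_sum ((isLocalMetric_gram g x).transpose_eq (mem_extChartAt_target x))).symm

theorem overlap_symm_mem {c : W} {y : Coord n} (hy : y ∈ (extChartAt (𝓡∂ n) c).target) :
    y ∈ overlap c ((extChartAt (𝓡∂ n) c).symm y) :=
  ⟨hy, mem_extChartAt_source (I := 𝓡∂ n) _⟩

theorem scalarCurv_symm (g : SmoothMetric n W) {c : W} {y : Coord n}
    (hy : y ∈ (extChartAt (𝓡∂ n) c).target) :
    scalarCurv g ((extChartAt (𝓡∂ n) c).symm y) = scal (gram g c) y := by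
  rw [scalarCurv_eq_scal_self]
  exact scal_trans g (overlap_symm_mem hy)

/-- The coefficients of the traceless Ricci tensor. -/
def tracelessMat (G : Coord n → Matrix (Fin n) (Fin n) ℝ) (y : Coord n) :
    Matrix (Fin n) (Fin n) ℝ :=
  ricMat G y - (scal G y / n) • G y

theorem tracelessMat_trans (g : SmoothMetric n W) {c c' : W} {y : Coord n}
    (hy : y ∈ overlap c c') :
    tracelessMat (gram g c) y = (jac (trans c c') y).transpose
      * tracelessMat (gram g c') (trans c c' y) * jac (trans c c') y := by
  rw [tracelessMat, tracelessMat, scal_trans g hy, ricMat_trans g hy, gram_trans g hy,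
    Matrix.mul_sub, Matrix.sub_mul, Matrix.mul_smul, Matrix.smul_mul]

theorem tracelessRicciNormSq_self (g : SmoothMetric n W) (x : W) :
    tracelessRicciNormSq g x = frob (gram g x (extChartAt (𝓡∂ n) x x))
      (tracelessMat (gram g x) (extChartAt (𝓡∂ n) x x))
      (tracelessMat (gram g x) (extChartAt (𝓡∂ n) x x)) := by
  have hc : ∀ i j, tracelessRicciCoeff g x i j
      = tracelessMat (gram g x) (extChartAt (𝓡∂ n) x x) i j := fun i j => by
    rw [tracelessRicciCoeff, scalarCurv_eq_scal_self]; rfl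
  have hs := (isLocalMetric_gram g x).inv_symm (mem_extChartAt_target (I := 𝓡∂ n) x)
  rw [tracelessRicciNormSq, frob]
  simp only [hc, gramInv, Matrix.trace, Matrix.diag, Matrix.mul_apply, Matrix.transpose_apply,
    Finset.sum_mul]
  set T := tracelessMat (gram g x) (extChartAt (𝓡∂ n) x x)
  set A := (gram g x (extChartAt (𝓡∂ n) x x))⁻¹
  calc ∑ i, ∑ j, ∑ k, ∑ l, A i k * A j l * T i j * T k l
      = ∑ i, ∑ k, ∑ j, ∑ l, A k i * T i j * A j l * T k l := by
        refine Finset.sum_congr rfl fun i _ => ?_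
        rw [Finset.sum_comm]
        refine Finset.sum_congr rfl fun k _ => Finset.sum_congr rfl fun j _ =>
          Finset.sum_congr rfl fun l _ => ?_
        rw [hs i k]; ring
    _ = _ := by
        rw [Finset.sum_comm]
        refine Finset.sum_congr rfl fun k _ => ?_
        rw [Finset.sum_congr rfl fun i _ => Finset.sum_comm, Finset.sum_comm]
        refine Finset.sum_congr rfl fun l _ => ?_
        rw [Finset.sum_comm]

theorem tracelessRicciNormSq_symm (g : SmoothMetric n W) {c : W} {y : Coord n}
    (hy : y ∈ (extChartAt (𝓡∂ n) c).target) :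
    tracelessRicciNormSq g ((extChartAt (𝓡∂ n) c).symm y)
      = frob (gram g c y) (tracelessMat (gram g c) y) (tracelessMat (gram g c) y) := by
  rw [tracelessRicciNormSq_self]
  exact frob_conj (gramInv_trans g (overlap_symm_mem hy))
    (tracelessMat_trans g (overlap_symm_mem hy)) (tracelessMat_trans g (overlap_symm_mem hy))

/-- Lowering the index of `ν` leaves `-δₗ₀ / √g⁰⁰`, so the second fundamental form is `Γ⁰ᵢⱼ / √g⁰⁰`,
and `gⁱʲ - νⁱ νʲ` is `tanInv`. -/
theorem meanCurv_eq (g : SmoothMetric n W) (x : W) :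
    meanCurv g x = hsum (gram g x) (extChartAt (𝓡∂ n) x x)
      / √((gram g x (extChartAt (𝓡∂ n) x x))⁻¹ 0 0) := by
  have hy := mem_extChartAt_target (I := 𝓡∂ n) x
  have hG := isLocalMetric_gram g x
  have hp := hG.inv_zero_zero_pos hy
  set y := extChartAt (𝓡∂ n) x x
  set r := √((gram g x y)⁻¹ 0 0) with hr
  have hr0 : r ≠ 0 := (Real.sqrt_pos.2 hp).ne'
  have hr2 : r * r = (gram g x y)⁻¹ 0 0 := Real.mul_self_sqrt hp.le
  have hν : ∀ i, outwardNormal g x i = - (gram g x y)⁻¹ i 0 / r := fun i => rfl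
  have hA : ∀ i j, secondFundCoeff g x i j = chr (gram g x) 0 i j y / r := by
    intro i j
    have h1 : ∀ l, ∑ k, gram g x y k l * (gram g x y)⁻¹ k 0 = if l = 0 then 1 else 0 := by
      intro l
      have := congrFun (congrFun (Matrix.mul_nonsing_inv _ (hG.isUnit_det hy)) l) 0
      rw [Matrix.mul_apply, Matrix.one_apply] at this
      rw [← this]
      exact Finset.sum_congr rfl fun k _ => by rw [hG.symm hy]
    unfold secondFundCoeff
    simp only [hν, christoffel_eq]
    rw [Finset.sum_comm]
    have h2 : ∀ l, ∑ k, gram g x y k l * (-(gram g x y)⁻¹ k 0 / r) * chr (gram g x) l i j y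
        = -(if l = 0 then 1 else 0) * chr (gram g x) l i j y / r := by
      intro l
      rw [← h1, ← Finset.sum_neg_distrib, Finset.sum_mul, Finset.sum_div]
      exact Finset.sum_congr rfl fun k _ => by ring
    rw [Finset.sum_congr rfl fun l _ => h2 l]
    rw [Finset.sum_eq_single 0 (fun l _ hl => by simp [hl]) (by simp)]
    rw [if_pos rfl]; ring
  unfold meanCurv hsum
  rw [Finset.sum_div]
  refine Finset.sum_congr rfl fun i _ => ?_
  rw [Finset.sum_div]
  refine Finset.sum_congr rfl fun j _ => ?_
  rw [hA, hν, hν, tanInv, Matrix.of_apply, ← hr2]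
  change ((gram g x y)⁻¹ i j - _) * _ = _
  field_simp

/-- Minimality is a condition at each point in its own chart; it passes to the chart around `c`
because `hsum` only changes by a nonzero factor at boundary points. -/
theorem hsum_eq_zero {g : SmoothMetric n W} (hg : MinimalBoundary g) {c : W} {y : Coord n}
    (hy : y ∈ (extChartAt (𝓡∂ n) c).target) (hy0 : y 0 = 0) : hsum (gram g c) y = 0 := by
  set x := (extChartAt (𝓡∂ n) c).symm y with hx
  have hov := overlap_symm_mem hy
  have hT := isTransition (n := n) c x
  have hxb : x ∈ (𝓡∂ n).boundary W := by
    rw [mem_boundary_iff ((extChartAt (𝓡∂ n) c).map_target hy),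
      (extChartAt (𝓡∂ n) c).right_inv hy, hy0]
  have h1 := hg x hxb
  have hp := (isLocalMetric_gram g x).inv_zero_zero_pos (mem_extChartAt_target (I := 𝓡∂ n) x)
  rw [meanCurv_eq, div_eq_zero_iff, or_iff_left (Real.sqrt_pos.2 hp).ne'] at h1
  have h2 := hT.hsum_eq (isLocalMetric_gram_overlap g c x) (isLocalMetric_gram g x)
    (gram_trans' g c x) hov hy0
  have h3 : trans c x y = extChartAt (𝓡∂ n) x x := rfl
  rw [h3, h1] at h2
  exact (mul_eq_zero.1 h2.symm).resolve_left (hT.jac_zero_zero_ne_zero hov hy0)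

/-- The tangential blocks of the metric coefficients of two metrics that are conformal on the
boundary are proportional. -/
theorem BoundaryConformal.exists_gram_eq {g g₀ : SmoothMetric n W} (h : BoundaryConformal g g₀)
    {c : W} {y : Coord n} (hy : y ∈ (extChartAt (𝓡∂ n) c).target) (hy0 : y 0 = 0) :
    ∃ f : ℝ, 0 < f ∧ ∀ i j, i ≠ 0 → j ≠ 0 → gram g c y i j = f * gram g₀ c y i j := by
  obtain ⟨f, hf⟩ := h
  set x := (extChartAt (𝓡∂ n) c).symm y with hx
  have hov := overlap_symm_mem hy
  have hxb : x ∈ (𝓡∂ n).boundary W := by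
    rw [mem_boundary_iff ((extChartAt (𝓡∂ n) c).map_target hy),
      (extChartAt (𝓡∂ n) c).right_inv hy, hy0]
  refine ⟨f x, (hf x hxb).1, fun i j hi hj => ?_⟩
  have hz : ∀ a : Fin n, a ≠ 0 → comp (coordVec c a y) 0 = 0 := by
    intro a ha
    have h1 : comp (coordVec c a y) 0 = jac (trans c x) y 0 a := by
      rw [← fderivWithin_single ((relOpen_target c).subset hy) (differentiableWithinAt_trans hov)]
      exact congrArg (fun v : Coord n => v 0) (coordVec_eq c a hy)
    rw [h1, (isTransition (n := n) c x).jac_zero_of_boundary hov hy0 ha]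
  exact (hf x hxb).2 _ _ (hz i hi) (hz j hj)

/-- The Ricci tensor in terms of the coordinate vector fields. -/
theorem ricci_coordVec (g : SmoothMetric n W) {c : W} {y : Coord n}
    (hy : y ∈ (extChartAt (𝓡∂ n) c).target) (i j : Fin n) :
    ricci g ((extChartAt (𝓡∂ n) c).symm y) (coordVec c i y) (coordVec c j y)
      = ricMat (gram g c) y i j := by
  set x := (extChartAt (𝓡∂ n) c).symm y with hx
  have hov := overlap_symm_mem hy
  have h1 : ∀ a b, comp (coordVec c a y) b = jac (trans c x) y b a := by
    intro a b
    rw [← fderivWithin_single ((relOpen_target c).subset hy) (differentiableWithinAt_trans hov)]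
    exact congrArg (fun v : Coord n => v b) (coordVec_eq c a hy)
  rw [ricMat_trans g hov, Matrix.mul_assoc, Matrix.mul_apply, ricci]
  refine Finset.sum_congr rfl fun k _ => ?_
  rw [Matrix.mul_apply, Finset.mul_sum]
  refine Finset.sum_congr rfl fun l _ => ?_
  rw [h1, h1, ricciCoeff_eq, Matrix.transpose_apply]
  change _ * _ * _ = _ * (ricMat (gram g x) (extChartAt (𝓡∂ n) x x) k l * _)
  ring

end Geometry

/-! ### The Riemannian volume measure -/

section Volume

variable {n : ℕ} [NeZero n] {W : Type*} [TopologicalSpace W]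
  [ChartedSpace (EuclideanHalfSpace n) W]

theorem isOpen_chartSource (c : W) : IsOpen (extChartAt (𝓡∂ n) c).source :=
  isOpen_extChartAt_source c

theorem measurableSet_target (c : W) : MeasurableSet (extChartAt (𝓡∂ n) c).target :=
  (relOpen_target c).measurableSet

theorem det_fderivWithin {φ : Coord n → Coord n} {y : Coord n} (hy : y ∈ halfSpace n)
    (hφ : DifferentiableWithinAt ℝ φ (halfSpace n) y) :
    (fderivWithin ℝ φ (halfSpace n) y).det = (jac φ y).det := by
  rw [ContinuousLinearMap.det, ← LinearMap.det_toMatrix (EuclideanSpace.basisFun (Fin n) ℝ).toBasis]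
  congr 1
  ext i j
  rw [LinearMap.toMatrix_apply, ← fderivWithin_single hy hφ j i]
  simp

variable [IsManifold (𝓡∂ n) ∞ W]

theorem density_trans (g : SmoothMetric n W) {c c' : W} {y : Coord n} (hy : y ∈ overlap c c') :
    density (gram g c) y = |(jac (trans c c') y).det| * density (gram g c') (trans c c' y) := by
  rw [density, gram_trans g hy, Matrix.det_mul, Matrix.det_mul, Matrix.det_transpose, density,
    ← Real.sqrt_sq_eq_abs, ← Real.sqrt_mul (sq_nonneg _)]
  congr 1; ring

variable [MeasurableSpace W] [BorelSpace W]

theorem aemeasurable_symm (c : W) : AEMeasurable (extChartAt (𝓡∂ n) c).symm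
    ((volume : Measure (Coord n)).restrict (extChartAt (𝓡∂ n) c).target) :=
  (continuousOn_extChartAt_symm c).aemeasurable (measurableSet_target c)

theorem aemeasurable_density (g : SmoothMetric n W) (c : W) :
    AEMeasurable (fun y => ENNReal.ofReal (density (gram g c) y))
      ((volume : Measure (Coord n)).restrict (extChartAt (𝓡∂ n) c).target) :=
  ((isLocalMetric_gram g c).contDiffOn_density.continuousOn.aemeasurable
    (measurableSet_target c)).ennreal_ofReal

theorem measurableSet_target_inter_preimage (c : W) {A : Set W} (hA : MeasurableSet A) :
    MeasurableSet ((extChartAt (𝓡∂ n) c).target ∩ (extChartAt (𝓡∂ n) c).symm ⁻¹' A) := by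
  have h := (continuousOn_iff_continuous_domRestrict.1
    (continuousOn_extChartAt_symm (I := 𝓡∂ n) c)).measurable hA
  have h2 := (MeasurableEmbedding.subtype_coe (measurableSet_target (n := n) c)).measurableSet_image.2 h
  convert h2 using 1
  ext y
  rw [inter_comm]; simp

theorem chartVolume_apply (g : SmoothMetric n W) (c : W) {A : Set W} (hA : MeasurableSet A) :
    chartVolume g c A
      = ∫⁻ y in (extChartAt (𝓡∂ n) c).target ∩ (extChartAt (𝓡∂ n) c).symm ⁻¹' A,
          ENNReal.ofReal (density (gram g c) y) := by
  have hm : AEMeasurable (extChartAt (𝓡∂ n) c).symm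
      (((volume : Measure (Coord n)).restrict (extChartAt (𝓡∂ n) c).target).withDensity
        (fun y => ENNReal.ofReal (density (gram g c) y))) :=
    (aemeasurable_symm c).mono_ac (withDensity_absolutelyContinuous _ _)
  rw [chartVolume]
  erw [Measure.map_apply_of_aemeasurable hm hA]
  have h1 := measurableSet_target_inter_preimage (n := n) c hA
  have h2 : ((volume : Measure (Coord n)).restrict (extChartAt (𝓡∂ n) c).target).withDensity
        (fun y => ENNReal.ofReal (density (gram g c) y)) (extChartAt (𝓡∂ n) c).targetᶜ = 0 :=
    withDensity_absolutelyContinuous _ _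
      (by rw [Measure.restrict_apply (measurableSet_target c).compl]; simp)
  rw [← measure_inter_add_sdiff _ (measurableSet_target c),
    measure_mono_null (s := _ \ _) (fun y hy => hy.2) h2, add_zero, inter_comm,
    withDensity_apply _ h1, Measure.restrict_restrict h1]
  congr 2
  ext y; simp; tauto

theorem chartVolume_inter_source (g : SmoothMetric n W) (c : W) {A : Set W}
    (hA : MeasurableSet A) :
    chartVolume g c (A ∩ (extChartAt (𝓡∂ n) c).source) = chartVolume g c A := by
  rw [chartVolume_apply g c hA, chartVolume_apply g c (hA.inter (isOpen_chartSource c).measurableSet)]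
  congr 2
  ext y
  simp only [mem_inter_iff, mem_preimage]
  exact ⟨fun h => ⟨h.1, h.2.1⟩, fun h => ⟨h.1, h.2, (extChartAt (𝓡∂ n) c).map_target h.1⟩⟩

/-- The chart volumes agree on overlaps. -/
theorem chartVolume_eq (g : SmoothMetric n W) (c c' : W) {A : Set W} (hA : MeasurableSet A)
    (h : A ⊆ (extChartAt (𝓡∂ n) c).source) (h' : A ⊆ (extChartAt (𝓡∂ n) c').source) :
    chartVolume g c A = chartVolume g c' A := by
  rw [chartVolume_apply g c hA, chartVolume_apply g c' hA]
  set S := (extChartAt (𝓡∂ n) c).target ∩ (extChartAt (𝓡∂ n) c).symm ⁻¹' A with hS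
  have hSo : S ⊆ overlap c c' := fun y hy => ⟨hy.1, h' hy.2⟩
  have himg : (extChartAt (𝓡∂ n) c').target ∩ (extChartAt (𝓡∂ n) c').symm ⁻¹' A
      = trans c c' '' S := by
    ext z
    constructor
    · intro hz
      have hzo : z ∈ overlap c' c := ⟨hz.1, h hz.2⟩
      exact ⟨trans c' c z, ⟨(trans_mem hzo).1, by
        rw [mem_preimage, symm_trans hzo]; exact hz.2⟩, trans_trans_self hzo⟩
    · rintro ⟨y, hy, rfl⟩
      exact ⟨(trans_mem (hSo hy)).1, by rw [mem_preimage, symm_trans (hSo hy)]; exact hy.2⟩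
  have hd : ∀ y ∈ S, DifferentiableWithinAt ℝ (trans c c') (halfSpace n) y := fun y hy =>
    differentiableWithinAt_trans (hSo hy)
  have hH : S ⊆ halfSpace n := fun y hy => (relOpen_target c).subset hy.1
  rw [himg, lintegral_image_eq_lintegral_abs_det_fderiv_mul volume
    (measurableSet_target_inter_preimage c hA)
    (fun y hy => (hd y hy).hasFDerivWithinAt.mono hH)
    (fun y hy z hz hyz => by rw [← trans_trans_self (hSo hy), hyz, trans_trans_self (hSo hz)])]
  refine setLIntegral_congr_fun (measurableSet_target_inter_preimage c hA) fun y hy => ?_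
  rw [det_fderivWithin (hH hy) (hd y hy), density_trans g (hSo hy),
    ENNReal.ofReal_mul (abs_nonneg _)]

/-- The Riemannian volume measure is the chart volume on the domain of the chart. -/
theorem riemVolume_restrict (g : SmoothMetric n W) (c : W) :
    (riemVolume g).restrict (extChartAt (𝓡∂ n) c).source = chartVolume g c := by
  have hO : ∀ c : W, MeasurableSet (extChartAt (𝓡∂ n) c).source :=
    fun c => (isOpen_chartSource c).measurableSet
  apply le_antisymm
  · have h1 : ∀ c', (chartVolume g c').restrict (extChartAt (𝓡∂ n) c).source
        ≤ chartVolume g c := by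
      intro c'
      refine Measure.le_iff.2 fun A hA => ?_
      rw [Measure.restrict_apply hA, ← chartVolume_inter_source g c' (hA.inter (hO c)),
        chartVolume_eq g c' c ((hA.inter (hO c)).inter (hO c')) inter_subset_right
          (inter_subset_left.trans inter_subset_right)]
      exact measure_mono (inter_subset_left.trans inter_subset_left)
    -- The supremum is bounded by bounding every chart volume, split into its parts inside and
    -- outside the chart around `c`. Restricting afterwards to that chart removes the second
    -- summand.
    have h2 : riemVolume g ≤ chartVolume g c
        + (riemVolume g).restrict (extChartAt (𝓡∂ n) c).sourceᶜ := by
      refine iSup_le fun c' => ?_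
      rw [← Measure.restrict_add_restrict_compl (μ := chartVolume g c') (hO c)]
      exact add_le_add (h1 c') (Measure.restrict_mono le_rfl (le_iSup (chartVolume g) c'))
    have h3 := Measure.restrict_mono (le_refl (extChartAt (𝓡∂ n) c).source) h2
    rw [Measure.restrict_add, Measure.restrict_restrict (hO c), inter_compl_self,
      Measure.restrict_empty, add_zero] at h3
    exact h3.trans Measure.restrict_le_self
  · refine Measure.le_iff.2 fun A hA => ?_
    rw [Measure.restrict_apply hA, ← chartVolume_inter_source g c hA]
    exact Measure.le_iff.1 (le_iSup (chartVolume g) c) _ (hA.inter (hO c))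

theorem integral_chart (g : SmoothMetric n W) (c : W) {f : W → ℝ} (hf : Continuous f)
    (h0 : ∀ x, x ∉ (extChartAt (𝓡∂ n) c).source → f x = 0) :
    ∫ x, f x ∂(riemVolume g) = ∫ y in (extChartAt (𝓡∂ n) c).target,
      density (gram g c) y * f ((extChartAt (𝓡∂ n) c).symm y) := by
  rw [← setIntegral_eq_integral_of_forall_compl_eq_zero h0, riemVolume_restrict, chartVolume]
  have hm : AEMeasurable (extChartAt (𝓡∂ n) c).symm
      (((volume : Measure (Coord n)).restrict (extChartAt (𝓡∂ n) c).target).withDensity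
        (fun y => ENNReal.ofReal (density (gram g c) y))) :=
    (aemeasurable_symm c).mono_ac (withDensity_absolutelyContinuous _ _)
  erw [integral_map hm hf.aestronglyMeasurable,
    integral_withDensity_eq_integral_toReal_smul₀ (aemeasurable_density g c) (by simp)]
  refine integral_congr_ae (ae_of_all _ fun y => ?_)
  change _ * _ = _ * _
  congr 1
  exact ENNReal.toReal_ofReal (Real.sqrt_nonneg _)

/-- Nonempty open sets have positive volume. -/
theorem riemVolume_pos (g : SmoothMetric n W) {A : Set W} (hA : IsOpen A) (hne : A.Nonempty) :
    0 < riemVolume g A := by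
  obtain ⟨x, hx⟩ := hne
  have h1 : chartVolume g x A ≤ riemVolume g A :=
    Measure.le_iff.1 (le_iSup (chartVolume g) x) _ hA.measurableSet
  refine lt_of_lt_of_le ?_ h1
  rw [chartVolume_apply g x hA.measurableSet]
  have hro : RelOpen ((extChartAt (𝓡∂ n) x).target ∩ (extChartAt (𝓡∂ n) x).symm ⁻¹' A) :=
    (relOpen_target x).inter_preimage (continuousOn_extChartAt_symm x) hA
  set S := (extChartAt (𝓡∂ n) x).target ∩ (extChartAt (𝓡∂ n) x).symm ⁻¹' A with hS
  have hxS : extChartAt (𝓡∂ n) x x ∈ S :=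
    ⟨mem_extChartAt_target x, by rw [mem_preimage, extChartAt_to_inv]; exact hx⟩
  have hvol : volume S ≠ 0 := by
    have h2 : (interior S).Nonempty := by
      have := hro.subset_closure_interior hxS
      exact closure_nonempty_iff.1 ⟨_, this⟩
    exact fun h => (isOpen_interior.measure_pos volume h2).ne' (measure_mono_null interior_subset h)
  rw [pos_iff_ne_zero]
  intro h
  rw [lintegral_eq_zero_iff' ((aemeasurable_density g x).mono_measure
    (Measure.restrict_mono inter_subset_left le_rfl))] at h
  have h3 : ∀ᵐ y ∂(volume.restrict S), False := by
    filter_upwards [h, ae_restrict_mem hro.measurableSet] with y hy hyS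
    have := (isLocalMetric_gram g x).density_pos hyS.1
    simp only [Pi.zero_apply, ENNReal.ofReal_eq_zero] at hy
    linarith
  rw [ae_iff] at h3
  simp at h3
  exact hvol h3

end Volume

/-! ### Finite partitions of unity subordinate to charts -/

section Partition

variable {n : ℕ} [NeZero n] {W : Type*} [TopologicalSpace W]
  [ChartedSpace (EuclideanHalfSpace n) W]

theorem continuous_of_chart {f : W → ℝ} (h : ∀ c : W, ContinuousOn
    (fun y : Coord n => f ((extChartAt (𝓡∂ n) c).symm y)) (extChartAt (𝓡∂ n) c).target) :
    Continuous f := by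
  refine continuous_iff_continuousAt.2 fun x => ?_
  have h1 : ContinuousOn (fun z => f ((extChartAt (𝓡∂ n) x).symm (extChartAt (𝓡∂ n) x z)))
      (extChartAt (𝓡∂ n) x).source :=
    (h x).comp (continuousOn_extChartAt x) (extChartAt (𝓡∂ n) x).mapsTo
  have h2 : ContinuousOn f (extChartAt (𝓡∂ n) x).source :=
    h1.congr fun z hz => by simp only [(extChartAt (𝓡∂ n) x).left_inv hz]
  exact h2.continuousAt ((isOpen_chartSource x).mem_nhds (mem_extChartAt_source x))

variable [T2Space W] [CompactSpace W] [IsManifold (𝓡∂ n) ∞ W]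

variable (n W) in
/-- A finite smooth partition of unity subordinate to charts. -/
structure ChartPartition where
  index : Finset W
  ρ : W → W → ℝ
  smooth : ∀ c, ContMDiff (𝓡∂ n) 𝓘(ℝ, ℝ) ∞ (ρ c)
  nonneg : ∀ c x, 0 ≤ ρ c x
  subordinate : ∀ c, tsupport (ρ c) ⊆ (extChartAt (𝓡∂ n) c).source
  sum_eq_one : ∀ x, ∑ c ∈ index, ρ c x = 1

variable (n W) in
theorem exists_chartPartition : Nonempty (ChartPartition n W) := by
  obtain ⟨f, hf⟩ := SmoothPartitionOfUnity.exists_isSubordinate_chartAt_source (𝓡∂ n) W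
  have hfin : {c | (Function.support (f c)).Nonempty}.Finite := by
    have := f.locallyFinite.finite_nonempty_of_compact
    exact this
  refine ⟨⟨hfin.toFinset, fun c => f c, fun c => (f c).contMDiff, fun c x => f.nonneg c x,
    fun c => by rw [extChartAt_source]; exact hf c, fun x => ?_⟩⟩
  rw [← f.sum_eq_one (mem_univ x)]
  refine (finsum_eq_sum_of_support_subset _ fun c hc => ?_).symm
  simp only [Finite.coe_toFinset, mem_ofPred_eq]
  exact ⟨x, hc⟩

namespace ChartPartition

variable (P : ChartPartition n W)

theorem continuous (c : W) : Continuous (P.ρ c) := (P.smooth c).continuous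

theorem eq_zero {c x : W} (hx : x ∉ (extChartAt (𝓡∂ n) c).source) : P.ρ c x = 0 :=
  image_eq_zero_of_notMem_tsupport fun h => hx (P.subordinate c h)

/-- The coordinate expression of the function `ρ c` in the chart around `c'`. -/
def loc (c c' : W) (y : Coord n) : ℝ := P.ρ c ((extChartAt (𝓡∂ n) c').symm y)

theorem contDiffOn_loc (c c' : W) : ContDiffOn ℝ ∞ (P.loc c c') (extChartAt (𝓡∂ n) c').target :=
  contMDiffOn_iff_contDiffOn.1
    ((P.smooth c).comp_contMDiffOn (contMDiffOn_extChartAt_symm c'))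

variable [MeasurableSpace W] [BorelSpace W]

theorem integral_eq (g : SmoothMetric n W) [IsFiniteMeasure (riemVolume g)] {f : W → ℝ}
    (hf : Continuous f) : ∫ x, f x ∂(riemVolume g)
      = ∑ c ∈ P.index, ∫ y in (extChartAt (𝓡∂ n) c).target,
        P.loc c c y * (density (gram g c) y * f ((extChartAt (𝓡∂ n) c).symm y)) := by
  have h1 : ∀ x, f x = ∑ c ∈ P.index, P.ρ c x * f x := fun x => by
    rw [← Finset.sum_mul, P.sum_eq_one, one_mul]
  have hc : ∀ c, Continuous fun x => P.ρ c x * f x := fun c => (P.continuous c).mul hf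
  rw [integral_congr_ae (ae_of_all _ h1), integral_finsetSum _ fun c _ =>
    (hc c).integrable_of_hasCompactSupport (HasCompactSupport.of_compactSpace _)]
  refine Finset.sum_congr rfl fun c _ => ?_
  rw [integral_chart g c (hc c) fun x hx => by rw [P.eq_zero hx, zero_mul]]
  refine integral_congr_ae (ae_of_all _ fun y => ?_)
  simp only [loc]; ring

end ChartPartition

end Partition

/-! ### The divergence theorem on the half space -/

section DivergenceTheorem

theorem relOpen_halfSpace {n : ℕ} [NeZero n] : RelOpen (halfSpace n) :=
  ⟨univ, isOpen_univ, (univ_inter _).symm⟩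

theorem continuousOn_pderiv {n : ℕ} [NeZero n] {Ω : Set (Coord n)} {f : Coord n → ℝ}
    (hf : ContDiffOn ℝ 1 f Ω) (h : RelOpen Ω) (i : Fin n) : ContinuousOn (pderiv f i) Ω :=
  (contDiffOn_pderiv (m := 0) hf h (by norm_num) i).continuousOn

/-- The support fits in a box with one face on the boundary hyperplane. The divergence theorem on
the box, for the field with the single component `F` in direction `k`, leaves integrals over two
faces; on the outer faces `F` vanishes because they miss `K`, and on the boundary face by `hb`. -/
theorem integral_halfSpace_pderiv_eq_zero {n : ℕ} [NeZero n] {F : Coord n → ℝ}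
    {K : Set (Coord n)} (hF : ContDiffOn ℝ 1 F (halfSpace n)) (hK : IsCompact K)
    (h0 : ∀ y ∈ halfSpace n, y ∉ K → F y = 0) (k : Fin n)
    (hb : k = 0 → ∀ y, y 0 = 0 → F y = 0) :
    ∫ y in halfSpace n, pderiv F k y = 0 := by
  obtain ⟨m, rfl⟩ : ∃ m, n = m + 1 := Nat.exists_eq_succ_of_ne_zero (NeZero.ne n)
  obtain ⟨r, hr⟩ := hK.isBounded.exists_norm_le
  -- The added one makes the outer faces of the box disjoint from `K`; the maximum with zero keeps
  -- the box nondegenerate.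
  set R := max r 0 + 1 with hR
  have hRpos : 0 < R := by positivity
  have hKR : ∀ y : Coord (m + 1), ∀ i, R ≤ |y i| → y ∉ K := fun y i hy hyK => by
    have h1 := (PiLp.norm_apply_le y i).trans (hr y hyK)
    rw [Real.norm_eq_abs] at h1
    have := le_max_left r 0
    linarith
  have hp0 : ∀ y ∈ halfSpace (m + 1), y ∉ K → pderiv F k y = 0 := fun y hy hyK => by
    have hro : RelOpen (Kᶜ ∩ halfSpace (m + 1)) := ⟨Kᶜ, hK.isClosed.isOpen_compl, rfl⟩
    rw [pderiv_congr (f' := fun _ => 0) hro ⟨hyK, hy⟩ (fun z hz => h0 z hz.2 hz.1) k, pderiv_const]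
  have hpc : ContinuousOn (pderiv F k) (halfSpace (m + 1)) :=
    continuousOn_pderiv hF relOpen_halfSpace k
  set a : Fin (m + 1) → ℝ := fun i => if i = 0 then 0 else -R with ha
  set b : Fin (m + 1) → ℝ := fun _ => R with hbR
  have hab : a ≤ b := fun i => by
    simp only [ha, hbR]; split_ifs <;> linarith
  have hL : Continuous (fun x : Fin (m + 1) → ℝ => (WithLp.toLp 2 x : Coord (m + 1))) :=
    PiLp.continuous_toLp 2 _
  have hIH : MapsTo (fun x : Fin (m + 1) → ℝ => (WithLp.toLp 2 x : Coord (m + 1))) (Icc a b)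
      (halfSpace (m + 1)) := fun x hx => by
    rw [mem_halfSpace]
    have := hx.1 0
    simpa [ha] using this
  have hbox : ∀ x : Fin (m + 1) → ℝ, x ∉ Icc a b →
      (halfSpace (m + 1)).indicator (pderiv F k) (WithLp.toLp 2 x) = 0 := fun x hx => by
    by_cases hH : (WithLp.toLp 2 x : Coord (m + 1)) ∈ halfSpace (m + 1)
    · rw [indicator_of_mem hH]
      refine hp0 _ hH fun hxK => hx ⟨fun i => ?_, fun i => ?_⟩
      · by_cases hi : i = 0
        · subst hi; simpa [ha] using mem_halfSpace.1 hH
        · simp only [ha, if_neg hi]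
          by_contra hc
          exact hKR _ i (by rw [le_abs]; right; simp at hc ⊢; linarith) hxK
      · by_contra hc
        exact hKR _ i (by rw [le_abs]; left; simp [hbR] at hc ⊢; linarith) hxK
    · rw [indicator_of_notMem hH]
  have hmp := PiLp.volume_preserving_toLp (Fin (m + 1))
  have hme : MeasurableEmbedding (fun x : Fin (m + 1) → ℝ => (WithLp.toLp 2 x : Coord (m + 1))) :=
    (MeasurableEquiv.toLp 2 (Fin (m + 1) → ℝ)).measurableEmbedding
  rw [← integral_indicator isClosed_halfSpace.measurableSet, ← hmp.integral_comp hme,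
    ← setIntegral_eq_integral_of_forall_compl_eq_zero hbox]
  set L : (Fin (m + 1) → ℝ) →L[ℝ] Coord (m + 1) :=
    ((EuclideanSpace.equiv (Fin (m + 1)) ℝ).symm : (Fin (m + 1) → ℝ) →L[ℝ] Coord (m + 1)) with hLdef
  have hLx : ∀ x, L x = WithLp.toLp 2 x := fun x => rfl
  set f : Fin (m + 1) → (Fin (m + 1) → ℝ) → ℝ := fun i x => if i = k then F (L x) else 0 with hf
  set f' : Fin (m + 1) → (Fin (m + 1) → ℝ) → (Fin (m + 1) → ℝ) →L[ℝ] ℝ := fun i x =>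
    if i = k then (fderivWithin ℝ F (halfSpace (m + 1)) (L x)).comp L else 0 with hf'
  have hsum : ∀ x, ∑ i, f' i x (Pi.single i 1) = pderiv F k (L x) := fun x => by
    rw [Finset.sum_eq_single k (fun i _ hi => by simp [hf', hi]) (by simp)]
    simp only [hf', if_true]
    rfl
  have hdiv := integral_divergence_of_hasFDerivAt_off_countable' a b hab f f' ∅ countable_empty
    (fun i => by
      by_cases hi : i = k
      · simp only [hf, if_pos hi]
        exact hF.continuousOn.comp hL.continuousOn hIH
      · simp only [hf, if_neg hi]; exact continuousOn_const)
    (fun x hx i => by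
      by_cases hi : i = k
      · simp only [hf, hf', if_pos hi]
        have hin : L x ∈ interior (halfSpace (m + 1)) := by
          rw [interior_halfSpace_eq]
          have := (hx.1 0 (mem_univ _)).1
          simp only [ha, if_true] at this
          exact this
        have hd : HasFDerivAt F (fderivWithin ℝ F (halfSpace (m + 1)) (L x)) (L x) :=
          ((hF.differentiableOn (by simp) _ (interior_subset hin)).hasFDerivWithinAt).hasFDerivAt
            (mem_interior_iff_mem_nhds.1 hin)
        exact hd.comp x L.hasFDerivAt
      · simp only [hf, hf', if_neg hi]; exact hasFDerivAt_const _ _)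
    (by
      simp only [hsum]
      exact (hpc.comp hL.continuousOn hIH).integrableOn_compact isCompact_Icc)
  simp only [hsum] at hdiv
  have h1 : ∫ x in Icc a b, (halfSpace (m + 1)).indicator (pderiv F k) (WithLp.toLp 2 x)
      = ∫ x in Icc a b, pderiv F k (L x) :=
    setIntegral_congr_fun measurableSet_Icc fun x hx => indicator_of_mem (hIH hx) _
  rw [h1, hdiv]
  refine Finset.sum_eq_zero fun i _ => ?_
  by_cases hi : i = k
  · subst hi
    have hface : ∀ (v : ℝ), (v = R ∨ v = a i) →
        ∀ x ∈ Icc (a ∘ i.succAbove) (b ∘ i.succAbove),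
        f i (i.insertNth v x) = 0 := by
      intro v hv x hx
      simp only [hf, if_true, hLx]
      have hvi : (WithLp.toLp 2 (i.insertNth v x : Fin (m + 1) → ℝ) : Coord (m + 1)) i = v := by
        simp
      have hmem : (WithLp.toLp 2 (i.insertNth v x : Fin (m + 1) → ℝ) : Coord (m + 1))
          ∈ halfSpace (m + 1) := by
        refine hIH ⟨?_, ?_⟩
        · refine (Fin.le_insertNth_iff).2 ⟨?_, hx.1⟩
          rcases hv with rfl | rfl
          · exact hab i
          · exact le_rfl
        · refine (Fin.insertNth_le_iff).2 ⟨?_, hx.2⟩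
          rcases hv with rfl | rfl
          · exact le_rfl
          · exact hab i
      by_cases hv0 : v = R
      · exact h0 _ hmem (hKR _ i (by rw [hvi, hv0]; exact le_abs_self _))
      · have hva := hv.resolve_left hv0
        by_cases hi0 : i = 0
        · refine hb hi0 _ ?_
          rw [← hi0, hvi, hva]; simp [ha, hi0]
        · refine h0 _ hmem (hKR _ i ?_)
          rw [hvi, hva]; simp only [ha, if_neg hi0, abs_neg]; exact le_abs_self _
    rw [setIntegral_congr_fun measurableSet_Icc fun x hx => hface (b i) (Or.inl rfl) x hx,
      setIntegral_congr_fun measurableSet_Icc fun x hx => hface (a i) (Or.inr rfl) x hx]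
    simp
  · simp [hf, hi]

/-- The divergence theorem for functions with compact support in a relatively open subset of the
half space. -/
theorem integral_pderiv_eq_zero {n : ℕ} [NeZero n] {Ω K : Set (Coord n)} {f : Coord n → ℝ}
    (hΩ : RelOpen Ω) (hf : ContDiffOn ℝ 1 f Ω) (hK : IsCompact K) (hKΩ : K ⊆ Ω)
    (h0 : ∀ y ∈ Ω, y ∉ K → f y = 0) (k : Fin n)
    (hb : k = 0 → ∀ y ∈ Ω, y 0 = 0 → f y = 0) : ∫ y in Ω, pderiv f k y = 0 := by
  have hro : RelOpen (Kᶜ ∩ halfSpace n) := ⟨Kᶜ, hK.isClosed.isOpen_compl, rfl⟩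
  have hz : ∀ y ∈ Kᶜ ∩ halfSpace n, Ω.indicator f y = 0 := fun y hy => by
    by_cases hyΩ : y ∈ Ω
    · rw [indicator_of_mem hyΩ, h0 y hyΩ hy.1]
    · rw [indicator_of_notMem hyΩ]
  have hF : ContDiffOn ℝ 1 (Ω.indicator f) (halfSpace n) := fun y hy => by
    by_cases hyK : y ∈ K
    · have h1 : ContDiffWithinAt ℝ 1 (Ω.indicator f) Ω y :=
        (hf y (hKΩ hyK)).congr (fun z hz => indicator_of_mem hz f) (indicator_of_mem (hKΩ hyK) f)
      exact h1.mono_of_mem_nhdsWithin (hΩ.mem_nhdsWithin (hKΩ hyK))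
    · have h1 : ContDiffWithinAt ℝ 1 (Ω.indicator f) (Kᶜ ∩ halfSpace n) y :=
        (contDiffWithinAt_const (c := (0 : ℝ))).congr hz (hz y ⟨hyK, hy⟩)
      exact h1.mono_of_mem_nhdsWithin (hro.mem_nhdsWithin ⟨hyK, hy⟩)
  have h1 := integral_halfSpace_pderiv_eq_zero hF hK (fun y hy hyK => hz y ⟨hyK, hy⟩) k
    (fun hk y hy => by
      by_cases hyΩ : y ∈ Ω
      · rw [indicator_of_mem hyΩ, hb hk y hyΩ hy]
      · rw [indicator_of_notMem hyΩ])
  rw [← h1, setIntegral_eq_of_subset_of_forall_sdiff_eq_zero (s := Ω)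
    isClosed_halfSpace.measurableSet hΩ.subset]
  · exact setIntegral_congr_fun hΩ.measurableSet fun y hy =>
      pderiv_congr hΩ hy (fun z hz => (indicator_of_mem hz f).symm) k
  · intro y hy
    have hyK : y ∉ K := fun h => hy.2 (hKΩ h)
    rw [pderiv_congr (f' := fun _ => 0) hro ⟨hyK, hy.1⟩ (fun z hz' => hz z hz') k, pderiv_const]

end DivergenceTheorem

/-! ### Interchange of time and space derivatives -/

section CommutingDerivatives

variable {n : ℕ} [NeZero n] {Ω : Set (Coord n)}

/-- Rays in positive coordinate directions never leave the half space, so one-sided derivatives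
along them compute partial derivatives at boundary points as well. -/
theorem ray_mem_halfSpace {y : Coord n} (hy : y ∈ halfSpace n) (i : Fin n) {r : ℝ} (hr : 0 ≤ r) :
    y + r • EuclideanSpace.single i (1 : ℝ) ∈ halfSpace n := by
  rw [mem_halfSpace] at hy ⊢
  simp only [PiLp.add_apply, PiLp.smul_apply, smul_eq_mul, PiLp.single_apply]
  split_ifs <;> simp <;> linarith

theorem hasDerivWithinAt_ray {f : Coord n → ℝ} {y : Coord n} (hy : y ∈ halfSpace n) (i : Fin n)
    {r : ℝ} (hf : DifferentiableWithinAt ℝ f (halfSpace n)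
      (y + r • EuclideanSpace.single i (1 : ℝ))) :
    HasDerivWithinAt (fun ρ : ℝ => f (y + ρ • EuclideanSpace.single i (1 : ℝ)))
      (pderiv f i (y + r • EuclideanSpace.single i (1 : ℝ))) (Ici 0) r := by
  have h1 : HasDerivWithinAt (fun ρ : ℝ => y + ρ • (EuclideanSpace.single i (1 : ℝ) : Coord n))
      ((1 : ℝ) • (EuclideanSpace.single i (1 : ℝ) : Coord n)) (Ici 0) r :=
    ((hasDerivWithinAt_id r _).smul_const _).const_add y
  have h2 := hf.hasFDerivWithinAt.comp_hasDerivWithinAt r h1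
    (fun ρ hρ => ray_mem_halfSpace hy i hρ)
  rw [one_smul] at h2
  exact h2

theorem abs_deriv_le_of_ray {φ : ℝ → ℝ} {D C r₁ : ℝ} (hφ : HasDerivWithinAt φ D (Ici 0) 0)
    (hr : 0 < r₁) (h : ∀ r, 0 < r → r < r₁ → |φ r - φ 0| ≤ C * r) : |D| ≤ C := by
  have h1 : Tendsto (slope φ 0) (𝓝[>] 0) (𝓝 D) :=
    (hasDerivWithinAt_iff_tendsto_slope' (by simp)).1 (hφ.mono Ioi_subset_Ici_self)
  refine le_of_tendsto h1.abs ?_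
  filter_upwards [Ioo_mem_nhdsGT hr] with r hr'
  rw [slope_def_field, abs_div, sub_zero, abs_of_pos hr'.1, div_le_iff₀ hr'.1]
  exact h r hr'.1 hr'.2

/-- The time derivative commutes with partial derivatives. -/
theorem hasDerivAt_pderiv {J : Set ℝ} (hJ : IsOpen J) (hΩ : RelOpen Ω) {f f' : ℝ → Coord n → ℝ}
    (i : Fin n) (hf : ∀ t ∈ J, ∀ y ∈ Ω, DifferentiableWithinAt ℝ (f t) (halfSpace n) y)
    (hf' : ∀ t ∈ J, ∀ y ∈ Ω, DifferentiableWithinAt ℝ (f' t) (halfSpace n) y)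
    (hc : ContinuousOn (fun p : ℝ × Coord n => pderiv (f' p.1) i p.2) (J ×ˢ Ω))
    (hd : ∀ t ∈ J, ∀ y ∈ Ω, HasDerivAt (fun s => f s y) (f' t y) t) {t : ℝ} (ht : t ∈ J)
    {y : Coord n} (hy : y ∈ Ω) :
    HasDerivAt (fun s => pderiv (f s) i y) (pderiv (f' t) i y) t := by
  have hyH := hΩ.subset hy
  set e : Coord n := EuclideanSpace.single i (1 : ℝ) with he
  have hen : ‖e‖ = 1 := by simp [he]
  rw [hasDerivAt_iff_isLittleO, Asymptotics.isLittleO_iff]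
  intro δ hδ
  -- With `δ / 2` around the value at `(t, y)`, two derivatives at nearby points differ by at most
  -- `δ`.
  obtain ⟨r₁, hr₁, hball, hballΩ, hbd⟩ : ∃ r₁ > 0, Metric.ball t r₁ ⊆ J ∧
      (Metric.ball y r₁ ∩ halfSpace n ⊆ Ω) ∧ ∀ τ ∈ Metric.ball t r₁, ∀ z ∈ Metric.ball y r₁ ∩ Ω,
        |pderiv (f' τ) i z - pderiv (f' t) i y| ≤ δ / 2 := by
    obtain ⟨r1, hr1, h1⟩ := Metric.isOpen_iff.1 hJ t ht
    obtain ⟨r2, hr2, h2⟩ := Metric.mem_nhdsWithin_iff.1 (hΩ.mem_nhdsWithin hy)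
    obtain ⟨r3, hr3, h3⟩ := Metric.continuousOn_iff.1 hc (t, y) ⟨ht, hy⟩ (δ / 2) (by positivity)
    refine ⟨min r1 (min r2 r3), by positivity, ?_, ?_, ?_⟩
    · exact (Metric.ball_subset_ball (min_le_left _ _)).trans h1
    · exact (inter_subset_inter_left _ (Metric.ball_subset_ball
        ((min_le_right _ _).trans (min_le_left _ _)))).trans h2
    · intro τ hτ z hz
      have hτJ : τ ∈ J := h1 (Metric.ball_subset_ball (min_le_left _ _) hτ)
      have := h3 (τ, z) ⟨hτJ, hz.2⟩ (by
        rw [Prod.dist_eq, max_lt_iff]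
        exact ⟨lt_of_lt_of_le hτ ((min_le_right _ _).trans (min_le_right _ _)),
          lt_of_lt_of_le hz.1 ((min_le_right _ _).trans (min_le_right _ _))⟩)
      exact (Real.dist_eq _ _ ▸ this).le
  have hray : ∀ r, 0 ≤ r → r < r₁ → y + r • e ∈ Metric.ball y r₁ ∩ Ω := by
    intro r hr hrr
    have hb : y + r • e ∈ Metric.ball y r₁ := by
      rw [Metric.mem_ball, dist_eq_norm, add_sub_cancel_left, norm_smul, hen, mul_one,
        Real.norm_eq_abs, abs_of_nonneg hr]
      exact hrr
    exact ⟨hb, hballΩ ⟨hb, ray_mem_halfSpace hyH i hr⟩⟩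
  have hy0 : y + (0 : ℝ) • e = y := by simp
  filter_upwards [Metric.ball_mem_nhds t hr₁] with s hs
  have hsJ := hball hs
  -- The mean value inequality, applied first in space and then in time, bounds the mixed second
  -- difference of `f` by `δ |s - t| r`. Dividing by `r` and letting `r → 0` bounds the remainder of
  -- the derivative in question.
  have hspace : ∀ τ ∈ Metric.ball t r₁, ∀ r, 0 ≤ r → r < r₁ →
      |(f' τ (y + r • e) - f' τ y) - (f' t (y + r • e) - f' t y)| ≤ δ * r := by
    intro τ hτ r hr hrr
    have := norm_image_sub_le_of_norm_deriv_le_segment'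
      (f := fun ρ => f' τ (y + ρ • e) - f' t (y + ρ • e)) (a := 0) (b := r) (C := δ)
      (f' := fun ρ => pderiv (f' τ) i (y + ρ • e) - pderiv (f' t) i (y + ρ • e))
      (fun ρ hρ => ((hasDerivWithinAt_ray hyH i
        (hf' τ (hball hτ) _ (hray ρ hρ.1 (hρ.2.trans_lt hrr)).2)).sub
        (hasDerivWithinAt_ray hyH i (hf' t ht _ (hray ρ hρ.1 (hρ.2.trans_lt hrr)).2))).mono
          Icc_subset_Ici_self)
      (fun ρ hρ => by
        have hz := hray ρ hρ.1 (hρ.2.trans hrr)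
        have h1 := hbd τ hτ _ hz
        have h2 := hbd t (Metric.mem_ball_self hr₁) _ hz
        rw [Real.norm_eq_abs]
        rw [abs_le] at h1 h2 ⊢
        constructor <;> linarith [h1.1, h1.2, h2.1, h2.2]) r ⟨hr, le_rfl⟩
    rw [hy0, Real.norm_eq_abs, sub_zero] at this
    convert this using 2
    ring
  have htime : ∀ r, 0 ≤ r → r < r₁ →
      |(f s (y + r • e) - f t (y + r • e) - (s - t) * f' t (y + r • e))
        - (f s y - f t y - (s - t) * f' t y)| ≤ δ * |s - t| * r := by
    intro r hr hrr
    have := Convex.norm_image_sub_le_of_norm_hasDerivWithin_le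
      (f := fun τ => (f τ (y + r • e) - f τ y) - τ * (f' t (y + r • e) - f' t y))
      (f' := fun τ => (f' τ (y + r • e) - f' τ y) - (f' t (y + r • e) - f' t y))
      (s := Metric.ball t r₁) (C := δ * r)
      (fun τ hτ => by
        have h1 := (hd τ (hball hτ) _ (hray r hr hrr).2).sub (hd τ (hball hτ) _ hy)
        have h2 := (hasDerivAt_id τ).mul_const (f' t (y + r • e) - f' t y)
        rw [one_mul] at h2
        exact (h1.sub h2).hasDerivWithinAt)
      (fun τ hτ => hspace τ hτ r hr hrr) (convex_ball t r₁) (Metric.mem_ball_self hr₁) hs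
    rw [Real.norm_eq_abs, Real.norm_eq_abs] at this
    calc _ = _ := by congr 1; ring
      _ ≤ _ := this
      _ = _ := by ring
  have hφ : HasDerivWithinAt
      (fun r : ℝ => f s (y + r • e) - f t (y + r • e) - (s - t) * f' t (y + r • e))
      (pderiv (f s) i y - pderiv (f t) i y - (s - t) * pderiv (f' t) i y) (Ici 0) 0 := by
    have hray0 : ∀ h : Coord n → ℝ, DifferentiableWithinAt ℝ h (halfSpace n) y →
        HasDerivWithinAt (fun ρ : ℝ => h (y + ρ • e)) (pderiv h i y) (Ici 0) 0 := by
      intro h hh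
      have := hasDerivWithinAt_ray (f := h) hyH i (r := 0) (by rw [← he, hy0]; exact hh)
      rwa [← he, hy0] at this
    exact ((hray0 _ (hf s hsJ y hy)).sub (hray0 _ (hf t ht y hy))).sub
      ((hray0 _ (hf' t ht y hy)).const_mul (s - t))
  have := abs_deriv_le_of_ray (C := δ * |s - t|) hφ hr₁ fun r hr hrr => by
    have := htime r hr.le hrr
    simpa only [hy0] using this
  rw [Real.norm_eq_abs, Real.norm_eq_abs, smul_eq_mul]
  exact this

end CommutingDerivatives

/-! ### Time-dependent families of functions and their regularity -/

section Families

variable {n : ℕ} [NeZero n] {Ω : Set (Coord n)} {J : Set ℝ}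

/-- The partial derivatives of order at most `k` of `f t` exist and are jointly continuous. -/
def CFam (J : Set ℝ) (Ω : Set (Coord n)) : ℕ → (ℝ → Coord n → ℝ) → Prop
  | 0, f => ContinuousOn (fun p : ℝ × Coord n => f p.1 p.2) (J ×ˢ Ω)
  | k + 1, f => ContinuousOn (fun p : ℝ × Coord n => f p.1 p.2) (J ×ˢ Ω) ∧
      (∀ t ∈ J, ∀ y ∈ Ω, DifferentiableWithinAt ℝ (f t) (halfSpace n) y) ∧
      ∀ i, CFam J Ω k (fun t => pderiv (f t) i)

namespace CFam

theorem continuousOn {k : ℕ} {f : ℝ → Coord n → ℝ} (h : CFam J Ω k f) :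
    ContinuousOn (fun p : ℝ × Coord n => f p.1 p.2) (J ×ˢ Ω) := by
  cases k with
  | zero => exact h
  | succ k => exact h.1

theorem diff {k : ℕ} {f : ℝ → Coord n → ℝ} (h : CFam J Ω (k + 1) f) {t : ℝ} (ht : t ∈ J)
    {y : Coord n} (hy : y ∈ Ω) : DifferentiableWithinAt ℝ (f t) (halfSpace n) y := h.2.1 t ht y hy

theorem pderiv {k : ℕ} {f : ℝ → Coord n → ℝ} (h : CFam J Ω (k + 1) f) (i : Fin n) :
    CFam J Ω k (fun t => RelYamabe.pderiv (f t) i) := h.2.2 i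

theorem of_succ {k : ℕ} {f : ℝ → Coord n → ℝ} (h : CFam J Ω (k + 1) f) : CFam J Ω k f := by
  induction k generalizing f with
  | zero => exact h.1
  | succ k ih => exact ⟨h.1, h.2.1, fun i => ih (h.2.2 i)⟩

theorem of_le {k m : ℕ} {f : ℝ → Coord n → ℝ} (h : CFam J Ω k f) (hm : m ≤ k) : CFam J Ω m f := by
  induction hm with
  | refl => exact h
  | step _ ih => exact ih h.of_succ

theorem mono {k : ℕ} {f : ℝ → Coord n → ℝ} (h : CFam J Ω k f) {J' : Set ℝ} {Ω' : Set (Coord n)}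
    (hJ : J' ⊆ J) (hΩ : Ω' ⊆ Ω) : CFam J' Ω' k f := by
  induction k generalizing f with
  | zero => exact ContinuousOn.mono h (prod_mono hJ hΩ)
  | succ k ih => exact ⟨h.1.mono (prod_mono hJ hΩ),
      fun t ht y hy => h.2.1 t (hJ ht) y (hΩ hy), fun i => ih (h.2.2 i)⟩

theorem congr (hΩ : RelOpen Ω) {k : ℕ} {f f' : ℝ → Coord n → ℝ} (h : CFam J Ω k f)
    (he : ∀ t ∈ J, ∀ y ∈ Ω, f' t y = f t y) : CFam J Ω k f' := by
  induction k generalizing f f' with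
  | zero => exact ContinuousOn.congr h fun p hp => he _ hp.1 _ hp.2
  | succ k ih =>
    refine ⟨h.1.congr fun p hp => he _ hp.1 _ hp.2, fun t ht y hy => ?_, fun i =>
      ih (h.2.2 i) fun t ht y hy => pderiv_congr hΩ hy (he t ht) i⟩
    have h1 := (h.2.1 t ht y hy).mono hΩ.subset
    exact (h1.congr (he t ht) (he t ht y hy)).mono_of_mem_nhdsWithin (hΩ.mem_nhdsWithin hy)

theorem const {k : ℕ} (c : ℝ) : CFam J Ω k (fun _ _ => c) := by
  induction k generalizing c with
  | zero => exact continuousOn_const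
  | succ k ih =>
    refine ⟨continuousOn_const, fun t _ y _ => differentiableWithinAt_const c, fun i => ?_⟩
    have : (fun t : ℝ => RelYamabe.pderiv (fun _ : Coord n => c) i) = fun _ _ => 0 := by
      funext t y; exact pderiv_const c i
    rw [this]; exact ih 0

theorem add (hΩ : RelOpen Ω) {k : ℕ} {f g : ℝ → Coord n → ℝ} (hf : CFam J Ω k f)
    (hg : CFam J Ω k g) : CFam J Ω k (fun t y => f t y + g t y) := by
  induction k generalizing f g with
  | zero => exact ContinuousOn.add hf hg
  | succ k ih =>
    exact ⟨hf.1.add hg.1, fun t ht y hy => (hf.diff ht hy).add (hg.diff ht hy), fun i =>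
      (ih (hf.2.2 i) (hg.2.2 i)).congr hΩ fun t ht y hy =>
        pderiv_add (hΩ.subset hy) (hf.diff ht hy) (hg.diff ht hy) i⟩

theorem mul (hΩ : RelOpen Ω) {k : ℕ} {f g : ℝ → Coord n → ℝ} (hf : CFam J Ω k f)
    (hg : CFam J Ω k g) : CFam J Ω k (fun t y => f t y * g t y) := by
  induction k generalizing f g with
  | zero => exact ContinuousOn.mul hf hg
  | succ k ih =>
    exact ⟨hf.1.mul hg.1, fun t ht y hy => (hf.diff ht hy).mul (hg.diff ht hy), fun i =>
      (add hΩ (ih (hf.2.2 i) hg.of_succ) (ih hf.of_succ (hg.2.2 i))).congr hΩ fun t ht y hy =>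
        pderiv_mul (hΩ.subset hy) (hf.diff ht hy) (hg.diff ht hy) i⟩

theorem const_mul (hΩ : RelOpen Ω) {k : ℕ} {f : ℝ → Coord n → ℝ} (c : ℝ) (hf : CFam J Ω k f) :
    CFam J Ω k (fun t y => c * f t y) := (const c).mul hΩ hf

theorem neg (hΩ : RelOpen Ω) {k : ℕ} {f : ℝ → Coord n → ℝ} (hf : CFam J Ω k f) :
    CFam J Ω k (fun t y => - f t y) :=
  (hf.const_mul hΩ (-1)).congr hΩ fun _ _ _ _ => by ring

theorem sub (hΩ : RelOpen Ω) {k : ℕ} {f g : ℝ → Coord n → ℝ} (hf : CFam J Ω k f)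
    (hg : CFam J Ω k g) : CFam J Ω k (fun t y => f t y - g t y) :=
  (hf.add hΩ (hg.neg hΩ)).congr hΩ fun _ _ _ _ => by ring

theorem sum (hΩ : RelOpen Ω) {k : ℕ} {ι : Type*} (s : Finset ι) {f : ι → ℝ → Coord n → ℝ}
    (hf : ∀ a ∈ s, CFam J Ω k (f a)) : CFam J Ω k (fun t y => ∑ a ∈ s, f a t y) := by
  classical
  induction s using Finset.induction_on with
  | empty => simpa using const 0
  | insert a s ha ih =>
    refine ((hf a (by simp)).add hΩ (ih fun b hb => hf b (by simp [hb]))).congr hΩ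
      fun t _ y _ => ?_
    rw [Finset.sum_insert ha]

theorem of_contDiffOn (hΩ : RelOpen Ω) {k : ℕ} {f : Coord n → ℝ} (hf : ContDiffOn ℝ k f Ω) :
    CFam J Ω k (fun _ => f) := by
  induction k generalizing f with
  | zero => exact hf.continuousOn.comp continuousOn_snd fun p hp => hp.2
  | succ k ih =>
    exact ⟨hf.continuousOn.comp continuousOn_snd fun p hp => hp.2,
      fun t _ y hy => differentiableWithinAt_of_contDiffOn hf hΩ (by simp) hy,
      fun i => ih (contDiffOn_pderiv hf hΩ (by norm_cast) i)⟩

/-- Composition with a smooth function of several variables. -/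
theorem comp_smooth (hΩ : RelOpen Ω) {k : ℕ} {ι : Type*} [Fintype ι] [DecidableEq ι]
    {f : ι → ℝ → Coord n → ℝ}
    {U : Set (ι → ℝ)} (hU : IsOpen U) {F : (ι → ℝ) → ℝ} (hF : ContDiffOn ℝ ∞ F U)
    (hf : ∀ a, CFam J Ω k (f a)) (hm : ∀ t ∈ J, ∀ y ∈ Ω, (fun a => f a t y) ∈ U) :
    CFam J Ω k (fun t y => F (fun a => f a t y)) := by
  induction k generalizing F with
  | zero =>
    exact hF.continuousOn.comp (continuousOn_pi.2 fun a => hf a) fun p hp => hm _ hp.1 _ hp.2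
  | succ k ih =>
    have hFd : ∀ x ∈ U, HasFDerivAt F (fderiv ℝ F x) x := fun x hx =>
      ((hF.contDiffAt (hU.mem_nhds hx)).differentiableAt (by simp)).hasFDerivAt
    have hfd : ∀ t ∈ J, ∀ y ∈ Ω, HasFDerivWithinAt (fun z a => f a t z)
        (ContinuousLinearMap.pi fun a => fderivWithin ℝ (f a t) (halfSpace n) y)
        (halfSpace n) y := fun t ht y hy =>
      hasFDerivWithinAt_pi.2 fun a => ((hf a).diff ht hy).hasFDerivWithinAt
    have hcomp : ∀ t ∈ J, ∀ y ∈ Ω, HasFDerivWithinAt (fun z => F (fun a => f a t z))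
        ((fderiv ℝ F (fun a => f a t y)).comp
          (ContinuousLinearMap.pi fun a => fderivWithin ℝ (f a t) (halfSpace n) y))
        (halfSpace n) y := fun t ht y hy =>
      (hFd _ (hm t ht y hy)).comp_hasFDerivWithinAt y (hfd t ht y hy)
    refine ⟨hF.continuousOn.comp (continuousOn_pi.2 fun a => (hf a).continuousOn)
      fun p hp => hm _ hp.1 _ hp.2, fun t ht y hy => (hcomp t ht y hy).differentiableWithinAt,
      fun i => ?_⟩
    refine (sum hΩ Finset.univ fun a _ => mul hΩ
      (ih (F := fun x => fderiv ℝ F x (Pi.single a 1)) ?_ fun a => (hf a).of_succ)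
      ((hf a).pderiv i)).congr hΩ fun t ht y hy => ?_
    · exact ((hF.fderiv_of_isOpen hU (m := ∞) (by simp)).clm_apply contDiffOn_const)
    · rw [pderiv_def, (hcomp t ht y hy).fderivWithin (uniqueDiffOn_halfSpace y (hΩ.subset hy))]
      rw [ContinuousLinearMap.comp_apply]
      set v : ι → ℝ := (ContinuousLinearMap.pi fun a => fderivWithin ℝ (f a t) (halfSpace n) y)
        (EuclideanSpace.single i 1) with hv
      conv_lhs => rw [← Finset.univ_sum_single v, map_sum]
      refine Finset.sum_congr rfl fun a _ => ?_
      rw [show Pi.single a (v a) = v a • (Pi.single a (1 : ℝ) : ι → ℝ) by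
        rw [← Pi.single_smul]; simp, map_smul, smul_eq_mul, mul_comm]
      rfl

theorem comp_scalar (hΩ : RelOpen Ω) {k : ℕ} {f : ℝ → Coord n → ℝ} {U : Set ℝ} (hU : IsOpen U)
    {F : ℝ → ℝ} (hF : ContDiffOn ℝ ∞ F U) (hf : CFam J Ω k f)
    (hm : ∀ t ∈ J, ∀ y ∈ Ω, f t y ∈ U) : CFam J Ω k (fun t y => F (f t y)) :=
  comp_smooth (ι := Unit) (f := fun _ => f) (U := (fun x => x ()) ⁻¹' U) hΩ
    (hU.preimage (continuous_apply ())) (F := fun x => F (x ()))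
    (hF.comp (contDiff_apply ℝ ℝ ()).contDiffOn (mapsTo_preimage _ _)) (fun _ => hf) hm

theorem inv_matrix (hΩ : RelOpen Ω) {k : ℕ} {G : ℝ → Coord n → Matrix (Fin n) (Fin n) ℝ}
    (hG : ∀ i j, CFam J Ω k (fun t y => G t y i j)) (hd : ∀ t ∈ J, ∀ y ∈ Ω, (G t y).det ≠ 0)
    (i j : Fin n) : CFam J Ω k (fun t y => (G t y)⁻¹ i j) := by
  have hc : Continuous fun x : Fin n × Fin n → ℝ =>
      (Matrix.of fun a b => x (a, b) : Matrix (Fin n) (Fin n) ℝ).det :=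
    Continuous.matrix_det (by fun_prop)
  exact comp_smooth (ι := Fin n × Fin n) (f := fun a t y => G t y a.1 a.2) hΩ
    (isOpen_ne_fun hc continuous_const)
    (F := fun x => (Matrix.of fun a b => x (a, b) : Matrix (Fin n) (Fin n) ℝ)⁻¹ i j)
    (contDiffOn_inv (fun a b => by simp only [Matrix.of_apply]; fun_prop) (fun x hx => hx) i j)
    (fun a => hG a.1 a.2) hd

theorem det (hΩ : RelOpen Ω) {k : ℕ} {G : ℝ → Coord n → Matrix (Fin n) (Fin n) ℝ}
    (hG : ∀ i j, CFam J Ω k (fun t y => G t y i j)) : CFam J Ω k (fun t y => (G t y).det) :=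
  comp_smooth (ι := Fin n × Fin n) (f := fun a t y => G t y a.1 a.2) hΩ isOpen_univ
    (F := fun x => (Matrix.of fun a b => x (a, b) : Matrix (Fin n) (Fin n) ℝ).det)
    (contDiffOn_det fun a b => by simp only [Matrix.of_apply]; fun_prop)
    (fun a => hG a.1 a.2) fun _ _ _ _ => mem_univ _

theorem contDiffOn (hΩ : RelOpen Ω) {k : ℕ} {f : ℝ → Coord n → ℝ} (hf : CFam J Ω k f) {t : ℝ}
    (ht : t ∈ J) : ContDiffOn ℝ k (f t) Ω := by
  have hc : ∀ {h : ℝ → Coord n → ℝ}, ContinuousOn (fun p : ℝ × Coord n => h p.1 p.2) (J ×ˢ Ω) →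
      ContinuousOn (h t) Ω := fun hh =>
    hh.comp (f := fun y => (t, y)) (by fun_prop) fun y hy => ⟨ht, hy⟩
  induction k generalizing f with
  | zero => exact contDiffOn_zero.2 (hc hf)
  | succ k ih =>
    rw [show ((k + 1 : ℕ) : WithTop ℕ∞) = (k : WithTop ℕ∞) + 1 by norm_cast,
      contDiffOn_succ_iff_fderivWithin hΩ.uniqueDiffOn]
    refine ⟨fun y hy => (hf.diff ht hy).mono hΩ.subset, by simp, ?_⟩
    have h1 : ContDiffOn ℝ k (fun y => ∑ i, RelYamabe.pderiv (f t) i y •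
        (PiLp.proj 2 (fun _ : Fin n => ℝ) i : Coord n →L[ℝ] ℝ)) Ω :=
      ContDiffOn.sum fun i _ => (ih (hf.pderiv i)).smul contDiffOn_const
    refine h1.congr fun y hy => ?_
    ext v
    rw [← hΩ.fderivWithin_eq hy, fderivWithin_apply_eq_sum]
    simp [mul_comm]

end CFam

/-- A family that is differentiable in time, together with its time derivative. -/
structure TFam (J : Set ℝ) (Ω : Set (Coord n)) (k : ℕ) (f f' : ℝ → Coord n → ℝ) : Prop where
  fam : CFam J Ω k f
  fam' : CFam J Ω k f'
  hasDerivAt : ∀ t ∈ J, ∀ y ∈ Ω, HasDerivAt (fun s => f s y) (f' t y) t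

namespace TFam

theorem of_le {k m : ℕ} {f f' : ℝ → Coord n → ℝ} (h : TFam J Ω k f f') (hm : m ≤ k) :
    TFam J Ω m f f' := ⟨h.fam.of_le hm, h.fam'.of_le hm, h.hasDerivAt⟩

theorem pderiv (hJ : IsOpen J) (hΩ : RelOpen Ω) {k : ℕ} {f f' : ℝ → Coord n → ℝ}
    (h : TFam J Ω (k + 1) f f') (i : Fin n) :
    TFam J Ω k (fun t => RelYamabe.pderiv (f t) i) (fun t => RelYamabe.pderiv (f' t) i) :=
  ⟨h.fam.pderiv i, h.fam'.pderiv i, fun _ ht _ hy => hasDerivAt_pderiv hJ hΩ i h.fam.2.1 h.fam'.2.1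
    (h.fam'.pderiv i).continuousOn h.hasDerivAt ht hy⟩

theorem add (hΩ : RelOpen Ω) {k : ℕ} {f f' g g' : ℝ → Coord n → ℝ} (hf : TFam J Ω k f f')
    (hg : TFam J Ω k g g') :
    TFam J Ω k (fun t y => f t y + g t y) (fun t y => f' t y + g' t y) :=
  ⟨hf.fam.add hΩ hg.fam, hf.fam'.add hΩ hg.fam', fun t ht y hy =>
    (hf.hasDerivAt t ht y hy).add (hg.hasDerivAt t ht y hy)⟩

theorem sub (hΩ : RelOpen Ω) {k : ℕ} {f f' g g' : ℝ → Coord n → ℝ} (hf : TFam J Ω k f f')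
    (hg : TFam J Ω k g g') :
    TFam J Ω k (fun t y => f t y - g t y) (fun t y => f' t y - g' t y) :=
  ⟨hf.fam.sub hΩ hg.fam, hf.fam'.sub hΩ hg.fam', fun t ht y hy =>
    (hf.hasDerivAt t ht y hy).sub (hg.hasDerivAt t ht y hy)⟩

theorem mul (hΩ : RelOpen Ω) {k : ℕ} {f f' g g' : ℝ → Coord n → ℝ} (hf : TFam J Ω k f f')
    (hg : TFam J Ω k g g') :
    TFam J Ω k (fun t y => f t y * g t y) (fun t y => f' t y * g t y + f t y * g' t y) :=
  ⟨hf.fam.mul hΩ hg.fam, (hf.fam'.mul hΩ hg.fam).add hΩ (hf.fam.mul hΩ hg.fam'), fun t ht y hy =>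
    (hf.hasDerivAt t ht y hy).mul (hg.hasDerivAt t ht y hy)⟩

theorem const_mul (hΩ : RelOpen Ω) {k : ℕ} {f f' : ℝ → Coord n → ℝ} (c : ℝ)
    (hf : TFam J Ω k f f') : TFam J Ω k (fun t y => c * f t y) (fun t y => c * f' t y) :=
  ⟨hf.fam.const_mul hΩ c, hf.fam'.const_mul hΩ c, fun t ht y hy =>
    (hf.hasDerivAt t ht y hy).const_mul c⟩

theorem sum (hΩ : RelOpen Ω) {k : ℕ} {ι : Type*} (s : Finset ι) {f f' : ι → ℝ → Coord n → ℝ}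
    (hf : ∀ a ∈ s, TFam J Ω k (f a) (f' a)) :
    TFam J Ω k (fun t y => ∑ a ∈ s, f a t y) (fun t y => ∑ a ∈ s, f' a t y) :=
  ⟨CFam.sum hΩ s fun a ha => (hf a ha).fam, CFam.sum hΩ s fun a ha => (hf a ha).fam',
    fun t ht y hy => HasDerivAt.fun_sum fun a ha => (hf a ha).hasDerivAt t ht y hy⟩

theorem congr (hΩ : RelOpen Ω) {k : ℕ} {f f' g' : ℝ → Coord n → ℝ}
    (hf : TFam J Ω k f f') (he' : ∀ t ∈ J, ∀ y ∈ Ω, g' t y = f' t y) : TFam J Ω k f g' :=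
  ⟨hf.fam, hf.fam'.congr hΩ he', fun t ht y hy => by
    rw [he' t ht y hy]; exact hf.hasDerivAt t ht y hy⟩

/-- The inverse of a family of matrices. -/
theorem inv_matrix (hΩ : RelOpen Ω) {k : ℕ} {G G' : ℝ → Coord n → Matrix (Fin n) (Fin n) ℝ}
    (hG : ∀ i j, TFam J Ω k (fun t y => G t y i j) (fun t y => G' t y i j))
    (hd : ∀ t ∈ J, ∀ y ∈ Ω, (G t y).det ≠ 0) (i j : Fin n) :
    TFam J Ω k (fun t y => (G t y)⁻¹ i j)
      (fun t y => (-((G t y)⁻¹ * G' t y * (G t y)⁻¹)) i j) := by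
  have hI := fun i j => CFam.inv_matrix hΩ (fun i j => (hG i j).fam) hd i j
  refine ⟨hI i j, ?_, fun t ht y hy => ?_⟩
  · simp only [Matrix.neg_apply, Matrix.mul_apply]
    exact (CFam.sum hΩ _ fun a _ => (CFam.sum hΩ _ fun b _ =>
      (hI i b).mul hΩ (hG b a).fam').mul hΩ (hI a j)).neg hΩ
  · let _ : NormedRing (Matrix (Fin n) (Fin n) ℝ) := Matrix.linftyOpNormedRing
    let _ : NormedAlgebra ℝ (Matrix (Fin n) (Fin n) ℝ) := Matrix.linftyOpNormedAlgebra
    have hGd : HasDerivAt (fun s => G s y) (G' t y) t :=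
      hasDerivAt_pi.2 fun a => hasDerivAt_pi.2 fun b => (hG a b).hasDerivAt t ht y hy
    have hu : IsUnit (G t y) :=
      (Matrix.isUnit_iff_isUnit_det _).2 (isUnit_iff_ne_zero.2 (hd t ht y hy))
    obtain ⟨w, hw⟩ := hu
    have h1 := (hasFDerivAt_ringInverse (𝕜 := ℝ) w).comp_hasDerivAt_of_eq t hGd hw
    have hv : (-(ContinuousLinearMap.mulLeftRight ℝ (Matrix (Fin n) (Fin n) ℝ)) ↑w⁻¹ ↑w⁻¹) (G' t y)
        = -((G t y)⁻¹ * G' t y * (G t y)⁻¹) := by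
      rw [← hw, ← Matrix.coe_units_inv]
      rfl
    have e : (Ring.inverse ∘ fun s => G s y) = fun s => (G s y)⁻¹ := by
      funext s; exact (Matrix.nonsing_inv_eq_ringInverse _).symm
    rw [e, hv] at h1
    exact hasDerivAt_pi.1 (hasDerivAt_pi.1 h1 i) j

end TFam

end Families

/-! ### Index identities behind the linearized scalar curvature -/

section Algebra

variable {n : ℕ}

theorem sum_rotate₃ (f : Fin n → Fin n → Fin n → ℝ) :
    ∑ i, ∑ j, ∑ k, f i j k = ∑ k, ∑ i, ∑ j, f i j k := by
  rw [Finset.sum_congr rfl fun i _ => Finset.sum_comm, Finset.sum_comm]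

theorem sum_perm₄ {f h : Fin n → Fin n → Fin n → Fin n → ℝ}
    (e : Fin n × Fin n × Fin n × Fin n ≃ Fin n × Fin n × Fin n × Fin n)
    (H : ∀ p : Fin n × Fin n × Fin n × Fin n,
      f p.1 p.2.1 p.2.2.1 p.2.2.2 = h (e p).1 (e p).2.1 (e p).2.2.1 (e p).2.2.2) :
    ∑ i, ∑ j, ∑ k, ∑ l, f i j k l = ∑ i, ∑ j, ∑ k, ∑ l, h i j k l := by
  have h1 : ∀ F : Fin n → Fin n → Fin n → Fin n → ℝ, ∑ i, ∑ j, ∑ k, ∑ l, F i j k l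
      = ∑ p : Fin n × Fin n × Fin n × Fin n, F p.1 p.2.1 p.2.2.1 p.2.2.2 := fun F => by
    simp only [Fintype.sum_prod_type]
  rw [h1, h1]
  exact Fintype.sum_equiv e _ _ H

/-- The contraction of the linearized Ricci tensor is a divergence. -/
theorem sum_linearizedRicci_eq (g : Fin n → Fin n → ℝ) (Γ C : Fin n → Fin n → Fin n → ℝ)
    (D : Fin n → Fin n → Fin n → Fin n → ℝ) (dg : Fin n → Fin n → Fin n → ℝ)
    (hΓ : ∀ k i j, Γ k i j = Γ k j i) (hC : ∀ k i j, C k i j = C k j i)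
    (hdg : ∀ k i j, dg k i j = -∑ m, (Γ i k m * g m j + Γ j k m * g i m)) :
    ∑ i, ∑ j, g i j * (∑ k, (D k k i j - D j k i k)
        + ∑ k, ∑ l, (C k k l * Γ l i j + Γ k k l * C l i j
          - (C k j l * Γ l i k + Γ k j l * C l i k)))
      = ∑ k, ((∑ i, ∑ j, (dg k i j * C k i j + g i j * D k k i j
          - (dg k i k * C j i j + g i k * D k j i j)))
        + ∑ l, Γ l k l * ∑ i, ∑ j, (g i j * C k i j - g i k * C j i j)) := by
  have e1 : ∀ k, ∑ i, ∑ j, dg k i j * C k i j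
      = -∑ i, ∑ j, ∑ m, Γ i k m * g m j * C k i j
        - ∑ i, ∑ j, ∑ m, Γ j k m * g i m * C k i j := fun k => by
    simp only [hdg, ← Finset.sum_neg_distrib, ← Finset.sum_sub_distrib, Finset.sum_mul]
    refine Finset.sum_congr rfl fun i _ => Finset.sum_congr rfl fun j _ =>
      Finset.sum_congr rfl fun m _ => by ring
  have e2 : ∀ k, ∑ i, ∑ j, dg k i k * C j i j
      = -∑ i, ∑ j, ∑ m, Γ i k m * g m k * C j i j
        - ∑ i, ∑ j, ∑ m, Γ k k m * g i m * C j i j := fun k => by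
    simp only [hdg, ← Finset.sum_neg_distrib, ← Finset.sum_sub_distrib, Finset.sum_mul]
    refine Finset.sum_congr rfl fun i _ => Finset.sum_congr rfl fun j _ =>
      Finset.sum_congr rfl fun m _ => by ring
  simp only [Finset.mul_sum, mul_add, mul_sub, Finset.sum_add_distrib, Finset.sum_sub_distrib,
    e1, e2, ← mul_assoc]
  -- The terms with `D`, the derivatives of `C`, agree on both sides after renaming indices, and so
  -- do the products of `Γ` with `C`. On the divergence side one product occurs twice with opposite
  -- signs and drops out (`f2`).
  have a1 : ∑ i, ∑ j, ∑ k, g i j * D k k i j = ∑ k, ∑ i, ∑ j, g i j * D k k i j :=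
    sum_rotate₃ _
  have a2 : ∑ i, ∑ j, ∑ k, g i j * D j k i k = ∑ k, ∑ i, ∑ j, g i k * D k j i j := by
    rw [Finset.sum_comm]
  have b1 : ∑ i, ∑ j, ∑ k, ∑ l, g i j * C k k l * Γ l i j
      = ∑ k, ∑ i, ∑ j, ∑ m, Γ i k m * g m k * C j i j := by
    refine sum_perm₄ ⟨fun p => (p.2.1, p.2.2.2, p.2.2.1, p.1), fun p => (p.2.2.2, p.1, p.2.2.1, p.2.1),
      fun _ => rfl, fun _ => rfl⟩ fun p => ?_
    simp only [Equiv.coe_fn_mk]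
    rw [hΓ p.2.2.2 p.2.1 p.1, hC p.2.2.1 p.2.2.2 p.2.2.1]; ring
  have b2 : ∑ i, ∑ j, ∑ k, ∑ l, g i j * Γ k k l * C l i j
      = ∑ k, ∑ l, ∑ i, ∑ j, Γ l k l * g i j * C k i j := by
    refine sum_perm₄ ⟨fun p => (p.2.2.2, p.2.2.1, p.1, p.2.1), fun p => (p.2.2.1, p.2.2.2, p.2.1, p.1),
      fun _ => rfl, fun _ => rfl⟩ fun p => ?_
    simp only [Equiv.coe_fn_mk]
    rw [hΓ p.2.2.1 p.2.2.2 p.2.2.1]; ring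
  have b3 : ∑ i, ∑ j, ∑ k, ∑ l, g i j * C k j l * Γ l i k
      = ∑ k, ∑ i, ∑ j, ∑ m, Γ i k m * g m j * C k i j := by
    refine sum_perm₄ ⟨fun p => (p.2.2.1, p.2.2.2, p.2.1, p.1), fun p => (p.2.2.2, p.2.2.1, p.1, p.2.1),
      fun _ => rfl, fun _ => rfl⟩ fun p => ?_
    simp only [Equiv.coe_fn_mk]
    rw [hΓ p.2.2.2 p.2.2.1 p.1, hC p.2.2.1 p.2.2.2 p.2.1]; ring
  have b4 : ∑ i, ∑ j, ∑ k, ∑ l, g i j * Γ k j l * C l i k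
      = ∑ k, ∑ i, ∑ j, ∑ m, Γ j k m * g i m * C k i j := by
    refine sum_perm₄ ⟨fun p => (p.2.2.2, p.1, p.2.2.1, p.2.1), fun p => (p.2.1, p.2.2.2, p.2.2.1, p.1),
      fun _ => rfl, fun _ => rfl⟩ fun p => ?_
    simp only [Equiv.coe_fn_mk]
    rw [hΓ p.2.2.1 p.2.2.2 p.2.1]; ring
  have f2 : ∑ k, ∑ l, ∑ i, ∑ j, Γ l k l * g i k * C j i j
      = ∑ k, ∑ i, ∑ j, ∑ m, Γ k k m * g i m * C j i j := by
    refine sum_perm₄ ⟨fun p => (p.2.1, p.2.2.1, p.2.2.2, p.1), fun p => (p.2.2.2, p.1, p.2.1, p.2.2.1),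
      fun _ => rfl, fun _ => rfl⟩ fun p => ?_
    simp only [Equiv.coe_fn_mk]
    rw [hΓ p.2.1 p.1 p.2.1]
  rw [a1, a2, b1, b2, b3, b4, f2]
  simp only [Finset.sum_neg_distrib]
  ring

/-- On a boundary on which the mean curvature and its linearizations vanish, the normal component of
the divergence part of the linearized scalar curvature is a tangential divergence. -/
theorem sum_normal_component_eq [NeZero n] (g p : Fin n → Fin n → ℝ)
    (Γ C : Fin n → Fin n → Fin n → ℝ) (dg dp : Fin n → Fin n → Fin n → ℝ) (da : Fin n → ℝ) {a : ℝ}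
    (hg : ∀ i j, g i j = g j i) (hp : ∀ i j, p i j = p j i)
    (hΓ : ∀ k i j, Γ k i j = Γ k j i) (hC : ∀ k i j, C k i j = C k j i)
    (hdg : ∀ k i j, dg k i j = -∑ m, (Γ i k m * g m j + Γ j k m * g i m))
    (hdp : ∀ k i j, dp k i j = -∑ m, (C i k m * g m j + Γ i k m * p m j
      + (C j k m * g i m + Γ j k m * p i m)))
    (h00 : g 0 0 ≠ 0)
    (hda : ∀ k, da k * g 0 0 + a * dg k 0 0 = dp k 0 0)
    (h1 : ∑ i, ∑ j, (g i j - g i 0 * g j 0 / g 0 0) * Γ 0 i j = 0)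
    (h2 : ∑ i, ∑ j, (g i j - g i 0 * g j 0 / g 0 0) * C 0 i j = 0)
    (h3 : ∑ i, ∑ j, (p i j - ((p i 0 * g j 0 + g i 0 * p j 0) / g 0 0
      - a * (g i 0 * g j 0 / g 0 0))) * Γ 0 i j = 0) :
    ∑ i, ∑ j, (g i j * C 0 i j - g i 0 * C j i j)
      = ∑ k, (dp k k 0 - (dg k k 0 * a + g k 0 * da k)
        + ∑ l, Γ l k l * (p k 0 - g k 0 * a)) := by
  set q := (g 0 0)⁻¹ with hq
  have hq1 : g 0 0 * q = 1 := mul_inv_cancel₀ h00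
  set P := ∑ i, ∑ j, g i 0 * g j 0 * Γ 0 i j with hP
  set Q := ∑ i, ∑ j, g i 0 * g j 0 * C 0 i j with hQ
  set N := ∑ i, ∑ j, p i 0 * g j 0 * Γ 0 i j with hN
  have hN' : ∑ i, ∑ j, g i 0 * p j 0 * Γ 0 i j = N := by
    rw [hN, Finset.sum_comm]
    exact Finset.sum_congr rfl fun i _ => Finset.sum_congr rfl fun j _ => by rw [hΓ]; ring
  -- The hypotheses `h1`, `h2`, `h3` trade full traces of `Γ⁰` and `C⁰` for their purely normal
  -- contractions `P`, `Q`, `N`. The rest is linear algebra in `P`, `Q`, `N` and the traces `s₁`,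
  -- `s₂`, `s₃`.
  have e1 : ∑ i, ∑ j, g i j * Γ 0 i j = q * P := by
    rw [← sub_eq_zero, ← h1, hP, Finset.mul_sum, ← Finset.sum_sub_distrib]
    refine Finset.sum_congr rfl fun i _ => ?_
    rw [Finset.mul_sum, ← Finset.sum_sub_distrib]
    exact Finset.sum_congr rfl fun j _ => by rw [hq]; ring
  have e2 : ∑ i, ∑ j, g i j * C 0 i j = q * Q := by
    rw [← sub_eq_zero, ← h2, hQ, Finset.mul_sum, ← Finset.sum_sub_distrib]
    refine Finset.sum_congr rfl fun i _ => ?_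
    rw [Finset.mul_sum, ← Finset.sum_sub_distrib]
    exact Finset.sum_congr rfl fun j _ => by rw [hq]; ring
  have e3 : ∑ i, ∑ j, p i j * Γ 0 i j = 2 * (q * N) - a * q * P := by
    have : ∑ i, ∑ j, p i j * Γ 0 i j - (q * N + q * ∑ i, ∑ j, g i 0 * p j 0 * Γ 0 i j
        - a * q * P) = 0 := by
      rw [← h3, hP, hN]
      simp only [Finset.mul_sum, ← Finset.sum_sub_distrib, ← Finset.sum_add_distrib]
      exact Finset.sum_congr rfl fun i _ => Finset.sum_congr rfl fun j _ => by rw [hq]; ring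
    rw [hN'] at this
    linarith
  set s₁ := ∑ k, ∑ m, C k k m * g m 0 with hs₁
  set s₂ := ∑ k, ∑ m, Γ k k m * p m 0 with hs₂
  set s₃ := ∑ k, ∑ m, Γ k k m * g m 0 with hs₃
  have hswap : ∀ F : Fin n → Fin n → Fin n → ℝ, (∀ k i j, F k i j = F k j i) → ∀ v : Fin n → ℝ,
      ∑ k, ∑ l, F l k l * v k = ∑ k, ∑ m, F k k m * v m := fun F hF v => by
    rw [Finset.sum_comm]
    exact Finset.sum_congr rfl fun i _ => Finset.sum_congr rfl fun j _ => by rw [hF]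
  have f1 : ∑ k, dp k k 0 = -s₁ - s₂ - q * Q - (2 * (q * N) - a * q * P) := by
    rw [← e2, ← e3, hs₁, hs₂]
    simp only [hdp, ← Finset.sum_neg_distrib, ← Finset.sum_sub_distrib]
    exact Finset.sum_congr rfl fun i _ => Finset.sum_congr rfl fun j _ => by ring
  have f2 : ∑ k, dg k k 0 = -s₃ - q * P := by
    rw [← e1, hs₃]
    simp only [hdg, ← Finset.sum_neg_distrib, ← Finset.sum_sub_distrib]
    exact Finset.sum_congr rfl fun i _ => Finset.sum_congr rfl fun j _ => by ring
  have f3 : ∑ k, g k 0 * dg k 0 0 = -2 * P := by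
    rw [hP, Finset.mul_sum]
    simp only [hdg, Finset.mul_sum, ← Finset.sum_neg_distrib]
    exact Finset.sum_congr rfl fun i _ => Finset.sum_congr rfl fun j _ => by rw [hg 0 j]; ring
  have f4 : ∑ k, g k 0 * dp k 0 0 = -2 * Q - 2 * N := by
    have : ∑ k, g k 0 * dp k 0 0 = -2 * Q - 2 * ∑ i, ∑ j, g i 0 * p j 0 * Γ 0 i j := by
      rw [hQ]
      simp only [hdp, Finset.mul_sum, ← Finset.sum_neg_distrib, ← Finset.sum_sub_distrib]
      exact Finset.sum_congr rfl fun i _ => Finset.sum_congr rfl fun j _ => by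
        rw [hg 0 j, hp 0 j]; ring
    rw [this, hN']
  have f5 : ∑ k, g k 0 * da k = q * (-2 * Q - 2 * N) - q * a * (-2 * P) := by
    rw [← f4, ← f3, Finset.mul_sum, Finset.mul_sum, ← Finset.sum_sub_distrib]
    refine Finset.sum_congr rfl fun k _ => ?_
    have : da k = q * (dp k 0 0 - a * dg k 0 0) := by
      rw [← hda k]; linear_combination (- da k) * hq1
    rw [this]; ring
  have f6 : ∑ i, ∑ j, g i 0 * C j i j = s₁ := by
    rw [hs₁, ← hswap C hC]
    exact Finset.sum_congr rfl fun i _ => Finset.sum_congr rfl fun j _ => by ring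
  have f7 : ∑ k, ∑ l, Γ l k l * (p k 0 - g k 0 * a) = s₂ - s₃ * a := by
    rw [hs₂, hs₃, ← hswap Γ hΓ, ← hswap Γ hΓ]
    simp only [Finset.sum_mul, ← Finset.sum_sub_distrib]
    exact Finset.sum_congr rfl fun i _ => Finset.sum_congr rfl fun j _ => by ring
  have f8 : ∑ k, dg k k 0 * a = (-s₃ - q * P) * a := by rw [← f2, Finset.sum_mul]
  simp only [Finset.sum_add_distrib, Finset.sum_sub_distrib, f1, f5, f7, f8, e2, f6]
  ring

end Algebra

/-! ### First variation of curvature and volume density -/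

section Variation

variable {n : ℕ} [NeZero n] {Ω : Set (Coord n)} {J : Set ℝ}
  {G H : ℝ → Coord n → Matrix (Fin n) (Fin n) ℝ}

/-- The device by which identities are linearized: a relation that holds at all times of an open set
is differentiated, and uniqueness of the derivative gives its linear version without a new tensor
computation. -/
theorem deriv_unique_of_eqOn {J : Set ℝ} (hJ : IsOpen J) {f g : ℝ → ℝ} {a b t : ℝ} (ht : t ∈ J)
    (he : ∀ s ∈ J, f s = g s) (hf : HasDerivAt f a t) (hg : HasDerivAt g b t) : a = b :=
  hf.unique (hg.congr_of_eventuallyEq (by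
    filter_upwards [hJ.mem_nhds ht] with s hs using he s hs))

/-- The time derivative of the inverse metric. -/
def dinv (G H : Coord n → Matrix (Fin n) (Fin n) ℝ) (y : Coord n) : Matrix (Fin n) (Fin n) ℝ :=
  -((G y)⁻¹ * H y * (G y)⁻¹)

/-- The time derivative of the Christoffel symbols. -/
def dchr (G H : Coord n → Matrix (Fin n) (Fin n) ℝ) (k i j : Fin n) (y : Coord n) : ℝ :=
  (1 / 2) * ∑ l, (dinv G H y k l *
      (pderiv (fun z => G z j l) i y + pderiv (fun z => G z i l) j y
        - pderiv (fun z => G z i j) l y)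
    + (G y)⁻¹ k l * (pderiv (fun z => H z j l) i y + pderiv (fun z => H z i l) j y
      - pderiv (fun z => H z i j) l y))

/-- The vector field `X` in the linearization `R' = -⟨Ric, h⟩ + div X` of the scalar curvature. -/
def scalVec (G H : Coord n → Matrix (Fin n) (Fin n) ℝ) (k : Fin n) (y : Coord n) : ℝ :=
  ∑ i, ∑ j, ((G y)⁻¹ i j * dchr G H k i j y - (G y)⁻¹ i k * dchr G H j i j y)

/-- A family of metrics that is differentiable in time, with time derivative `H`. -/
structure MetricFam (J : Set ℝ) (Ω : Set (Coord n)) (G H : ℝ → Coord n → Matrix (Fin n) (Fin n) ℝ) :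
    Prop where
  isOpen : IsOpen J
  relOpen : RelOpen Ω
  isLocalMetric : ∀ t ∈ J, IsLocalMetric Ω (G t)
  tfam : ∀ i j, TFam J Ω 2 (fun t y => G t y i j) (fun t y => H t y i j)

namespace MetricFam

variable {t : ℝ} {y : Coord n}

theorem tfam_inv (h : MetricFam J Ω G H) (i j : Fin n) :
    TFam J Ω 2 (fun t y => (G t y)⁻¹ i j) (fun t y => dinv (G t) (H t) y i j) :=
  TFam.inv_matrix h.relOpen h.tfam (fun t ht _ hy => (h.isLocalMetric t ht).det_ne_zero hy) i j

theorem tfam_chr (h : MetricFam J Ω G H) (k i j : Fin n) :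
    TFam J Ω 1 (fun t => chr (G t) k i j) (fun t => dchr (G t) (H t) k i j) := by
  have hp : ∀ i j a, TFam J Ω 1 (fun t => pderiv (fun z => G t z i j) a)
      (fun t => pderiv (fun z => H t z i j) a) := fun i j a =>
    (h.tfam i j).pderiv h.isOpen h.relOpen a
  exact (TFam.sum h.relOpen Finset.univ fun l _ => ((h.tfam_inv k l).of_le one_le_two).mul h.relOpen
    (((hp j l i).add h.relOpen (hp i l j)).sub h.relOpen (hp i j l))).const_mul h.relOpen (1 / 2)

theorem cfam_scalVec (h : MetricFam J Ω G H) (k : Fin n) :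
    CFam J Ω 1 (fun t => scalVec (G t) (H t) k) :=
  CFam.sum h.relOpen _ fun i _ => CFam.sum h.relOpen _ fun j _ =>
    (((h.tfam_inv i j).fam.of_le one_le_two).mul h.relOpen (h.tfam_chr k i j).fam').sub h.relOpen
    (((h.tfam_inv i k).fam.of_le one_le_two).mul h.relOpen (h.tfam_chr j i j).fam')

theorem dinv_symm (h : MetricFam J Ω G H) (ht : t ∈ J) (hy : y ∈ Ω) (i j : Fin n) :
    dinv (G t) (H t) y i j = dinv (G t) (H t) y j i :=
  deriv_unique_of_eqOn h.isOpen ht (fun s hs => (h.isLocalMetric s hs).inv_symm hy i j)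
    ((h.tfam_inv i j).hasDerivAt t ht y hy) ((h.tfam_inv j i).hasDerivAt t ht y hy)

theorem dchr_symm (h : MetricFam J Ω G H) (ht : t ∈ J) (hy : y ∈ Ω) (k i j : Fin n) :
    dchr (G t) (H t) k i j y = dchr (G t) (H t) k j i y :=
  deriv_unique_of_eqOn h.isOpen ht (fun s hs => (h.isLocalMetric s hs).chr_symm hy k i j)
    ((h.tfam_chr k i j).hasDerivAt t ht y hy) ((h.tfam_chr k j i).hasDerivAt t ht y hy)

theorem _root_.RelYamabe.IsLocalMetric.pderiv_inv {G : Coord n → Matrix (Fin n) (Fin n) ℝ}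
    (h : IsLocalMetric Ω G) (hy : y ∈ Ω) (k i j : Fin n) :
    pderiv (fun z => (G z)⁻¹ i j) k y
      = -∑ m, (chr G i k m y * (G y)⁻¹ m j + chr G j k m y * (G y)⁻¹ i m) := by
  have := congrFun (congrFun (h.mderiv_inv hy k) i) j
  rw [mderiv_apply] at this
  rw [this, Matrix.sub_apply, Matrix.neg_apply, Matrix.mul_apply, Matrix.mul_apply,
    Finset.sum_add_distrib, neg_add']
  simp only [Matrix.transpose_apply, conn_apply, mul_comm]

/-- The time derivative of `∇g⁻¹ = 0`, using that time and space derivatives commute. -/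
theorem pderiv_dinv (h : MetricFam J Ω G H) (ht : t ∈ J) (hy : y ∈ Ω) (k i j : Fin n) :
    pderiv (fun z => dinv (G t) (H t) z i j) k y
      = -∑ m, (dchr (G t) (H t) i k m y * (G t y)⁻¹ m j + chr (G t) i k m y * dinv (G t) (H t) y m j
        + (dchr (G t) (H t) j k m y * (G t y)⁻¹ i m
          + chr (G t) j k m y * dinv (G t) (H t) y i m)) := by
  have hc := fun k i j => (h.tfam_chr k i j).hasDerivAt t ht y hy
  have hi := fun i j => (h.tfam_inv i j).hasDerivAt t ht y hy
  refine deriv_unique_of_eqOn h.isOpen ht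
    (fun s hs => (h.isLocalMetric s hs).pderiv_inv hy k i j)
    (((h.tfam_inv i j).pderiv h.isOpen h.relOpen k).hasDerivAt t ht y hy) ?_
  exact (HasDerivAt.fun_sum fun m _ => ((hc i k m).mul (hi m j)).add ((hc j k m).mul (hi i m))).neg

theorem hasDerivAt_ric (h : MetricFam J Ω G H) (ht : t ∈ J) (hy : y ∈ Ω) (i j : Fin n) :
    HasDerivAt (fun s => ricMat (G s) y i j)
      (∑ k, (pderiv (dchr (G t) (H t) k i j) k y - pderiv (dchr (G t) (H t) k i k) j y)
        + ∑ k, ∑ l, (dchr (G t) (H t) k k l y * chr (G t) l i j y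
            + chr (G t) k k l y * dchr (G t) (H t) l i j y
          - (dchr (G t) (H t) k j l y * chr (G t) l i k y
            + chr (G t) k j l y * dchr (G t) (H t) l i k y))) t := by
  have hc := fun k i j => (h.tfam_chr k i j).hasDerivAt t ht y hy
  have hd := fun k i j a => ((h.tfam_chr k i j).pderiv h.isOpen h.relOpen a).hasDerivAt t ht y hy
  exact (HasDerivAt.fun_sum fun k _ => (hd k i j k).sub (hd k i k j)).add
    (HasDerivAt.fun_sum fun k _ => HasDerivAt.fun_sum fun l _ =>
      ((hc k k l).mul (hc l i j)).sub ((hc k j l).mul (hc l i k)))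

theorem pderiv_scalVec (h : MetricFam J Ω G H) (ht : t ∈ J) (hy : y ∈ Ω) (k a : Fin n) :
    pderiv (scalVec (G t) (H t) k) a y
      = ∑ i, ∑ j, (pderiv (fun z => (G t z)⁻¹ i j) a y * dchr (G t) (H t) k i j y
          + (G t y)⁻¹ i j * pderiv (dchr (G t) (H t) k i j) a y
        - (pderiv (fun z => (G t z)⁻¹ i k) a y * dchr (G t) (H t) j i j y
          + (G t y)⁻¹ i k * pderiv (dchr (G t) (H t) j i j) a y)) := by
  have hH := h.relOpen.subset hy
  have hi : ∀ i j, DifferentiableWithinAt ℝ (fun z => (G t z)⁻¹ i j) (halfSpace n) y := fun i j =>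
    (h.tfam_inv i j).fam.diff ht hy
  have hc : ∀ k i j, DifferentiableWithinAt ℝ (dchr (G t) (H t) k i j) (halfSpace n) y :=
    fun k i j => (h.tfam_chr k i j).fam'.diff ht hy
  have h1 : ∀ i j k k' l l', DifferentiableWithinAt ℝ (fun z =>
      (G t z)⁻¹ i j * dchr (G t) (H t) k i j z - (G t z)⁻¹ i k' * dchr (G t) (H t) l i l' z)
      (halfSpace n) y := fun i j k k' l l' =>
    ((hi i j).mul (hc k i j)).sub ((hi i k').mul (hc l i l'))
  unfold scalVec
  rw [pderiv_sum _ hH fun i _ => DifferentiableWithinAt.fun_sum fun j _ => h1 i j k k j j]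
  refine Finset.sum_congr rfl fun i _ => ?_
  rw [pderiv_sum _ hH fun j _ => h1 i j k k j j]
  refine Finset.sum_congr rfl fun j _ => ?_
  rw [pderiv_sub hH ((hi i j).fun_mul (hc k i j)) ((hi i k).fun_mul (hc j i j)),
    pderiv_mul hH (hi i j) (hc k i j), pderiv_mul hH (hi i k) (hc j i j)]

/-- The linearization of the scalar curvature. -/
theorem hasDerivAt_scal (h : MetricFam J Ω G H) (ht : t ∈ J) (hy : y ∈ Ω) :
    HasDerivAt (fun s => scal (G s) y)
      (-frob (G t y) (H t y) (ricMat (G t) y) + divg (G t) (scalVec (G t) (H t)) y) t := by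
  have hm := h.isLocalMetric t ht
  have hi := fun i j => (h.tfam_inv i j).hasDerivAt t ht y hy
  have h1 := HasDerivAt.fun_sum (u := Finset.univ) fun i _ => HasDerivAt.fun_sum
    (u := Finset.univ) fun j _ => (hi i j).mul (h.hasDerivAt_ric ht hy i j)
  have h2 : HasDerivAt (fun s => scal (G s) y) _ t :=
    h1.congr_of_eventuallyEq (by
      filter_upwards [h.isOpen.mem_nhds ht] with s hs
      exact mtr_eq_sum ((h.isLocalMetric s hs).transpose_eq hy))
  refine h2.congr_deriv ?_
  simp only [Finset.sum_add_distrib]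
  have e1 : ∑ i, ∑ j, dinv (G t) (H t) y i j * ricMat (G t) y i j
      = -frob (G t y) (H t y) (ricMat (G t) y) := by
    rw [frob, Matrix.trace, ← Finset.sum_neg_distrib]
    refine Finset.sum_congr rfl fun i _ => ?_
    rw [Matrix.diag_apply, Matrix.mul_apply, ← Finset.sum_neg_distrib]
    exact Finset.sum_congr rfl fun j _ => by
      rw [dinv, Matrix.neg_apply, Matrix.transpose_apply]; ring
  rw [e1]
  congr 1
  -- With `C` the time derivative of the Christoffel symbols, the contraction `gⁱʲ Ric'ᵢⱼ` is the
  -- divergence of `scalVec`; derivatives of `g⁻¹` enter through `∇g⁻¹ = 0`.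
  have key := sum_linearizedRicci_eq (fun i j => (G t y)⁻¹ i j) (fun k i j => chr (G t) k i j y)
    (fun k i j => dchr (G t) (H t) k i j y) (fun a k i j => pderiv (dchr (G t) (H t) k i j) a y)
    (fun k i j => pderiv (fun z => (G t z)⁻¹ i j) k y) (fun k i j => hm.chr_symm hy k i j)
    (fun k i j => h.dchr_symm ht hy k i j) (fun k i j => hm.pderiv_inv hy k i j)
  simp only [← Finset.sum_add_distrib] at key ⊢
  rw [key, divg]
  refine Finset.sum_congr rfl fun k _ => ?_
  rw [h.pderiv_scalVec ht hy]
  simp only [Finset.sum_add_distrib, Finset.sum_sub_distrib, scalVec]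

/-- The linearization of the volume density. -/
theorem hasDerivAt_density (h : MetricFam J Ω G H) (ht : t ∈ J) (hy : y ∈ Ω) :
    HasDerivAt (fun s => density (G s) y)
      (density (G t) y * ((1 / 2) * mtr (G t y) (H t y))) t := by
  have hm := h.isLocalMetric t ht
  have hd := hasFDerivWithinAt_det (s := univ) (M := fun s => G s y)
    (fun i j => ((h.tfam i j).hasDerivAt t ht y hy).hasFDerivAt.hasFDerivWithinAt)
    (hm.det_ne_zero hy)
  rw [hasFDerivWithinAt_univ] at hd
  have hd' := (hd.sqrt (hm.det_ne_zero hy)).hasDerivAt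
  refine hd'.congr_deriv ?_
  have hs := Real.sq_sqrt (hm.det_pos hy).le
  have hp : √(G t y).det ≠ 0 := (Real.sqrt_pos.2 (hm.det_pos hy)).ne'
  have e : mtr (G t y) (H t y) = ∑ i, ∑ j, (G t y)⁻¹ j i * H t y i j := by
    rw [mtr, Matrix.trace, Finset.sum_comm]
    simp only [Matrix.diag_apply, Matrix.mul_apply]
  rw [e, density]
  simp
  field_simp
  rw [hs]

end MetricFam

end Variation

/-! ### The antisymmetric correction tensor -/

section CorrectionTensor

variable {n : ℕ} [NeZero n]

/-- The differential of a function. -/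
def grad (f : Coord n → ℝ) (y : Coord n) (j : Fin n) : ℝ := pderiv f j y

/-- The gradient of a function. -/
def gradVec (G : Coord n → Matrix (Fin n) (Fin n) ℝ) (p : Coord n → ℝ) (y : Coord n) : Fin n → ℝ :=
  (G y)⁻¹ *ᵥ grad p y

/-- The time derivative of the gradient of a function. -/
def dgradVec (G H : Coord n → Matrix (Fin n) (Fin n) ℝ) (p : Coord n → ℝ) (y : Coord n) :
    Fin n → ℝ :=
  dinv G H y *ᵥ grad p y

/-- `|dp|² + p`. -/
def corrDen (G : Coord n → Matrix (Fin n) (Fin n) ℝ) (p : Coord n → ℝ) (y : Coord n) : ℝ :=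
  grad p y ⬝ᵥ gradVec G p y + p y

/-- An antisymmetric tensor whose divergence has the same normal component on the boundary
as the vector field `scalVec`. -/
def corrTen (G H : Coord n → Matrix (Fin n) (Fin n) ℝ) (p : Coord n → ℝ) (i j : Fin n)
    (y : Coord n) : ℝ :=
  (gradVec G p y i * dgradVec G H p y j - gradVec G p y j * dgradVec G H p y i) / corrDen G p y

/-- The contraction of `corrTen` with the differential of `r`. -/
def corrVec (G H : Coord n → Matrix (Fin n) (Fin n) ℝ) (p r : Coord n → ℝ) (j : Fin n)
    (y : Coord n) : ℝ :=
  ∑ k, corrTen G H p k j y * pderiv r k y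

theorem corrTen_antisymm (G H : Coord n → Matrix (Fin n) (Fin n) ℝ) (p : Coord n → ℝ) (i j : Fin n)
    (y : Coord n) : corrTen G H p j i y = -corrTen G H p i j y := by
  rw [corrTen, corrTen]; ring

/-- In this form only vectors and scalar products appear, so that coordinate independence can be
checked factor by factor. -/
theorem corrVec_eq (G H : Coord n → Matrix (Fin n) (Fin n) ℝ) (p r : Coord n → ℝ) (j : Fin n)
    (y : Coord n) : corrVec G H p r j y
      = ((gradVec G p y ⬝ᵥ grad r y) * dgradVec G H p y j
        - gradVec G p y j * (dgradVec G H p y ⬝ᵥ grad r y)) / corrDen G p y := by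
  simp only [corrVec, corrTen, dotProduct, Finset.sum_mul, Finset.mul_sum,
    ← Finset.sum_sub_distrib, Finset.sum_div]
  exact Finset.sum_congr rfl fun k _ => by rw [grad]; ring

end CorrectionTensor

/-! ### Coordinate independence of the vector fields in the variation -/

section TransitionLaws

variable {n : ℕ} [NeZero n] {Ω Ω' : Set (Coord n)} {J : Set ℝ} {φ : Coord n → Coord n}
  {G H G' H' : ℝ → Coord n → Matrix (Fin n) (Fin n) ℝ} {t : ℝ} {y : Coord n}

theorem sum_conj_mul (J g M : Matrix (Fin n) (Fin n) ℝ) :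
    ∑ i, ∑ j, (J * g * Jᵀ) i j * M i j = ∑ a, ∑ b, g a b * (Jᵀ * M * J) a b := by
  have h : ∀ A B : Matrix (Fin n) (Fin n) ℝ, ∑ i, ∑ j, A i j * B i j = (A * Bᵀ).trace :=
    fun A B => rfl
  rw [h, h]
  simp only [Matrix.transpose_mul, Matrix.transpose_transpose]
  rw [Matrix.mul_assoc, Matrix.mul_assoc, Matrix.trace_mul_comm]
  simp only [Matrix.mul_assoc]

theorem IsTransition.grad_eq (h : IsTransition Ω Ω' φ) {p p' : Coord n → ℝ}
    (hp' : ContDiffOn ℝ 1 p' Ω') (hpp : ∀ z ∈ Ω, p z = p' (φ z)) (hy : y ∈ Ω) :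
    grad p y = (jac φ y)ᵀ *ᵥ grad p' (φ y) := by
  funext a
  rw [grad, pderiv_congr h.relOpen hy hpp, pderiv_comp h.relOpen hy h.mapsTo_half
    (h.differentiableWithinAt hy)
    (differentiableWithinAt_of_contDiffOn hp' h.relOpen' (by simp) (h.mapsTo hy))]
  rfl

namespace MetricFam

theorem inv_eq (h : IsTransition Ω Ω' φ)
    (hGG' : ∀ t ∈ J, ∀ y ∈ Ω, G t y = (jac φ y)ᵀ * G' t (φ y) * jac φ y) (ht : t ∈ J) (hy : y ∈ Ω) :
    (G' t (φ y))⁻¹ = jac φ y * (G t y)⁻¹ * (jac φ y)ᵀ := h.inv_eq (hGG' t ht) hy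

theorem dinv_eq (h : IsTransition Ω Ω' φ) (hG : MetricFam J Ω G H) (hG' : MetricFam J Ω' G' H')
    (hGG' : ∀ t ∈ J, ∀ y ∈ Ω, G t y = (jac φ y)ᵀ * G' t (φ y) * jac φ y) (ht : t ∈ J) (hy : y ∈ Ω) :
    dinv (G' t) (H' t) (φ y) = jac φ y * dinv (G t) (H t) y * (jac φ y)ᵀ := by
  ext i j
  refine deriv_unique_of_eqOn hG.isOpen ht
    (fun s hs => congrFun (congrFun (inv_eq h hGG' hs hy) i) j)
    ((hG'.tfam_inv i j).hasDerivAt t ht _ (h.mapsTo hy)) ?_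
  simp only [Matrix.mul_apply]
  exact HasDerivAt.fun_sum fun a _ => (HasDerivAt.fun_sum fun b _ =>
    ((hG.tfam_inv b a).hasDerivAt t ht y hy).const_mul _).mul_const _

/-- The second derivatives of `φ` in the Christoffel law do not depend on time. Differentiation
removes them, so the time derivative of the connection is a tensor. -/
theorem sum_jac_mul_dchr (h : IsTransition Ω Ω' φ) (hG : MetricFam J Ω G H)
    (hG' : MetricFam J Ω' G' H')
    (hGG' : ∀ t ∈ J, ∀ y ∈ Ω, G t y = (jac φ y)ᵀ * G' t (φ y) * jac φ y) (ht : t ∈ J) (hy : y ∈ Ω)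
    (m a b : Fin n) : ∑ k, jac φ y m k * dchr (G t) (H t) k a b y
      = ∑ i, ∑ j, jac φ y i a * dchr (G' t) (H' t) m i j (φ y) * jac φ y j b := by
  have key : ∀ s ∈ J, ∑ k, jac φ y m k * chr (G s) k a b y
      = mderiv (jac φ) a y m b
        + ∑ i, ∑ j, jac φ y i a * chr (G' s) m i j (φ y) * jac φ y j b := fun s hs => by
    have := congrFun (congrFun (h.jac_mul_conn (hG.isLocalMetric s hs) (hG'.isLocalMetric s hs)
      (hGG' s hs) hy a) m) b
    rw [Matrix.add_apply, pullConn_mul_apply, Matrix.mul_apply] at this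
    exact this
  refine deriv_unique_of_eqOn hG.isOpen ht key
    (HasDerivAt.fun_sum fun k _ => ((hG.tfam_chr k a b).hasDerivAt t ht y hy).const_mul _) ?_
  refine HasDerivAt.const_add _ ?_
  exact HasDerivAt.fun_sum fun i _ => HasDerivAt.fun_sum fun j _ =>
    (((hG'.tfam_chr m i j).hasDerivAt t ht _ (h.mapsTo hy)).const_mul _).mul_const _

/-- Both parts of `scalVec` are contractions of this tensor. In the second the trace over the upper
index is taken first; it is the trace of an endomorphism up to conjugation by the Jacobian, hence a
covector `τ`. -/
theorem scalVec_eq (h : IsTransition Ω Ω' φ) (hG : MetricFam J Ω G H)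
    (hG' : MetricFam J Ω' G' H')
    (hGG' : ∀ t ∈ J, ∀ y ∈ Ω, G t y = (jac φ y)ᵀ * G' t (φ y) * jac φ y) (ht : t ∈ J) (hy : y ∈ Ω)
    (m : Fin n) :
    scalVec (G' t) (H' t) m (φ y) = ∑ k, jac φ y m k * scalVec (G t) (H t) k y := by
  set A := jac φ y with hA
  set g := (G t y)⁻¹ with hg
  have hinv : (G' t (φ y))⁻¹ = A * g * Aᵀ := inv_eq h hGG' ht hy
  have hlaw := sum_jac_mul_dchr h hG hG' hGG' ht hy
  have h1 : ∑ i, ∑ j, (G' t (φ y))⁻¹ i j * dchr (G' t) (H' t) m i j (φ y)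
      = ∑ a, ∑ b, g a b * ∑ k, A m k * dchr (G t) (H t) k a b y := by
    rw [hinv]
    refine (sum_conj_mul A g (Matrix.of fun i j => dchr (G' t) (H' t) m i j (φ y))).trans ?_
    refine Finset.sum_congr rfl fun a _ => Finset.sum_congr rfl fun b _ => ?_
    rw [hlaw]
    congr 1
    simp only [Matrix.mul_apply, Matrix.of_apply, Matrix.transpose_apply, Finset.sum_mul]
    exact Finset.sum_comm
  set τ : Fin n → ℝ := fun a => ∑ k, dchr (G t) (H t) k a k y with hτ
  set τ' : Fin n → ℝ := fun i => ∑ k, dchr (G' t) (H' t) k i k (φ y) with hτ'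
  have hττ : τ = τ' ᵥ* A := by
    funext a
    set M : Matrix (Fin n) (Fin n) ℝ := Matrix.of fun k b => dchr (G t) (H t) k a b y with hM
    set M' : Matrix (Fin n) (Fin n) ℝ :=
      Matrix.of fun k j => ∑ i, A i a * dchr (G' t) (H' t) k i j (φ y) with hM'
    have hMM : A * M = M' * A := by
      ext m b
      rw [Matrix.mul_apply, Matrix.mul_apply]
      refine (hlaw m a b).trans ?_
      rw [Finset.sum_comm]
      simp only [hM', Matrix.of_apply, Finset.sum_mul]
      rfl
    have hu := h.isUnit_det hy
    have e1 : τ a = M.trace := rfl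
    have e2 : (τ' ᵥ* A) a = M'.trace := by
      simp only [Matrix.trace, Matrix.diag_apply, hM', Matrix.of_apply, Matrix.vecMul, dotProduct,
        hτ', Finset.sum_mul]
      rw [Finset.sum_comm]
      exact Finset.sum_congr rfl fun k _ => Finset.sum_congr rfl fun i _ => mul_comm _ _
    rw [e1, e2, ← Matrix.nonsing_inv_mul_cancel_left A M hu, hMM, Matrix.trace_mul_comm,
      Matrix.mul_nonsing_inv_cancel_right _ _ hu]
  have h2 : ∑ i, (G' t (φ y))⁻¹ i m * τ' i = ∑ k, A m k * ∑ a, g a k * τ a := by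
    have e1 : ∑ i, (G' t (φ y))⁻¹ i m * τ' i = (τ' ᵥ* (G' t (φ y))⁻¹) m :=
      Finset.sum_congr rfl fun i _ => mul_comm _ _
    have e2 : ∑ k, A m k * ∑ a, g a k * τ a = (A *ᵥ (τ ᵥ* g)) m := by
      refine Finset.sum_congr rfl fun k _ => ?_
      congr 1
      exact Finset.sum_congr rfl fun i _ => mul_comm _ _
    rw [e1, e2, hinv, hττ, ← Matrix.vecMul_vecMul, ← Matrix.vecMul_vecMul, Matrix.vecMul_transpose]
  have hsplit : ∀ (G H : Coord n → Matrix (Fin n) (Fin n) ℝ) k (y : Coord n), scalVec G H k y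
      = ∑ i, ∑ j, (G y)⁻¹ i j * dchr G H k i j y
        - ∑ i, (G y)⁻¹ i k * ∑ j, dchr G H j i j y := fun G H k y => by
    simp only [scalVec, Finset.sum_sub_distrib, Finset.mul_sum]
  rw [hsplit, h1, h2]
  simp only [hsplit, mul_sub, Finset.sum_sub_distrib]
  congr 1
  simp only [Finset.mul_sum]
  rw [sum_rotate₃]
  exact Finset.sum_congr rfl fun k _ => Finset.sum_congr rfl fun i _ =>
    Finset.sum_congr rfl fun j _ => by ring

theorem corrVec_eq (h : IsTransition Ω Ω' φ) (hG : MetricFam J Ω G H)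
    (hG' : MetricFam J Ω' G' H')
    (hGG' : ∀ t ∈ J, ∀ y ∈ Ω, G t y = (jac φ y)ᵀ * G' t (φ y) * jac φ y) (ht : t ∈ J) (hy : y ∈ Ω)
    {p p' r r' : Coord n → ℝ} (hp' : ContDiffOn ℝ 1 p' Ω') (hr' : ContDiffOn ℝ 1 r' Ω')
    (hpp : ∀ z ∈ Ω, p z = p' (φ z)) (hrr : ∀ z ∈ Ω, r z = r' (φ z)) (m : Fin n) :
    corrVec (G' t) (H' t) p' r' m (φ y) = ∑ k, jac φ y m k * corrVec (G t) (H t) p r k y := by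
  have gp := h.grad_eq hp' hpp hy
  have gr := h.grad_eq hr' hrr hy
  have hV : gradVec (G' t) p' (φ y) = jac φ y *ᵥ gradVec (G t) p y := by
    rw [gradVec, gradVec, inv_eq h hGG' ht hy, gp, ← Matrix.mulVec_mulVec, ← Matrix.mulVec_mulVec]
  have hV' : dgradVec (G' t) (H' t) p' (φ y) = jac φ y *ᵥ dgradVec (G t) (H t) p y := by
    rw [dgradVec, dgradVec, dinv_eq h hG hG' hGG' ht hy, gp, ← Matrix.mulVec_mulVec,
      ← Matrix.mulVec_mulVec]
  have hdot : ∀ (v : Fin n → ℝ) (f f' : Coord n → ℝ), grad f y = (jac φ y)ᵀ *ᵥ grad f' (φ y) →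
      (jac φ y *ᵥ v) ⬝ᵥ grad f' (φ y) = v ⬝ᵥ grad f y := fun v f f' hf => by
    rw [hf, Matrix.dotProduct_mulVec, Matrix.vecMul_transpose]
  have hD : corrDen (G' t) p' (φ y) = corrDen (G t) p y := by
    rw [corrDen, corrDen, hV, dotProduct_comm, hdot _ p p' gp, dotProduct_comm, hpp y hy]
  simp only [RelYamabe.corrVec_eq]
  rw [hD, hV, hV', hdot _ r r' gr, hdot _ r r' gr]
  generalize gradVec (G t) p y ⬝ᵥ grad r y = a
  generalize dgradVec (G t) (H t) p y ⬝ᵥ grad r y = b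
  simp only [Matrix.mulVec, dotProduct, Finset.mul_sum, Finset.sum_mul, ← Finset.sum_sub_distrib,
    Finset.sum_div]
  exact Finset.sum_congr rfl fun k _ => by ring

end MetricFam

end TransitionLaws

/-! ### Normal components on the boundary -/

section BoundaryCorrection

variable {n : ℕ} [NeZero n] {Ω : Set (Coord n)} {J : Set ℝ}
  {G H : ℝ → Coord n → Matrix (Fin n) (Fin n) ℝ} {t : ℝ} {y : Coord n} {p r : Coord n → ℝ}

/-- `p` is a defining function of the boundary. -/
structure IsDefining (Ω : Set (Coord n)) (p : Coord n → ℝ) : Prop where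
  contDiffOn : ContDiffOn ℝ 3 p Ω
  pos : ∀ y ∈ Ω, 0 < y 0 → 0 < p y
  eq_zero : ∀ y ∈ Ω, y 0 = 0 → p y = 0
  pderiv_ne_zero : ∀ y ∈ Ω, y 0 = 0 → pderiv p 0 y ≠ 0

theorem IsDefining.pderiv_eq_zero (hp : IsDefining Ω p) (hΩ : RelOpen Ω) (hy : y ∈ Ω)
    (hy0 : y 0 = 0) {a : Fin n} (ha : a ≠ 0) : pderiv p a y = 0 := by
  rw [pderiv_congr_boundary hΩ hy hy0 (f' := fun _ => 0)
    (differentiableWithinAt_of_contDiffOn hp.contDiffOn hΩ (by simp) hy)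
    (differentiableWithinAt_const 0) (fun z hz hz0 => hp.eq_zero z hz hz0) ha, pderiv_const]

/-- The two summands of the denominator complement each other: in the interior `p` is positive
although `dp` may vanish, and on the boundary `dp` is nonzero although `p` vanishes. -/
theorem IsLocalMetric.corrDen_pos {G : Coord n → Matrix (Fin n) (Fin n) ℝ}
    (hG : IsLocalMetric Ω G) (hp : IsDefining Ω p) (hy : y ∈ Ω) : 0 < corrDen G p y := by
  have hi := (hG.posDef y hy).inv
  rcases (mem_halfSpace.1 (hG.mem_half hy)).lt_or_eq with h | h
  · have h1 := hi.posSemidef.dotProduct_mulVec_nonneg (grad p y)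
    rw [star_trivial] at h1
    exact add_pos_of_nonneg_of_pos h1 (hp.pos y hy h)
  · have h1 := hi.dotProduct_mulVec_pos (x := grad p y)
      fun h0 => hp.pderiv_ne_zero y hy h.symm (congrFun h0 0)
    rw [star_trivial] at h1
    exact add_pos_of_pos_of_nonneg h1 (hp.eq_zero y hy h.symm).ge

namespace MetricFam

theorem contDiffOn_dinv (h : MetricFam J Ω G H) (ht : t ∈ J) (i j : Fin n) :
    ContDiffOn ℝ 2 (fun y => dinv (G t) (H t) y i j) Ω :=
  (h.tfam_inv i j).fam'.contDiffOn h.relOpen ht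

theorem contDiffOn_scalVec (h : MetricFam J Ω G H) (ht : t ∈ J) (k : Fin n) :
    ContDiffOn ℝ 1 (scalVec (G t) (H t) k) Ω :=
  (h.cfam_scalVec k).contDiffOn h.relOpen ht

theorem contDiffOn_corrTen (h : MetricFam J Ω G H) (hp : IsDefining Ω p) (ht : t ∈ J)
    (i j : Fin n) : ContDiffOn ℝ 2 (corrTen (G t) (H t) p i j) Ω := by
  have hdp : ∀ j, ContDiffOn ℝ 2 (pderiv p j) Ω := fun j =>
    contDiffOn_pderiv hp.contDiffOn h.relOpen (by norm_num) j
  have hV : ∀ i, ContDiffOn ℝ 2 (fun y => gradVec (G t) p y i) Ω := fun i =>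
    ContDiffOn.sum (s := Finset.univ) fun j _ =>
      ((h.isLocalMetric t ht).contDiffOn_inv i j).mul (hdp j)
  have hV' : ∀ i, ContDiffOn ℝ 2 (fun y => dgradVec (G t) (H t) p y i) Ω := fun i =>
    ContDiffOn.sum (s := Finset.univ) fun j _ => (h.contDiffOn_dinv ht i j).mul (hdp j)
  have hD : ContDiffOn ℝ 2 (corrDen (G t) p) Ω :=
    (ContDiffOn.sum (s := Finset.univ) fun j _ => (hdp j).mul (hV j)).add (hp.contDiffOn.of_le (by norm_num))
  exact (((hV i).mul (hV' j)).sub ((hV j).mul (hV' i))).div hD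
    fun y hy => ((h.isLocalMetric t ht).corrDen_pos hp hy).ne'

theorem contDiffOn_corrVec (h : MetricFam J Ω G H) (hp : IsDefining Ω p) (hr : ContDiffOn ℝ 3 r Ω)
    (ht : t ∈ J) (j : Fin n) : ContDiffOn ℝ 2 (corrVec (G t) (H t) p r j) Ω :=
  ContDiffOn.sum fun k _ => (h.contDiffOn_corrTen hp ht k j).mul
    (contDiffOn_pderiv hr h.relOpen (by norm_num) k)

/-- The row of `corrTen` that is normal to the boundary. -/
def _root_.RelYamabe.corrRow (G H : Coord n → Matrix (Fin n) (Fin n) ℝ) (k : Fin n) (y : Coord n) :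
    ℝ :=
  dinv G H y k 0 - (G y)⁻¹ k 0 * (dinv G H y 0 0 / (G y)⁻¹ 0 0)

/-- On the boundary `dp` has only its normal component. The square of that component appears in
numerator and denominator and cancels, so this row does not depend on the choice of `p`. -/
theorem corrTen_zero_eq (h : MetricFam J Ω G H) (hp : IsDefining Ω p) (ht : t ∈ J) (hy : y ∈ Ω)
    (hy0 : y 0 = 0) (k : Fin n) : corrTen (G t) (H t) p 0 k y = corrRow (G t) (H t) k y := by
  have hc := hp.pderiv_ne_zero y hy hy0
  have hg := ((h.isLocalMetric t ht).inv_zero_zero_pos hy).ne'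
  have hgrad : ∀ M : Matrix (Fin n) (Fin n) ℝ, ∀ i, (M *ᵥ grad p y) i = M i 0 * pderiv p 0 y :=
    fun M i => by
      rw [Matrix.mulVec, dotProduct, Finset.sum_eq_single 0 (fun j _ hj => by
        rw [grad, hp.pderiv_eq_zero h.relOpen hy hy0 hj, mul_zero]) (by simp), grad]
  have hD : corrDen (G t) p y = pderiv p 0 y * ((G t y)⁻¹ 0 0 * pderiv p 0 y) := by
    rw [corrDen, hp.eq_zero y hy hy0, add_zero, dotProduct, Finset.sum_eq_single 0
      (fun j _ hj => by rw [grad, hp.pderiv_eq_zero h.relOpen hy hy0 hj, zero_mul]) (by simp),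
      gradVec, hgrad, grad]
  rw [corrTen, hD, corrRow]
  simp only [gradVec, dgradVec, hgrad]
  field_simp

/-- The metrics have minimal boundary, and the metrics that they induce on the boundary are
conformal to each other. -/
def _root_.RelYamabe.BoundaryCond (J : Set ℝ) (Ω : Set (Coord n))
    (G : ℝ → Coord n → Matrix (Fin n) (Fin n) ℝ) : Prop :=
  ∀ s ∈ J, ∀ t ∈ J, ∀ y ∈ Ω, y 0 = 0 → ∑ i, ∑ j, tanInv (G t) y i j * chr (G s) 0 i j y = 0

/-- Here minimality and conformality of the boundary enter. They remove the tangential traces of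
`Γ⁰` and of its time derivative, and what is left of the normal component of `X` is the divergence
of `corrRow`, a field without normal component. -/
theorem scalVec_zero_eq (h : MetricFam J Ω G H) (hb : BoundaryCond J Ω G) (ht : t ∈ J) (hy : y ∈ Ω)
    (hy0 : y 0 = 0) : scalVec (G t) (H t) 0 y = divg (G t) (corrRow (G t) (H t)) y := by
  have hm := h.isLocalMetric t ht
  have hH := h.relOpen.subset hy
  have hg := (hm.inv_zero_zero_pos hy).ne'
  have hi := fun i j => (h.tfam_inv i j).hasDerivAt t ht y hy
  have hd1 : ∀ i j, DifferentiableWithinAt ℝ (fun z => (G t z)⁻¹ i j) (halfSpace n) y := fun i j =>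
    (h.tfam_inv i j).fam.diff ht hy
  have hd2 : ∀ i j, DifferentiableWithinAt ℝ (fun z => dinv (G t) (H t) z i j) (halfSpace n) y :=
    fun i j => (h.tfam_inv i j).fam'.diff ht hy
  set A : Coord n → ℝ := fun z => dinv (G t) (H t) z 0 0 / (G t z)⁻¹ 0 0 with hA
  have hAd : DifferentiableWithinAt ℝ A (halfSpace n) y := by
    simp only [hA, div_eq_mul_inv]
    exact (hd2 0 0).fun_mul ((hd1 0 0).fun_inv hg)
  have hda : ∀ k, pderiv A k y * (G t y)⁻¹ 0 0 + A y * pderiv (fun z => (G t z)⁻¹ 0 0) k y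
      = pderiv (fun z => dinv (G t) (H t) z 0 0) k y := fun k => by
    rw [← pderiv_mul hH hAd (hd1 0 0)]
    refine pderiv_congr h.relOpen hy (fun z hz => ?_) k
    exact div_mul_cancel₀ _ (hm.inv_zero_zero_pos hz).ne'
  have h1 := hb t ht t ht y hy hy0
  -- The boundary condition has two independent times. Varying the time of the Christoffel symbols
  -- gives `h2`, varying that of the tangential inverse metric gives `h3`.
  have h2 : ∑ i, ∑ j, tanInv (G t) y i j * dchr (G t) (H t) 0 i j y = 0 :=
    deriv_unique_of_eqOn h.isOpen ht (fun s hs => hb s hs t ht y hy hy0)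
      (HasDerivAt.fun_sum fun i _ => HasDerivAt.fun_sum fun j _ =>
        ((h.tfam_chr 0 i j).hasDerivAt t ht y hy).const_mul _) (hasDerivAt_const t 0)
  have h3 : ∑ i, ∑ j, (dinv (G t) (H t) y i j - ((dinv (G t) (H t) y i 0 * (G t y)⁻¹ j 0
      + (G t y)⁻¹ i 0 * dinv (G t) (H t) y j 0) / (G t y)⁻¹ 0 0
      - A y * ((G t y)⁻¹ i 0 * (G t y)⁻¹ j 0 / (G t y)⁻¹ 0 0))) * chr (G t) 0 i j y = 0 := by
    refine deriv_unique_of_eqOn h.isOpen ht (fun s hs => hb t ht s hs y hy hy0)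
      (HasDerivAt.fun_sum fun i _ => HasDerivAt.fun_sum fun j _ =>
        HasDerivAt.mul_const ?_ _) (hasDerivAt_const t 0)
    refine ((hi i j).sub (((hi i 0).mul (hi j 0)).div (hi 0 0) hg)).congr_deriv ?_
    simp only [hA, Pi.mul_apply]
    field_simp
  have key := sum_normal_component_eq (fun i j => (G t y)⁻¹ i j) (fun i j => dinv (G t) (H t) y i j)
    (fun k i j => chr (G t) k i j y) (fun k i j => dchr (G t) (H t) k i j y)
    (fun k i j => pderiv (fun z => (G t z)⁻¹ i j) k y)
    (fun k i j => pderiv (fun z => dinv (G t) (H t) z i j) k y) (fun k => pderiv A k y) (a := A y)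
    (fun i j => hm.inv_symm hy i j) (fun i j => h.dinv_symm ht hy i j)
    (fun k i j => hm.chr_symm hy k i j) (fun k i j => h.dchr_symm ht hy k i j)
    (fun k i j => hm.pderiv_inv hy k i j) (fun k i j => h.pderiv_dinv ht hy k i j) hg hda h1 h2 h3
  rw [scalVec, key, divg]
  refine Finset.sum_congr rfl fun k _ => ?_
  have e : pderiv (corrRow (G t) (H t) k) k y
      = pderiv (fun z => dinv (G t) (H t) z k 0) k y
        - (pderiv (fun z => (G t z)⁻¹ k 0) k y * A y + (G t y)⁻¹ k 0 * pderiv A k y) := by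
    rw [← pderiv_mul hH (hd1 k 0) hAd, ← pderiv_sub hH (hd2 k 0) ((hd1 k 0).fun_mul hAd)]
    rfl
  rw [e]; rfl

theorem contDiffOn_corrRow (h : MetricFam J Ω G H) (ht : t ∈ J) (k : Fin n) :
    ContDiffOn ℝ 2 (corrRow (G t) (H t) k) Ω := by
  have hm := h.isLocalMetric t ht
  exact (h.contDiffOn_dinv ht k 0).sub ((hm.contDiffOn_inv k 0).mul
    ((h.contDiffOn_dinv ht 0 0).div (hm.contDiffOn_inv 0 0)
      fun y hy => (hm.inv_zero_zero_pos hy).ne'))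

/-- The normal components of `scalVec` and of the divergence of `corrTen` agree on the boundary. -/
theorem density_mul_scalVec_zero_eq (h : MetricFam J Ω G H) (hb : BoundaryCond J Ω G)
    (hp : IsDefining Ω p) (ht : t ∈ J) (hy : y ∈ Ω) (hy0 : y 0 = 0) :
    density (G t) y * scalVec (G t) (H t) 0 y
      = ∑ j, pderiv (fun z => density (G t) z * corrTen (G t) (H t) p 0 j z) j y := by
  have hm := h.isLocalMetric t ht
  rw [h.scalVec_zero_eq hb ht hy hy0, ← hm.density_mul_divg hy fun k =>
    differentiableWithinAt_of_contDiffOn (h.contDiffOn_corrRow ht k) h.relOpen (by simp) hy]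
  refine Finset.sum_congr rfl fun j _ => ?_
  -- The entries with `j = 0` vanish identically, so their normal derivatives agree. For `j ≠ 0` the
  -- derivative is tangential and only sees values on the boundary, where the two rows coincide.
  by_cases hj : j = 0
  · subst hj
    refine pderiv_congr h.relOpen hy (fun z hz => ?_) 0
    have e1 : corrRow (G t) (H t) 0 z = 0 := by
      rw [corrRow, mul_div_cancel₀ _ (hm.inv_zero_zero_pos hz).ne', sub_self]
    have e2 : corrTen (G t) (H t) p 0 0 z = 0 := by
      have := corrTen_antisymm (G t) (H t) p 0 0 z
      linarith
    simp only [e1, e2]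
  · refine pderiv_congr_boundary h.relOpen hy hy0
      (differentiableWithinAt_of_contDiffOn (hm.contDiffOn_density.mul (h.contDiffOn_corrRow ht j))
        h.relOpen (by simp) hy)
      (differentiableWithinAt_of_contDiffOn (hm.contDiffOn_density.mul
        (h.contDiffOn_corrTen hp ht 0 j)) h.relOpen (by simp) hy) (fun z hz hz0 => ?_) hj
    simp only [h.corrTen_zero_eq hp ht hz hz0]

end MetricFam

end BoundaryCorrection

/-! ### Integration by parts in one chart -/

section LocalIdentity

variable {n : ℕ} [NeZero n] {Ω Ω' K : Set (Coord n)} {J : Set ℝ}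
  {G H G' H' : ℝ → Coord n → Matrix (Fin n) (Fin n) ℝ} {t : ℝ} {y : Coord n} {p r : Coord n → ℝ}

theorem integrableOn_of_isCompact {F : Coord n → ℝ} (hΩ : RelOpen Ω) (hK : IsCompact K)
    (hKΩ : K ⊆ Ω) (hF : ContinuousOn F Ω) (h0 : ∀ y ∈ Ω, y ∉ K → F y = 0) : IntegrableOn F Ω :=
  ((hF.mono hKΩ).integrableOn_compact hK).of_forall_sdiff_eq_zero hΩ.measurableSet
    fun y hy => h0 y hy.1 hy.2

theorem RelOpen.diff_isCompact (hΩ : RelOpen Ω) (hK : IsCompact K) : RelOpen (Ω \ K) := by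
  obtain ⟨U, hU, rfl⟩ := hΩ
  exact ⟨U \ K, hU.sdiff hK.isClosed, by ext; simp; tauto⟩

theorem continuousOn_divg {G : Coord n → Matrix (Fin n) (Fin n) ℝ} (hG : IsLocalMetric Ω G)
    {U : Fin n → Coord n → ℝ} (hU : ∀ k, ContDiffOn ℝ 1 (U k) Ω) : ContinuousOn (divg G U) Ω :=
  continuousOn_finsetSum _ fun k _ => (continuousOn_pderiv (hU k) hG.relOpen k).add
    (continuousOn_finsetSum _ fun l _ =>
      (hG.contDiffOn_chr l k l).continuousOn.mul (hU k).continuousOn)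

/-- The scalar by which the divergence of the corrected vector field, tested against `r`, is
represented. -/
def corrScal (G H : Coord n → Matrix (Fin n) (Fin n) ℝ) (p r : Coord n → ℝ) (y : Coord n) : ℝ :=
  ∑ k, scalVec G H k y * pderiv r k y - divg G (corrVec G H p r) y

namespace MetricFam

theorem continuousOn_corrScal (h : MetricFam J Ω G H) (hp : IsDefining Ω p)
    (hr : ContDiffOn ℝ 3 r Ω) (ht : t ∈ J) : ContinuousOn (corrScal (G t) (H t) p r) Ω :=
  (continuousOn_finsetSum _ fun k _ => (h.contDiffOn_scalVec ht k).continuousOn.mul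
    (continuousOn_pderiv (hr.of_le (by norm_num)) h.relOpen k)).sub
  (continuousOn_divg (h.isLocalMetric t ht) fun k =>
    (h.contDiffOn_corrVec hp hr ht k).of_le (by norm_num))

/-- The product rule for `div (r (X - div B))`. The double divergence of `B` vanishes by
antisymmetry, and so does the contraction of `B` with the second derivatives of `r`; therefore `⟨div
B, dr⟩` equals `div (B (dr))`. The latter involves only the divergence of a vector field, whose
coordinate independence is available. -/
theorem sum_pderiv_mul_corrected (h : MetricFam J Ω G H) (hp : IsDefining Ω p)
    (hr : ContDiffOn ℝ 3 r Ω) (ht : t ∈ J) (hy : y ∈ Ω) :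
    ∑ k, pderiv (fun z => r z * (density (G t) z * scalVec (G t) (H t) k z
        - ∑ j, pderiv (fun w => density (G t) w * corrTen (G t) (H t) p k j w) j z)) k y
      = r y * (density (G t) y * divg (G t) (scalVec (G t) (H t)) y)
        + density (G t) y * corrScal (G t) (H t) p r y := by
  have hm := h.isLocalMetric t ht
  have hH := h.relOpen.subset hy
  have hd : ∀ {m : WithTop ℕ∞} {f : Coord n → ℝ}, ContDiffOn ℝ m f Ω → m ≠ 0 →
      DifferentiableWithinAt ℝ f (halfSpace n) y := fun hf hm0 =>
    differentiableWithinAt_of_contDiffOn hf h.relOpen hm0 hy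
  have hσX : ∀ k, ContDiffOn ℝ 1 (fun z => density (G t) z * scalVec (G t) (H t) k z) Ω := fun k =>
    (hm.contDiffOn_density.of_le (by norm_num)).mul (h.contDiffOn_scalVec ht k)
  have hB : ∀ k j, ContDiffOn ℝ 2 (fun w => density (G t) w * corrTen (G t) (H t) p k j w) Ω :=
    fun k j => hm.contDiffOn_density.mul (h.contDiffOn_corrTen hp ht k j)
  have hdB : ∀ k j, ContDiffOn ℝ 1
      (pderiv (fun w => density (G t) w * corrTen (G t) (H t) p k j w) j) Ω := fun k j =>
    contDiffOn_pderiv (hB k j) h.relOpen (by norm_num) j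
  have hsB : ∀ k, ContDiffOn ℝ 1 (fun z => ∑ j,
      pderiv (fun w => density (G t) w * corrTen (G t) (H t) p k j w) j z) Ω := fun k =>
    ContDiffOn.sum fun j _ => hdB k j
  set b : Fin n → Fin n → ℝ := fun k j =>
    pderiv (fun w => density (G t) w * corrTen (G t) (H t) p k j w) j y with hbdef
  have e1 : ∀ k, pderiv (fun z => r z * (density (G t) z * scalVec (G t) (H t) k z
        - ∑ j, pderiv (fun w => density (G t) w * corrTen (G t) (H t) p k j w) j z)) k y
      = pderiv r k y * (density (G t) y * scalVec (G t) (H t) k y - ∑ j, b k j)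
        + r y * (pderiv (fun z => density (G t) z * scalVec (G t) (H t) k z) k y
          - ∑ j, pderiv (pderiv (fun w => density (G t) w * corrTen (G t) (H t) p k j w) j) k y) :=
    fun k => by
      rw [pderiv_mul hH (hd hr (by simp)) (hd ((hσX k).sub (hsB k)) (by simp)),
        pderiv_sub hH (hd (hσX k) (by simp)) (hd (hsB k) (by simp)),
        pderiv_sum _ hH fun j _ => hd (hdB k j) (by simp)]
  have e2 : ∑ k, ∑ j,
      pderiv (pderiv (fun w => density (G t) w * corrTen (G t) (H t) p k j w) j) k y = 0 := by
    have hs : ∑ k, ∑ j,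
        pderiv (pderiv (fun w => density (G t) w * corrTen (G t) (H t) p k j w) j) k y
        = -∑ k, ∑ j,
          pderiv (pderiv (fun w => density (G t) w * corrTen (G t) (H t) p k j w) j) k y := by
      conv_lhs => rw [Finset.sum_comm]
      simp only [← Finset.sum_neg_distrib]
      refine Finset.sum_congr rfl fun k _ => Finset.sum_congr rfl fun j _ => ?_
      rw [pderiv_comm (hB j k) h.relOpen hy, ← pderiv_neg hH]
      refine pderiv_congr h.relOpen hy (fun z hz => ?_) k
      rw [← pderiv_neg (h.relOpen.subset hz)]
      refine pderiv_congr h.relOpen hz (fun w _ => ?_) j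
      rw [corrTen_antisymm]; ring
    linarith
  have e3 : density (G t) y * divg (G t) (corrVec (G t) (H t) p r) y
      = ∑ k, pderiv r k y * ∑ j, b k j := by
    rw [← hm.density_mul_divg hy fun k => hd (h.contDiffOn_corrVec hp hr ht k) (by simp)]
    have hdr : ∀ k, ContDiffOn ℝ 2 (pderiv r k) Ω := fun k =>
      contDiffOn_pderiv hr h.relOpen (by norm_num) k
    have e4 : ∀ j, pderiv (fun z => density (G t) z * corrVec (G t) (H t) p r j z) j y
        = ∑ k, (b k j * pderiv r k y + density (G t) y * corrTen (G t) (H t) p k j y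
          * pderiv (pderiv r k) j y) := fun j => by
      have : EqOn (fun z => density (G t) z * corrVec (G t) (H t) p r j z) (fun z => ∑ k,
          density (G t) z * corrTen (G t) (H t) p k j z * pderiv r k z) Ω := fun z _ => by
        simp only [corrVec, Finset.mul_sum, mul_assoc]
      rw [pderiv_congr h.relOpen hy this, pderiv_sum _ hH fun k _ =>
        (hd (hB k j) (by simp)).fun_mul (hd (hdr k) (by simp))]
      refine Finset.sum_congr rfl fun k _ => ?_
      rw [pderiv_mul hH (hd (hB k j) (by simp)) (hd (hdr k) (by simp))]
    have e5 : ∑ j, ∑ k, density (G t) y * corrTen (G t) (H t) p k j y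
          * pderiv (pderiv r k) j y = 0 := by
      have hs : ∑ j, ∑ k, density (G t) y * corrTen (G t) (H t) p k j y
            * pderiv (pderiv r k) j y
          = -∑ j, ∑ k, density (G t) y * corrTen (G t) (H t) p k j y
            * pderiv (pderiv r k) j y := by
        conv_lhs => rw [Finset.sum_comm]
        simp only [← Finset.sum_neg_distrib]
        refine Finset.sum_congr rfl fun k _ => Finset.sum_congr rfl fun j _ => ?_
        rw [pderiv_comm (hr.of_le (by norm_num)) h.relOpen hy, corrTen_antisymm]; ring
      linarith
    rw [Finset.sum_congr rfl fun j _ => e4 j]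
    simp only [Finset.sum_add_distrib, e5, add_zero]
    rw [Finset.sum_comm]
    exact Finset.sum_congr rfl fun k _ => by
      rw [Finset.mul_sum]; exact Finset.sum_congr rfl fun j _ => mul_comm _ _
  have e6 := hm.density_mul_divg hy fun k => hd (h.contDiffOn_scalVec ht k) (by simp)
  rw [Finset.sum_congr rfl fun k _ => e1 k, corrScal, mul_sub, e3, ← e6]
  simp only [mul_sub, Finset.sum_add_distrib, Finset.sum_sub_distrib, ← Finset.mul_sum, e2]
  rw [Finset.mul_sum (a := density (G t) y)]
  rw [Finset.sum_congr rfl fun k _ => show pderiv r k y * (density (G t) y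
    * scalVec (G t) (H t) k y) = density (G t) y * (scalVec (G t) (H t) k y * pderiv r k y) by ring]
  ring

/-- The corrected field times `r` has compact support and no normal component on the boundary, so
its total divergence integrates to zero. -/
theorem integral_mul_divg_scalVec (h : MetricFam J Ω G H) (hb : BoundaryCond J Ω G)
    (hp : IsDefining Ω p) (hr : ContDiffOn ℝ 3 r Ω) (ht : t ∈ J) (hK : IsCompact K) (hKΩ : K ⊆ Ω)
    (h0 : ∀ y ∈ Ω, y ∉ K → r y = 0) :
    ∫ y in Ω, r y * (density (G t) y * divg (G t) (scalVec (G t) (H t)) y)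
      = -∫ y in Ω, density (G t) y * corrScal (G t) (H t) p r y := by
  have hm := h.isLocalMetric t ht
  set w : Fin n → Coord n → ℝ := fun k z => r z * (density (G t) z * scalVec (G t) (H t) k z
        - ∑ j, pderiv (fun w => density (G t) w * corrTen (G t) (H t) p k j w) j z) with hw
  have hwc : ∀ k, ContDiffOn ℝ 1 (w k) Ω := fun k =>
    (hr.of_le (by norm_num)).mul (((hm.contDiffOn_density.of_le (by norm_num)).mul
      (h.contDiffOn_scalVec ht k)).sub (ContDiffOn.sum fun j _ => contDiffOn_pderiv
        (hm.contDiffOn_density.mul (h.contDiffOn_corrTen hp ht k j)) h.relOpen (by norm_num) j))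
  have hw0 : ∀ k, ∀ y ∈ Ω, y ∉ K → w k y = 0 := fun k y hy hyK => by
    simp only [hw, h0 y hy hyK, zero_mul]
  have hint : ∀ k, IntegrableOn (pderiv (w k) k) Ω := fun k =>
    integrableOn_of_isCompact h.relOpen hK hKΩ (continuousOn_pderiv (hwc k) h.relOpen k)
      fun y hy hyK => by
        rw [pderiv_congr (h.relOpen.diff_isCompact hK) ⟨hy, hyK⟩ (f' := fun _ => 0)
          (fun z hz => hw0 k z hz.1 hz.2), pderiv_const]
  have hzero : ∑ k, ∫ y in Ω, pderiv (w k) k y = 0 := Finset.sum_eq_zero fun k _ =>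
    integral_pderiv_eq_zero h.relOpen (hwc k) hK hKΩ (hw0 k) k fun hk y hy hy0 => by
      subst hk
      simp only [hw, h.density_mul_scalVec_zero_eq hb hp ht hy hy0, sub_self, mul_zero]
  rw [← integral_finsetSum _ fun k _ => hint k] at hzero
  have hi1 : IntegrableOn
      (fun y => r y * (density (G t) y * divg (G t) (scalVec (G t) (H t)) y)) Ω :=
    integrableOn_of_isCompact h.relOpen hK hKΩ (hr.continuousOn.mul
      (hm.contDiffOn_density.continuousOn.mul (continuousOn_divg hm (h.contDiffOn_scalVec ht))))
      fun y hy hyK => by rw [h0 y hy hyK, zero_mul]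
  have hpt : ∀ y ∈ Ω, density (G t) y * corrScal (G t) (H t) p r y
      = ∑ k, pderiv (w k) k y
        - r y * (density (G t) y * divg (G t) (scalVec (G t) (H t)) y) := fun y hy => by
    rw [h.sum_pderiv_mul_corrected hp hr ht hy]; ring
  rw [setIntegral_congr_fun h.relOpen.measurableSet hpt,
    integral_sub (integrable_finsetSum _ fun k _ => hint k) hi1, hzero]
  ring

/-- `corrScal` is independent of the coordinates. -/
theorem corrScal_eq {φ : Coord n → Coord n} (h : IsTransition Ω Ω' φ) (hG : MetricFam J Ω G H)
    (hG' : MetricFam J Ω' G' H')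
    (hGG' : ∀ t ∈ J, ∀ y ∈ Ω, G t y = (jac φ y)ᵀ * G' t (φ y) * jac φ y) (ht : t ∈ J)
    {p p' r r' : Coord n → ℝ} (hp : IsDefining Ω p) (hp' : IsDefining Ω' p')
    (hr : ContDiffOn ℝ 3 r Ω) (hr' : ContDiffOn ℝ 3 r' Ω')
    (hpp : ∀ z ∈ Ω, p z = p' (φ z)) (hrr : ∀ z ∈ Ω, r z = r' (φ z)) (hy : y ∈ Ω) :
    corrScal (G' t) (H' t) p' r' (φ y) = corrScal (G t) (H t) p r y := by
  rw [corrScal, corrScal, h.divg_eq (hG.isLocalMetric t ht) (hG'.isLocalMetric t ht) (hGG' t ht)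
    (fun k => (hG.contDiffOn_corrVec hp hr ht k).of_le (by norm_num))
    (fun k => (hG'.contDiffOn_corrVec hp' hr' ht k).of_le (by norm_num))
    (fun z hz m => corrVec_eq h hG hG' hGG' ht hz (hp'.contDiffOn.of_le (by norm_num))
      (hr'.of_le (by norm_num)) hpp hrr m) hy]
  congr 1
  have gr := h.grad_eq (hr'.of_le (by norm_num)) hrr hy
  have hX : (fun k => scalVec (G' t) (H' t) k (φ y)) = jac φ y *ᵥ fun k => scalVec (G t) (H t) k y :=
    funext fun m => scalVec_eq h hG hG' hGG' ht hy m
  change (fun k => scalVec (G' t) (H' t) k (φ y)) ⬝ᵥ grad r' (φ y)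
    = (fun k => scalVec (G t) (H t) k y) ⬝ᵥ grad r y
  rw [hX, gr, Matrix.dotProduct_mulVec, Matrix.vecMul_transpose]

/-- `corrScal` is linear in `r` through its derivatives and kills constants. This serves twice: for
a partition of unity, with sum one, and for a single function vanishing on `Ω`, where it expresses
locality. -/
theorem sum_corrScal_eq_zero (h : MetricFam J Ω G H) (hp : IsDefining Ω p) {ι : Type*}
    {s : Finset ι} {r : ι → Coord n → ℝ} (hr : ∀ a, ContDiffOn ℝ 3 (r a) Ω) {c : ℝ}
    (hs : ∀ y ∈ Ω, ∑ a ∈ s, r a y = c) (ht : t ∈ J) (hy : y ∈ Ω) :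
    ∑ a ∈ s, corrScal (G t) (H t) p (r a) y = 0 := by
  have hdr : ∀ z ∈ Ω, ∀ k, ∑ a ∈ s, pderiv (r a) k z = 0 := fun z hz k => by
    rw [← pderiv_sum s (h.relOpen.subset hz) fun a _ =>
      differentiableWithinAt_of_contDiffOn (hr a) h.relOpen (by simp) hz,
      pderiv_congr h.relOpen hz (f' := fun _ => c) hs, pderiv_const]
  have hv : ∀ z ∈ Ω, ∀ k, ∑ a ∈ s, corrVec (G t) (H t) p (r a) k z = 0 := fun z hz k => by
    simp only [corrVec]
    rw [Finset.sum_comm]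
    exact Finset.sum_eq_zero fun j _ => by rw [← Finset.mul_sum, hdr z hz, mul_zero]
  have hdv : ∀ k, ∑ a ∈ s, pderiv (corrVec (G t) (H t) p (r a) k) k y = 0 := fun k => by
    rw [← pderiv_sum s (h.relOpen.subset hy) fun a _ =>
      differentiableWithinAt_of_contDiffOn (h.contDiffOn_corrVec hp (hr a) ht k) h.relOpen
        (by simp) hy, pderiv_congr h.relOpen hy (f' := fun _ => 0) (fun z hz => hv z hz k),
      pderiv_const]
  simp only [corrScal, divg, Finset.sum_sub_distrib, Finset.sum_add_distrib]
  have e1 : ∑ a ∈ s, ∑ k, scalVec (G t) (H t) k y * pderiv (r a) k y = 0 := by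
    rw [Finset.sum_comm]
    exact Finset.sum_eq_zero fun j _ => by rw [← Finset.mul_sum, hdr y hy, mul_zero]
  have e2 : ∑ a ∈ s, ∑ k, pderiv (corrVec (G t) (H t) p (r a) k) k y = 0 := by
    rw [Finset.sum_comm]
    exact Finset.sum_eq_zero fun k _ => hdv k
  have e3 : ∑ a ∈ s, ∑ k, ∑ l, chr (G t) l k l y * corrVec (G t) (H t) p (r a) k y = 0 := by
    rw [Finset.sum_comm]
    refine Finset.sum_eq_zero fun k _ => ?_
    rw [Finset.sum_comm]
    exact Finset.sum_eq_zero fun l _ => by rw [← Finset.mul_sum, hv y hy, mul_zero]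
  rw [e1, e2, e3]; ring

end MetricFam

end LocalIdentity

/-! ### Restriction to smaller domains and one-sided derivatives -/

section Restriction

variable {n : ℕ} [NeZero n] {Ω Ω' : Set (Coord n)} {J : Set ℝ}
  {G H : ℝ → Coord n → Matrix (Fin n) (Fin n) ℝ} {p : Coord n → ℝ}

theorem TFam.mono_right {k : ℕ} {f f' : ℝ → Coord n → ℝ} (h : TFam J Ω k f f') (hs : Ω' ⊆ Ω) :
    TFam J Ω' k f f' :=
  ⟨h.fam.mono subset_rfl hs, h.fam'.mono subset_rfl hs, fun t ht y hy => h.hasDerivAt t ht y (hs hy)⟩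

theorem MetricFam.mono_right (h : MetricFam J Ω G H) (hΩ : RelOpen Ω') (hs : Ω' ⊆ Ω) :
    MetricFam J Ω' G H :=
  ⟨h.isOpen, hΩ, fun t ht => (h.isLocalMetric t ht).mono hΩ hs, fun i j => (h.tfam i j).mono_right hs⟩

theorem IsDefining.mono (h : IsDefining Ω p) (hs : Ω' ⊆ Ω) : IsDefining Ω' p :=
  ⟨h.contDiffOn.mono hs, fun y hy => h.pos y (hs hy), fun y hy => h.eq_zero y (hs hy),
    fun y hy => h.pderiv_ne_zero y (hs hy)⟩

/-- Difference quotients along positive rays are nonnegative at a zero of a nonnegative function.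
Normal derivatives of several such functions therefore cannot cancel in a sum. -/
theorem pderiv_zero_nonneg {f : Coord n → ℝ} {y : Coord n} (hΩ : RelOpen Ω) (hy : y ∈ Ω)
    (hf : DifferentiableWithinAt ℝ f (halfSpace n) y) (h0 : f y = 0) (hpos : ∀ z ∈ Ω, 0 ≤ f z)
    (i : Fin n) : 0 ≤ pderiv f i y := by
  have hyH := hΩ.subset hy
  have h := hasDerivWithinAt_ray hyH i (r := 0) (f := f) (by simpa using hf)
  simp only [zero_smul, add_zero] at h
  have h1 := (hasDerivWithinAt_iff_tendsto_slope' (by simp)).1 (h.mono Ioi_subset_Ici_self)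
  refine ge_of_tendsto h1 ?_
  have hc : Tendsto (fun r : ℝ => y + r • (EuclideanSpace.single i (1 : ℝ) : Coord n)) (𝓝[>] 0)
      (𝓝[halfSpace n] y) := by
    refine tendsto_nhdsWithin_iff.2 ⟨?_, ?_⟩
    · have : Continuous fun r : ℝ => y + r • (EuclideanSpace.single i (1 : ℝ) : Coord n) := by
        fun_prop
      have h2 := this.tendsto 0
      simp only [zero_smul, add_zero] at h2
      exact h2.mono_left nhdsWithin_le_nhds
    · filter_upwards [self_mem_nhdsWithin] with r hr
      exact ray_mem_halfSpace hyH i (le_of_lt hr)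
  filter_upwards [hc (hΩ.mem_nhdsWithin hy), self_mem_nhdsWithin] with r hr hr0
  rw [slope_def_field]
  simp only [zero_smul, add_zero, h0, sub_zero]
  exact div_nonneg (hpos _ hr) (le_of_lt hr0)

end Restriction

/-! ### A global defining function and the global divergence identity -/

section Global

variable {n : ℕ} [NeZero n] {W : Type*} [TopologicalSpace W]
  [ChartedSpace (EuclideanHalfSpace n) W] [T2Space W] [CompactSpace W] [IsManifold (𝓡∂ n) ∞ W]

namespace ChartPartition

variable (P : ChartPartition n W)

theorem sum_loc (c : W) (y : Coord n) : ∑ a ∈ P.index, P.loc a c y = 1 := P.sum_eq_one _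

theorem loc_eq_zero {a c : W} {y : Coord n}
    (h : (extChartAt (𝓡∂ n) c).symm y ∉ tsupport (P.ρ a)) : P.loc a c y = 0 :=
  image_eq_zero_of_notMem_tsupport (f := P.ρ a) h

theorem loc_trans (a : W) {c c' : W} {y : Coord n} (hy : y ∈ overlap c c') :
    P.loc a c y = P.loc a c' (trans c c' y) := by
  rw [loc, loc, symm_trans hy]

/-- One summand of the defining function of the boundary. -/
def height (a x : W) : ℝ := P.ρ a x * extChartAt (𝓡∂ n) a x 0

/-- A global defining function of the boundary, in the chart around `c`. -/
def defFun (c : W) (y : Coord n) : ℝ :=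
  ∑ a ∈ P.index, P.height a ((extChartAt (𝓡∂ n) c).symm y)

theorem contMDiff_height (a : W) : ContMDiff (𝓡∂ n) 𝓘(ℝ, ℝ) ∞ (P.height a) := by
  refine contMDiff_of_tsupport fun x hx => ?_
  have hxs : x ∈ (extChartAt (𝓡∂ n) a).source :=
    P.subordinate a (closure_mono (Function.support_mul_subset_left _ _) hx)
  have h1 : ContMDiffAt (𝓡∂ n) 𝓘(ℝ, Coord n) ∞ (extChartAt (𝓡∂ n) a) x :=
    contMDiffAt_extChartAt' (by rwa [extChartAt_source] at hxs)
  have h2 : ContMDiff 𝓘(ℝ, Coord n) 𝓘(ℝ, ℝ) ∞ (EuclideanSpace.proj (𝕜 := ℝ) (0 : Fin n)) :=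
    (EuclideanSpace.proj (𝕜 := ℝ) (0 : Fin n)).contDiff.contMDiff
  exact ((P.smooth a).contMDiffAt).mul (h2.contMDiffAt.comp x h1)

theorem contDiffOn_height (a c : W) : ContDiffOn ℝ ∞
    (fun y => P.height a ((extChartAt (𝓡∂ n) c).symm y)) (extChartAt (𝓡∂ n) c).target :=
  contMDiffOn_iff_contDiffOn.1
    ((P.contMDiff_height a).comp_contMDiffOn (contMDiffOn_extChartAt_symm c))

theorem height_nonneg (a x : W) : 0 ≤ P.height a x := by
  by_cases hx : x ∈ (extChartAt (𝓡∂ n) a).source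
  · exact mul_nonneg (P.nonneg a x) (mem_halfSpace.1
      ((relOpen_target a).subset ((extChartAt (𝓡∂ n) a).map_source hx)))
  · rw [height, P.eq_zero hx, zero_mul]

theorem exists_pos (x : W) : ∃ a ∈ P.index, 0 < P.ρ a x ∧ x ∈ (extChartAt (𝓡∂ n) a).source := by
  by_contra! h
  have : ∑ a ∈ P.index, P.ρ a x = 0 := Finset.sum_eq_zero fun a ha => by
    rcases (P.nonneg a x).lt_or_eq with h1 | h1
    · exact P.eq_zero (h a ha h1)
    · exact h1.symm
  rw [P.sum_eq_one] at this
  exact one_ne_zero this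

theorem defFun_trans {c c' : W} {y : Coord n} (hy : y ∈ overlap c c') :
    P.defFun c y = P.defFun c' (trans c c' y) := by
  rw [defFun, defFun, symm_trans hy]

theorem height_eq_zero (a : W) {c : W} {y : Coord n} (hy : y ∈ (extChartAt (𝓡∂ n) c).target)
    (hy0 : y 0 = 0) : P.height a ((extChartAt (𝓡∂ n) c).symm y) = 0 := by
  by_cases hx : (extChartAt (𝓡∂ n) c).symm y ∈ (extChartAt (𝓡∂ n) a).source
  · rw [height]
    have := (isTransition (n := n) c a).boundary y ⟨hy, hx⟩ hy0
    rw [trans] at this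
    rw [this, mul_zero]
  · rw [height, P.eq_zero hx, zero_mul]

/-- In each chart the coordinate `y 0` defines the boundary. In the weighted sum all terms are
nonnegative, as are their normal derivatives at the boundary, and at every point at least one weight
is positive; no cancellation can occur. -/
theorem isDefining_defFun (c : W) : IsDefining (extChartAt (𝓡∂ n) c).target (P.defFun c) where
  contDiffOn := ContDiffOn.sum fun a _ => (P.contDiffOn_height a c).of_le (by norm_cast)
  pos := fun y hy hy0 => by
    obtain ⟨a, ha, hpos, hs⟩ := P.exists_pos ((extChartAt (𝓡∂ n) c).symm y)
    refine Finset.sum_pos' (fun b _ => P.height_nonneg b _) ⟨a, ha, mul_pos hpos ?_⟩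
    refine lt_of_le_of_ne (mem_halfSpace.1
      ((relOpen_target a).subset ((extChartAt (𝓡∂ n) a).map_source hs))) fun h => ?_
    have h1 := (mem_boundary_iff hs).2 h.symm
    rw [mem_boundary_iff ((extChartAt (𝓡∂ n) c).map_target hy),
      (extChartAt (𝓡∂ n) c).right_inv hy] at h1
    exact hy0.ne' h1
  eq_zero := fun y hy hy0 => Finset.sum_eq_zero fun a _ => P.height_eq_zero a hy hy0
  pderiv_ne_zero := fun y hy hy0 => by
    have hyH := (relOpen_target c).subset hy
    have hd : ∀ a, DifferentiableWithinAt ℝ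
        (fun z => P.height a ((extChartAt (𝓡∂ n) c).symm z)) (halfSpace n) y := fun a =>
      differentiableWithinAt_of_contDiffOn (P.contDiffOn_height a c) (relOpen_target c) (by simp) hy
    refine ne_of_gt ?_
    unfold defFun
    rw [pderiv_sum _ hyH fun a _ => hd a]
    obtain ⟨a, ha, hpos, hs⟩ := P.exists_pos ((extChartAt (𝓡∂ n) c).symm y)
    refine Finset.sum_pos' (fun b _ => pderiv_zero_nonneg (relOpen_target c) hy (hd b)
      (P.height_eq_zero b hy hy0) (fun z _ => P.height_nonneg b _) 0) ⟨a, ha, ?_⟩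
    have hov : y ∈ overlap c a := ⟨hy, hs⟩
    have hT := isTransition (n := n) c a
    have ht : DifferentiableWithinAt ℝ (fun z => trans c a z 0) (halfSpace n) y :=
      differentiableWithinAt_of_contDiffOn (hT.contDiffOn_comp 0) hT.relOpen (by simp) hov
    have hl : DifferentiableWithinAt ℝ (P.loc a c) (halfSpace n) y :=
      differentiableWithinAt_of_contDiffOn (P.contDiffOn_loc a c) (relOpen_target c) (by simp) hy
    have e : pderiv (fun z => P.height a ((extChartAt (𝓡∂ n) c).symm z)) 0 y
        = P.loc a c y * jac (trans c a) y 0 0 := by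
      have h1 := pderiv_mul hyH hl ht 0
      rw [hT.boundary y hov hy0, mul_zero, zero_add] at h1
      exact h1
    rw [e]
    refine mul_pos hpos (lt_of_le_of_ne ?_ (hT.jac_zero_zero_ne_zero hov hy0).symm)
    exact pderiv_zero_nonneg hT.relOpen hov ht (hT.boundary y hov hy0)
      (fun z hz => mem_halfSpace.1 (hT.relOpen'.subset (hT.mapsTo hz))) 0

end ChartPartition

/-- A family of metrics on `W` with time derivative `H` for which the induced metrics on the boundary
are conformal and minimal. -/
structure GlobalFam (J : Set ℝ) (γ : ℝ → SmoothMetric n W)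
    (H : W → ℝ → Coord n → Matrix (Fin n) (Fin n) ℝ) : Prop where
  metricFam : ∀ c, MetricFam J (extChartAt (𝓡∂ n) c).target (fun t => gram (γ t) c) (H c)
  boundaryCond : ∀ c, BoundaryCond J (extChartAt (𝓡∂ n) c).target (fun t => gram (γ t) c)

namespace GlobalFam

variable {J : Set ℝ} {γ : ℝ → SmoothMetric n W} {H : W → ℝ → Coord n → Matrix (Fin n) (Fin n) ℝ}
  {t : ℝ}

theorem gram_trans_eq (γ : ℝ → SmoothMetric n W) (c c' : W) : ∀ t ∈ J, ∀ y ∈ overlap c c',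
    gram (γ t) c y = (jac (trans c c') y)ᵀ * gram (γ t) c' (trans c c' y) * jac (trans c c') y :=
  fun t _ => gram_trans' (γ t) c c'

theorem metricFam_overlap (h : GlobalFam J γ H) (c c' : W) :
    MetricFam J (overlap c c') (fun t => gram (γ t) c) (H c) :=
  (h.metricFam c).mono_right (relOpen_overlap c c') inter_subset_left

theorem corrScal_symm (h : GlobalFam J γ H) (P : ChartPartition n W) (ht : t ∈ J) (a : W)
    {c : W} {y : Coord n} (hy : y ∈ (extChartAt (𝓡∂ n) c).target) :
    let x := (extChartAt (𝓡∂ n) c).symm y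
    corrScal (gram (γ t) x) (H x t) (P.defFun x) (P.loc a x) (extChartAt (𝓡∂ n) x x)
      = corrScal (gram (γ t) c) (H c t) (P.defFun c) (P.loc a c) y := by
  intro x
  have hov : y ∈ overlap c x := ⟨hy, mem_extChartAt_source x⟩
  exact MetricFam.corrScal_eq (isTransition (n := n) c x) (h.metricFam_overlap c x) (h.metricFam x)
    (gram_trans_eq γ c x) ht ((P.isDefining_defFun c).mono inter_subset_left) (P.isDefining_defFun x)
    (((P.contDiffOn_loc a c).of_le (by norm_cast)).mono inter_subset_left)
    ((P.contDiffOn_loc a x).of_le (by norm_cast)) (fun z hz => P.defFun_trans hz)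
    (fun z hz => P.loc_trans a hz) hov

/-- The scalar representing the divergence tested against the `a`-th partition function. -/
def testScal (γ : ℝ → SmoothMetric n W) (H : W → ℝ → Coord n → Matrix (Fin n) (Fin n) ℝ)
    (P : ChartPartition n W) (t : ℝ) (a x : W) : ℝ :=
  corrScal (gram (γ t) x) (H x t) (P.defFun x) (P.loc a x) (extChartAt (𝓡∂ n) x x)

theorem continuous_testScal (h : GlobalFam J γ H) (P : ChartPartition n W) (ht : t ∈ J) (a : W) :
    Continuous (testScal γ H P t a) :=
  continuous_of_chart fun c => ((h.metricFam c).continuousOn_corrScal (P.isDefining_defFun c)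
    ((P.contDiffOn_loc a c).of_le (by norm_cast)) ht).congr fun _ hy => h.corrScal_symm P ht a hy

theorem testScal_eq_zero (h : GlobalFam J γ H) (P : ChartPartition n W) (ht : t ∈ J) {a x : W}
    (hx : x ∉ (extChartAt (𝓡∂ n) a).source) : testScal γ H P t a x = 0 := by
  set Ω' := (extChartAt (𝓡∂ n) x).target ∩ (extChartAt (𝓡∂ n) x).symm ⁻¹' (tsupport (P.ρ a))ᶜ
    with hΩ'
  have hro : RelOpen Ω' := (relOpen_target x).inter_preimage (continuousOn_extChartAt_symm x)
    (isClosed_tsupport _).isOpen_compl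
  have hm : extChartAt (𝓡∂ n) x x ∈ Ω' := ⟨mem_extChartAt_target x, by
    rw [mem_preimage, extChartAt_to_inv]; exact fun h1 => hx (P.subordinate a h1)⟩
  -- On `Ω'` the coordinate expression of `ρ a` is zero, so the vanishing of the sum applies to this
  -- single function with constant `c = 0`.
  have := ((h.metricFam x).mono_right hro inter_subset_left).sum_corrScal_eq_zero
    ((P.isDefining_defFun x).mono inter_subset_left) (s := {a}) (r := fun _ => P.loc a x) (c := 0)
    (fun _ => ((P.contDiffOn_loc a x).of_le (by norm_cast)).mono inter_subset_left)
    (fun y hy => by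
      rw [Finset.sum_singleton]
      exact P.loc_eq_zero hy.2) ht hm
  rwa [Finset.sum_singleton] at this

/-- The divergence term in the variation of the scalar curvature has vanishing integral. -/
theorem integral_eq_zero [MeasurableSpace W] [BorelSpace W] (h : GlobalFam J γ H) (ht : t ∈ J)
    [IsFiniteMeasure (riemVolume (γ t))] {F : W → ℝ} (hF : Continuous F)
    (hdiv : ∀ c, ∀ y ∈ (extChartAt (𝓡∂ n) c).target, F ((extChartAt (𝓡∂ n) c).symm y)
      = divg (gram (γ t) c) (scalVec (gram (γ t) c) (H c t)) y) :
    ∫ x, F x ∂(riemVolume (γ t)) = 0 := by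
  obtain ⟨P⟩ := exists_chartPartition n W
  -- Integration by parts replaces each chart integral by the integral over `W` of a continuous
  -- scalar that is no longer tied to the chart. These integrals can be added under one integral
  -- sign, where the sum of the scalars is zero.
  have h1 : ∀ c ∈ P.index, ∫ y in (extChartAt (𝓡∂ n) c).target,
      P.loc c c y * (density (gram (γ t) c) y * F ((extChartAt (𝓡∂ n) c).symm y))
        = -∫ x, testScal γ H P t c x ∂(riemVolume (γ t)) := fun c _ => by
    have hK : IsCompact (extChartAt (𝓡∂ n) c '' tsupport (P.ρ c)) :=
      (isClosed_tsupport _).isCompact.image_of_continuousOn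
        ((continuousOn_extChartAt c).mono (P.subordinate c))
    have hKt : extChartAt (𝓡∂ n) c '' tsupport (P.ρ c) ⊆ (extChartAt (𝓡∂ n) c).target := by
      rintro _ ⟨x, hx, rfl⟩
      exact (extChartAt (𝓡∂ n) c).map_source (P.subordinate c hx)
    have e1 : ∀ y ∈ (extChartAt (𝓡∂ n) c).target,
        P.loc c c y * (density (gram (γ t) c) y * F ((extChartAt (𝓡∂ n) c).symm y))
          = P.loc c c y * (density (gram (γ t) c) y
            * divg (gram (γ t) c) (scalVec (gram (γ t) c) (H c t)) y) := fun y hy => by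
      rw [hdiv c y hy]
    have e2 : ∀ y ∈ (extChartAt (𝓡∂ n) c).target,
        density (gram (γ t) c) y * testScal γ H P t c ((extChartAt (𝓡∂ n) c).symm y)
          = density (gram (γ t) c) y
            * corrScal (gram (γ t) c) (H c t) (P.defFun c) (P.loc c c) y := fun y hy => by
      rw [testScal, h.corrScal_symm P ht c hy]
    rw [integral_chart (γ t) c (h.continuous_testScal P ht c) fun x hx => h.testScal_eq_zero P ht hx]
    refine (setIntegral_congr_fun (measurableSet_target c) e1).trans
      (((h.metricFam c).integral_mul_divg_scalVec (h.boundaryCond c) (P.isDefining_defFun c)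
        ((P.contDiffOn_loc c c).of_le (by norm_cast)) ht hK hKt fun y hy hyK => P.loc_eq_zero
          fun hs => hyK ⟨_, hs, (extChartAt (𝓡∂ n) c).right_inv hy⟩).trans ?_)
    exact congrArg Neg.neg (setIntegral_congr_fun (measurableSet_target c) e2).symm
  rw [P.integral_eq (γ t) hF, Finset.sum_congr rfl h1, Finset.sum_neg_distrib,
    ← integral_finsetSum _ fun c _ =>
      (h.continuous_testScal P ht c).integrable_of_hasCompactSupport
        (HasCompactSupport.of_compactSpace _)]
  have h2 : ∀ x, ∑ c ∈ P.index, testScal γ H P t c x = 0 := fun x =>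
    (h.metricFam x).sum_corrScal_eq_zero (P.isDefining_defFun x)
      (fun a => (P.contDiffOn_loc a x).of_le (by norm_cast)) (fun y _ => P.sum_loc x y) ht
      (mem_extChartAt_target x)
  simp only [h2, integral_zero, neg_zero]

end GlobalFam

end Global

/-! ### Families that are continuous in the `C²` topology or jointly smooth -/

section Families

variable {n : ℕ} [NeZero n] {Ω : Set (Coord n)} {J : Set ℝ}

/-- Joint continuity of the spatial derivatives up to order two. -/
theorem CFam.of_iteratedFDerivWithin (hΩ : RelOpen Ω) {f : ℝ → Coord n → ℝ}
    (hf : ∀ t ∈ J, ContDiffOn ℝ 2 (f t) Ω)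
    (h : ∀ m ≤ 2, ContinuousOn
      (fun p : ℝ × Coord n => iteratedFDerivWithin ℝ m (f p.1) (range (𝓡∂ n)) p.2) (J ×ˢ Ω)) :
    CFam J Ω 2 f := by
  have happ : ∀ (m : ℕ) (v : Fin m → Coord n), Continuous
      fun A : ContinuousMultilinearMap ℝ (fun _ : Fin m => Coord n) ℝ => A v := fun m v =>
    continuous_eval_const v
  have hc : ∀ m ≤ 2, ∀ v : Fin m → Coord n, ContinuousOn
      (fun p : ℝ × Coord n => iteratedFDerivWithin ℝ m (f p.1) (range (𝓡∂ n)) p.2 v) (J ×ˢ Ω) :=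
    fun m hm v => (happ m v).comp_continuousOn (h m hm)
  refine ⟨?_, fun t ht y hy => differentiableWithinAt_of_contDiffOn (hf t ht) hΩ (by simp) hy,
    fun i => ⟨?_, fun t ht y hy => differentiableWithinAt_of_contDiffOn
      (contDiffOn_pderiv (m := 1) (hf t ht) hΩ (by norm_num) i) hΩ (by simp) hy, fun j => ?_⟩⟩
  · exact hc 0 (by simp) ![]
  · refine (hc 1 (by simp) ![EuclideanSpace.single i 1]).congr fun p hp => ?_
    dsimp only
    exact (iteratedFDerivWithin_one_apply (f := f p.1) (uniqueDiffOn_halfSpace p.2 (hΩ.subset hp.2))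
      ![EuclideanSpace.single i 1]).symm
  · refine (hc 2 le_rfl ![EuclideanSpace.single j 1, EuclideanSpace.single i 1]).congr
      fun p hp => ?_
    dsimp only
    have hH := hΩ.subset hp.2
    refine Eq.trans ?_ (iteratedFDerivWithin_two_apply _ uniqueDiffOn_halfSpace hH _).symm
    have hd : DifferentiableWithinAt ℝ (fderivWithin ℝ (f p.1) (halfSpace n)) (halfSpace n) p.2 := by
      have h1 : DifferentiableWithinAt ℝ (fderivWithin ℝ (f p.1) Ω) Ω p.2 :=
        ((hf p.1 hp.1).fderivWithin hΩ.uniqueDiffOn (m := 1) (by norm_num)).differentiableOn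
          (by simp) p.2 hp.2
      rw [← differentiableWithinAt_congr_nhds (hΩ.nhdsWithin_eq hp.2)]
      exact h1.congr (fun z hz => hΩ.fderivWithin_eq hz _) (hΩ.fderivWithin_eq hp.2 _)
    change fderivWithin ℝ (fun z => fderivWithin ℝ (f p.1) (halfSpace n) z
      (EuclideanSpace.single i 1)) (halfSpace n) p.2 (EuclideanSpace.single j 1) = _
    rw [fderivWithin_clm_apply (uniqueDiffOn_halfSpace _ hH) hd (differentiableWithinAt_const _)]
    simp [halfSpace]

theorem uniqueDiffOn_prod (hJ : IsOpen J) (hΩ : RelOpen Ω) :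
    UniqueDiffOn ℝ (J ×ˢ Ω : Set (ℝ × Coord n)) := hJ.uniqueDiffOn.prod hΩ.uniqueDiffOn

theorem CFam.of_contDiffOn_prod (hJ : IsOpen J) (hΩ : RelOpen Ω) (k : ℕ)
    {F : ℝ × Coord n → ℝ} (hF : ContDiffOn ℝ ∞ F (J ×ˢ Ω)) : CFam J Ω k fun t y => F (t, y) := by
  induction k generalizing F with
  | zero => exact hF.continuousOn
  | succ k ih =>
    have hd : ∀ t ∈ J, ∀ y ∈ Ω, HasFDerivWithinAt (fun z => F (t, z))
        ((fderivWithin ℝ F (J ×ˢ Ω) (t, y)).comp (ContinuousLinearMap.inr ℝ ℝ (Coord n))) Ω y :=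
      fun t ht y hy => by
        have h1 := (hF.differentiableOn (by simp) (t, y) ⟨ht, hy⟩).hasFDerivWithinAt
        exact h1.comp y (hasFDerivAt_prodMk_right t y).hasFDerivWithinAt fun z hz => ⟨ht, hz⟩
    refine ⟨hF.continuousOn, fun t ht y hy => ?_, fun i => ?_⟩
    · rw [← differentiableWithinAt_congr_nhds (hΩ.nhdsWithin_eq hy)]
      exact (hd t ht y hy).differentiableWithinAt
    · have h2 : ContDiffOn ℝ ∞ (fun p => fderivWithin ℝ F (J ×ˢ Ω) p
          ((0, EuclideanSpace.single i 1) : ℝ × Coord n)) (J ×ˢ Ω) :=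
        (hF.fderivWithin (uniqueDiffOn_prod hJ hΩ) (by simp)).clm_apply contDiffOn_const
      refine (ih h2).congr hΩ fun t ht y hy => ?_
      rw [pderiv_def]
      dsimp only
      rw [hΩ.fderivWithin_eq hy, (hd t ht y hy).fderivWithin (hΩ.uniqueDiffOn y hy)]
      simp

theorem TFam.of_contDiffOn_prod (hJ : IsOpen J) (hΩ : RelOpen Ω) (k : ℕ)
    {F : ℝ × Coord n → ℝ} (hF : ContDiffOn ℝ ∞ F (J ×ˢ Ω)) :
    TFam J Ω k (fun t y => F (t, y))
      (fun t y => fderivWithin ℝ F (J ×ˢ Ω) (t, y) ((1, 0) : ℝ × Coord n)) where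
  fam := CFam.of_contDiffOn_prod hJ hΩ k hF
  fam' := CFam.of_contDiffOn_prod hJ hΩ k
    (F := fun p => fderivWithin ℝ F (J ×ˢ Ω) p ((1, 0) : ℝ × Coord n))
    ((hF.fderivWithin (uniqueDiffOn_prod hJ hΩ) (by simp)).clm_apply contDiffOn_const)
  hasDerivAt := fun t ht y hy => by
    have h1 := (hF.differentiableOn (by simp) (t, y) ⟨ht, hy⟩).hasFDerivWithinAt
    have h2 := (HasFDerivWithinAt.comp (f := fun s => (s, y)) t h1
      (hasFDerivAt_prodMk_left t y).hasFDerivWithinAt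
      (fun s (hs : s ∈ J) => ⟨hs, hy⟩)).hasDerivWithinAt
    have h3 := h2.hasDerivAt (hJ.mem_nhds ht)
    simp only [ContinuousLinearMap.comp_apply, ContinuousLinearMap.inl_apply] at h3
    exact h3

variable {G : ℝ → Coord n → Matrix (Fin n) (Fin n) ℝ}

/-- A family of metrics that is continuous in time for the `C²` topology. -/
structure C2MetricFam (J : Set ℝ) (Ω : Set (Coord n))
    (G : ℝ → Coord n → Matrix (Fin n) (Fin n) ℝ) : Prop where
  relOpen : RelOpen Ω
  isLocalMetric : ∀ t ∈ J, IsLocalMetric Ω (G t)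
  cfam : ∀ i j, CFam J Ω 2 (fun t y => G t y i j)

namespace C2MetricFam

theorem cfam_inv (h : C2MetricFam J Ω G) (i j : Fin n) :
    CFam J Ω 2 (fun t y => (G t y)⁻¹ i j) :=
  CFam.inv_matrix h.relOpen h.cfam (fun t ht _ hy => (h.isLocalMetric t ht).det_ne_zero hy) i j

theorem cfam_chr (h : C2MetricFam J Ω G) (k i j : Fin n) : CFam J Ω 1 (fun t => chr (G t) k i j) :=
  (CFam.sum h.relOpen Finset.univ fun l _ => ((h.cfam_inv k l).of_le one_le_two).mul h.relOpen
    ((((h.cfam j l).pderiv i).add h.relOpen ((h.cfam i l).pderiv j)).sub h.relOpen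
      ((h.cfam i j).pderiv l))).const_mul h.relOpen (1 / 2)

theorem cfam_ricMat (h : C2MetricFam J Ω G) (i j : Fin n) :
    CFam J Ω 0 (fun t y => ricMat (G t) y i j) :=
  have hc := fun k i j => (h.cfam_chr k i j).of_le zero_le_one
  (CFam.sum h.relOpen _ fun k _ => ((h.cfam_chr k i j).pderiv k).sub h.relOpen
    ((h.cfam_chr k i k).pderiv j)).add h.relOpen
  (CFam.sum h.relOpen _ fun k _ => CFam.sum h.relOpen _ fun l _ =>
    ((hc k k l).mul h.relOpen (hc l i j)).sub h.relOpen ((hc k j l).mul h.relOpen (hc l i k)))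

theorem cfam_frob (h : C2MetricFam J Ω G) {A B : ℝ → Coord n → Matrix (Fin n) (Fin n) ℝ}
    (hA : ∀ i j, CFam J Ω 0 (fun t y => A t y i j)) (hB : ∀ i j, CFam J Ω 0 (fun t y => B t y i j)) :
    CFam J Ω 0 (fun t y => frob (G t y) (A t y) (B t y)) := by
  have hi := fun i j => (h.cfam_inv i j).of_le zero_le_two
  simp only [frob, Matrix.trace, Matrix.diag_apply, Matrix.mul_apply, Matrix.transpose_apply]
  exact CFam.sum h.relOpen _ fun a _ => CFam.sum h.relOpen _ fun b _ =>
    (CFam.sum h.relOpen _ fun c _ => (CFam.sum h.relOpen _ fun d _ =>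
      (hi a d).mul h.relOpen (hA d c)).mul h.relOpen (hi c b)).mul h.relOpen (hB a b)

theorem cfam_mtr (h : C2MetricFam J Ω G) {A : ℝ → Coord n → Matrix (Fin n) (Fin n) ℝ}
    (hA : ∀ i j, CFam J Ω 0 (fun t y => A t y i j)) :
    CFam J Ω 0 (fun t y => mtr (G t y) (A t y)) := by
  have hi := fun i j => (h.cfam_inv i j).of_le zero_le_two
  simp only [mtr, Matrix.trace, Matrix.diag_apply, Matrix.mul_apply]
  exact CFam.sum h.relOpen _ fun a _ => CFam.sum h.relOpen _ fun b _ =>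
    (hi a b).mul h.relOpen (hA b a)

theorem cfam_density (h : C2MetricFam J Ω G) : CFam J Ω 0 (fun t => density (G t)) :=
  ContinuousOn.sqrt ((CFam.det h.relOpen h.cfam).continuousOn)

end C2MetricFam

end Families

/-! ### The inverse of the induced metric on the boundary -/

section BoundaryMatrix

variable {n : ℕ} [NeZero n] {Ω Ω' : Set (Coord n)} {y : Coord n}
  {G G' : Coord n → Matrix (Fin n) (Fin n) ℝ}

/-- The product differs from the identity by a matrix supported in column zero, so `tanInv` inverts
the tangential block of `G`. -/
theorem IsLocalMetric.tanInv_mul_self (h : IsLocalMetric Ω G) (hy : y ∈ Ω) (i j : Fin n)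
    (hj : j ≠ 0) : (tanInv G y * G y) i j = (1 : Matrix (Fin n) (Fin n) ℝ) i j := by
  have h1 : tanInv G y * G y = 1 - Matrix.of fun i j =>
      (G y)⁻¹ i 0 / (G y)⁻¹ 0 0 * (1 : Matrix (Fin n) (Fin n) ℝ) 0 j := by
    rw [← Matrix.nonsing_inv_mul (G y) (h.isUnit_det hy)]
    ext i j
    rw [Matrix.sub_apply, Matrix.mul_apply, Matrix.mul_apply, Matrix.of_apply, Matrix.mul_apply,
      Finset.mul_sum, ← Finset.sum_sub_distrib]
    refine Finset.sum_congr rfl fun k _ => ?_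
    rw [tanInv, Matrix.of_apply, h.inv_symm hy k 0]
    ring
  rw [h1, Matrix.sub_apply, Matrix.of_apply, Matrix.one_apply_ne hj.symm, mul_zero, sub_zero]

/-- Proportional induced metrics on the boundary have proportional inverses. -/
theorem IsLocalMetric.tanInv_eq_smul (h : IsLocalMetric Ω G) (h' : IsLocalMetric Ω G') (hy : y ∈ Ω)
    {f : ℝ} (hf : ∀ i j, i ≠ 0 → j ≠ 0 → G' y i j = f * G y i j) :
    tanInv G y = f • tanInv G' y := by
  have hsymm : ∀ {M : Coord n → Matrix (Fin n) (Fin n) ℝ}, IsLocalMetric Ω M → ∀ j, j ≠ 0 → ∀ i,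
      (M y * tanInv M y) j i = (1 : Matrix (Fin n) (Fin n) ℝ) j i := fun hM j hj i => by
    have h1 := hM.tanInv_mul_self hy i j hj
    rw [Matrix.one_apply] at h1 ⊢
    rw [if_congr (eq_comm (a := j)) rfl rfl, ← h1, Matrix.mul_apply, Matrix.mul_apply]
    exact Finset.sum_congr rfl fun k _ => by rw [hM.symm hy, hM.tanInv_symm hy, mul_comm]
  -- The product of `tanInv G'`, a metric and `tanInv G` is evaluated with either metric in the
  -- middle. As only tangential entries of the middle factor count, the two results differ by the
  -- factor `f`.
  have e1 : tanInv G' y * (G' y * tanInv G y) = tanInv G y := by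
    rw [← Matrix.mul_assoc]
    ext i j
    rw [Matrix.mul_apply]
    have : ∀ k, (tanInv G' y * G' y) i k * tanInv G y k j
        = (1 : Matrix (Fin n) (Fin n) ℝ) i k * tanInv G y k j := fun k => by
      by_cases hk : k = 0
      · rw [hk, h.tanInv_zero_left hy, mul_zero, mul_zero]
      · rw [h'.tanInv_mul_self hy i k hk]
    simp only [this]
    rw [← Matrix.mul_apply, Matrix.one_mul]
  have e2 : tanInv G' y * (G y * tanInv G y) = tanInv G' y := by
    ext i j
    rw [Matrix.mul_apply]
    have : ∀ k, tanInv G' y i k * (G y * tanInv G y) k j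
        = tanInv G' y i k * (1 : Matrix (Fin n) (Fin n) ℝ) k j := fun k => by
      by_cases hk : k = 0
      · rw [hk, h'.tanInv_zero_right hy, zero_mul, zero_mul]
      · rw [hsymm h k hk]
    simp only [this]
    rw [← Matrix.mul_apply, Matrix.mul_one]
  rw [← e1]
  conv_rhs => rw [← e2]
  ext i j
  rw [Matrix.smul_apply, Matrix.mul_apply, Matrix.mul_apply, smul_eq_mul, Finset.mul_sum]
  refine Finset.sum_congr rfl fun k _ => ?_
  by_cases hk : k = 0
  · rw [hk, h'.tanInv_zero_right hy]; ring
  rw [Matrix.mul_apply, Matrix.mul_apply, mul_left_comm, Finset.mul_sum (a := f)]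
  congr 1
  refine Finset.sum_congr rfl fun l _ => ?_
  by_cases hl : l = 0
  · rw [hl, h.tanInv_zero_left hy]; ring
  rw [hf k l hk hl]; ring

end BoundaryMatrix

/-! ### The Ricci flow and its conformal normalization -/

section Flow

variable {n : ℕ} [NeZero n] {W : Type*} [TopologicalSpace W]
  [ChartedSpace (EuclideanHalfSpace n) W] [T2Space W] [CompactSpace W] [IsManifold (𝓡∂ n) ∞ W]

/-- A Ricci flow `g` with the boundary conditions of `IsRicciFlow`, and a conformal change `gY` of it
by a `C¹` family of functions `u` with time derivative `v`. -/
structure NormalizedFlow (T ε : ℝ) (g gY : ℝ → SmoothMetric n W) (u v : ℝ → W → ℝ) : Prop where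
  flow : IsRicciFlow T g
  ε_le : ε ≤ T
  smooth : ∀ t ∈ Ico 0 ε, ContMDiff (𝓡∂ n) 𝓘(ℝ, ℝ) ∞ (u t)
  smooth' : ∀ t ∈ Ico 0 ε, ContMDiff (𝓡∂ n) 𝓘(ℝ, ℝ) 2 (v t)
  pos : ∀ t ∈ Ico 0 ε, ∀ x, 0 < u t x
  hasDerivWithinAt : ∀ t ∈ Ico 0 ε, ∀ x, HasDerivWithinAt (fun s => u s x) (v t x) (Ico 0 ε) t
  contFamily : ContFamily (n := n) 2 (Ico 0 ε) (coordExpr u)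
  contFamily' : ContFamily (n := n) 2 (Ico 0 ε) (coordExpr v)
  isMultiple : ∀ t ∈ Ico 0 ε, IsMultiple (fun x => u t x ^ (4 / ((n : ℝ) - 2))) (g t) (gY t)
  minimalBoundary : ∀ t ∈ Ico 0 ε, MinimalBoundary (gY t)

variable {T ε : ℝ} {g gY : ℝ → SmoothMetric n W} {u v : ℝ → W → ℝ} {t : ℝ} {y : Coord n}

/-- The time derivative of the conformal factor `u ^ (4 / (n - 2))`. -/
def factorDeriv (n : ℕ) (u v : ℝ → W → ℝ) (t : ℝ) (x : W) : ℝ :=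
  4 / ((n : ℝ) - 2) * u t x ^ (4 / ((n : ℝ) - 2) - 1) * v t x

/-- The time derivative of the conformally changed flow. -/
def velocity (g : ℝ → SmoothMetric n W) (u v : ℝ → W → ℝ) (c : W) (t : ℝ) (y : Coord n) :
    Matrix (Fin n) (Fin n) ℝ :=
  factorDeriv n u v t ((extChartAt (𝓡∂ n) c).symm y) • gram (g t) c y
    + u t ((extChartAt (𝓡∂ n) c).symm y) ^ (4 / ((n : ℝ) - 2))
      • ((-2 : ℝ) • ricMat (gram (g t) c) y)

theorem IsRicciFlow.cfam_gram (h : IsRicciFlow T g) (c : W) (i j : Fin n) :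
    CFam (Ico 0 T) (extChartAt (𝓡∂ n) c).target 2 (fun t y => gram (g t) c y i j) :=
  CFam.of_iteratedFDerivWithin (relOpen_target c)
    (fun t _ => (contDiffOn_gram (g t) c i j).of_le (by norm_cast)) (h.contC2 i j c)

theorem IsRicciFlow.c2MetricFam (h : IsRicciFlow T g) (c : W) :
    C2MetricFam (Ico 0 T) (extChartAt (𝓡∂ n) c).target (fun t => gram (g t) c) where
  relOpen := relOpen_target c
  isLocalMetric := fun t _ => isLocalMetric_gram (g t) c
  cfam := h.cfam_gram c

/-- Joint smoothness provides a time derivative with the required regularity in space, and the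
evolution equation identifies it with `-2 Ric`. -/
theorem IsRicciFlow.tfam_gram (h : IsRicciFlow T g) (c : W) (i j : Fin n) :
    TFam (Ioo 0 T) (extChartAt (𝓡∂ n) c).target 2 (fun t y => gram (g t) c y i j)
      (fun t y => ((-2 : ℝ) • ricMat (gram (g t) c) y) i j) := by
  have h1 := TFam.of_contDiffOn_prod isOpen_Ioo (relOpen_target c) 2 (h.smooth c i j)
  refine h1.congr (relOpen_target c) fun t ht y hy => ?_
  have h2 := (h.evolution t ⟨ht.1.le, ht.2⟩ ((extChartAt (𝓡∂ n) c).symm y) (coordVec c i y)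
    (coordVec c j y)).hasDerivAt (Ico_mem_nhds ht.1 ht.2)
  rw [ricci_coordVec (g t) hy] at h2
  exact h2.unique (h1.hasDerivAt t ht y hy)

namespace NormalizedFlow

theorem gram_eq (h : NormalizedFlow T ε g gY u v) (ht : t ∈ Ico 0 ε) (c : W) (y : Coord n) :
    gram (gY t) c y
      = u t ((extChartAt (𝓡∂ n) c).symm y) ^ (4 / ((n : ℝ) - 2)) • gram (g t) c y := by
  ext i j
  exact h.isMultiple t ht _ _ _

theorem cfam_u (h : NormalizedFlow T ε g gY u v) (c : W) :
    CFam (Ico 0 ε) (extChartAt (𝓡∂ n) c).target 2 (coordExpr u c) :=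
  CFam.of_iteratedFDerivWithin (relOpen_target c) (fun t ht => contMDiffOn_iff_contDiffOn.1
    (((h.smooth t ht).of_le (by norm_cast)).comp_contMDiffOn
      ((contMDiffOn_extChartAt_symm c).of_le (by norm_cast : (2 : WithTop ℕ∞) ≤ ∞))))
    (h.contFamily c)

theorem cfam_v (h : NormalizedFlow T ε g gY u v) (c : W) :
    CFam (Ico 0 ε) (extChartAt (𝓡∂ n) c).target 2 (coordExpr v c) :=
  CFam.of_iteratedFDerivWithin (relOpen_target c) (fun t ht => contMDiffOn_iff_contDiffOn.1
    ((h.smooth' t ht).comp_contMDiffOn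
      ((contMDiffOn_extChartAt_symm c).of_le (by norm_cast : (2 : WithTop ℕ∞) ≤ ∞))))
    (h.contFamily' c)

theorem cfam_rpow (h : NormalizedFlow T ε g gY u v) (c : W) (q : ℝ) :
    CFam (Ico 0 ε) (extChartAt (𝓡∂ n) c).target 2
      (fun t y => u t ((extChartAt (𝓡∂ n) c).symm y) ^ q) :=
  CFam.comp_scalar (relOpen_target c) isOpen_Ioi (F := fun x => x ^ q)
    (fun _ hx => (Real.contDiffAt_rpow_const_of_ne (ne_of_gt hx)).contDiffWithinAt)
    (h.cfam_u c) fun t ht _ _ => h.pos t ht _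

theorem cfam_factorDeriv (h : NormalizedFlow T ε g gY u v) (c : W) :
    CFam (Ico 0 ε) (extChartAt (𝓡∂ n) c).target 2
      (fun t y => factorDeriv n u v t ((extChartAt (𝓡∂ n) c).symm y)) :=
  ((h.cfam_rpow c _).const_mul (relOpen_target c) _).mul (relOpen_target c) (h.cfam_v c)

theorem Ico_subset (h : NormalizedFlow T ε g gY u v) : Ico 0 ε ⊆ Ico 0 T :=
  Ico_subset_Ico_right h.ε_le

theorem c2MetricFam (h : NormalizedFlow T ε g gY u v) (c : W) :
    C2MetricFam (Ico 0 ε) (extChartAt (𝓡∂ n) c).target (fun t => gram (gY t) c) where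
  relOpen := relOpen_target c
  isLocalMetric := fun t _ => isLocalMetric_gram (gY t) c
  cfam := fun i j => ((h.cfam_rpow c _).mul (relOpen_target c)
    ((h.flow.cfam_gram c i j).mono h.Ico_subset subset_rfl)).congr (relOpen_target c)
      fun t ht y _ => by rw [h.gram_eq ht, Matrix.smul_apply, smul_eq_mul]

/-- The velocity is continuous up to the initial time. -/
theorem cfam_velocity (h : NormalizedFlow T ε g gY u v) (c : W) (i j : Fin n) :
    CFam (Ico 0 ε) (extChartAt (𝓡∂ n) c).target 0 (fun t y => velocity g u v c t y i j) :=
  ((((h.cfam_factorDeriv c).of_le zero_le_two).mul (relOpen_target c)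
    (((h.flow.cfam_gram c i j).of_le zero_le_two).mono h.Ico_subset subset_rfl)).add
      (relOpen_target c) (((h.cfam_rpow c _).of_le zero_le_two).mul (relOpen_target c)
        ((((h.flow.c2MetricFam c).cfam_ricMat i j).mono h.Ico_subset subset_rfl).const_mul
          (relOpen_target c) (-2)))).congr (relOpen_target c) fun _ _ _ _ => rfl

theorem tfam_rpow (h : NormalizedFlow T ε g gY u v) (c : W) :
    TFam (Ioo 0 ε) (extChartAt (𝓡∂ n) c).target 2
      (fun t y => u t ((extChartAt (𝓡∂ n) c).symm y) ^ (4 / ((n : ℝ) - 2)))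
      (fun t y => factorDeriv n u v t ((extChartAt (𝓡∂ n) c).symm y)) where
  fam := (h.cfam_rpow c _).mono Ioo_subset_Ico_self subset_rfl
  fam' := (h.cfam_factorDeriv c).mono Ioo_subset_Ico_self subset_rfl
  hasDerivAt := fun t ht y _ => by
    set x := (extChartAt (𝓡∂ n) c).symm y
    have h1 : HasDerivAt (fun s => u s x) (v t x) t :=
      (h.hasDerivWithinAt t ⟨ht.1.le, ht.2⟩ x).hasDerivAt (Ico_mem_nhds ht.1 ht.2)
    have h2 := h1.rpow_const (p := 4 / ((n : ℝ) - 2)) (Or.inl (h.pos t ⟨ht.1.le, ht.2⟩ x).ne')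
    refine h2.congr_deriv ?_
    rw [factorDeriv]; ring

/-- The initial time is left out: there joint continuity is known for two space derivatives of the
flow, which controls its Ricci tensor only in `C⁰`, while the linearization needs a velocity of
class `C²`. -/
theorem metricFam (h : NormalizedFlow T ε g gY u v) (c : W) :
    MetricFam (Ioo 0 ε) (extChartAt (𝓡∂ n) c).target (fun t => gram (gY t) c)
      (velocity g u v c) where
  isOpen := isOpen_Ioo
  relOpen := relOpen_target c
  isLocalMetric := fun t _ => isLocalMetric_gram (gY t) c
  tfam := fun i j => by
    have hs : Ioo 0 ε ⊆ Ioo 0 T := Ioo_subset_Ioo_right h.ε_le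
    have h0 := h.flow.tfam_gram c i j
    have h1 := (h.tfam_rpow c).mul (relOpen_target c) (J := Ioo 0 ε)
      (⟨h0.fam.mono hs subset_rfl, h0.fam'.mono hs subset_rfl,
        fun t ht y hy => h0.hasDerivAt t (hs ht) y hy⟩)
    have e : ∀ t ∈ Ioo 0 ε, ∀ y, gram (gY t) c y i j
        = u t ((extChartAt (𝓡∂ n) c).symm y) ^ (4 / ((n : ℝ) - 2)) * gram (g t) c y i j :=
      fun t ht y => by
        rw [h.gram_eq ⟨ht.1.le, ht.2⟩, Matrix.smul_apply, smul_eq_mul]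
    exact ⟨h1.fam.congr (relOpen_target c) fun t ht y _ => e t ht y, h1.fam', fun t ht y hy =>
      (h1.hasDerivAt t ht y hy).congr_of_eventuallyEq (by
        filter_upwards [isOpen_Ioo.mem_nhds ht] with s hs using e s hs y)⟩

/-- On the boundary every `gY s` is conformal to `g 0`, so the tangential inverses at two times are
proportional. The vanishing mean curvature of `gY s` can thus be traced with the metric of `gY t`.
-/
theorem boundaryCond (h : NormalizedFlow T ε g gY u v) (c : W) :
    BoundaryCond (Ioo 0 ε) (extChartAt (𝓡∂ n) c).target (fun t => gram (gY t) c) := by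
  intro s hs t ht y hy hy0
  have hs' : s ∈ Ico 0 ε := ⟨hs.1.le, hs.2⟩
  have ht' : t ∈ Ico 0 ε := ⟨ht.1.le, ht.2⟩
  obtain ⟨a, ha, hsa⟩ :=
    (h.flow.boundaryConformal s (h.Ico_subset hs')).exists_gram_eq (c := c) hy hy0
  obtain ⟨b, hb, htb⟩ :=
    (h.flow.boundaryConformal t (h.Ico_subset ht')).exists_gram_eq (c := c) hy hy0
  set x := (extChartAt (𝓡∂ n) c).symm y
  have hps := Real.rpow_pos_of_pos (h.pos s hs' x) (4 / ((n : ℝ) - 2))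
  have hpt := Real.rpow_pos_of_pos (h.pos t ht' x) (4 / ((n : ℝ) - 2))
  have e := (isLocalMetric_gram (gY t) c).tanInv_eq_smul (isLocalMetric_gram (gY s) c) hy
    (f := u s x ^ (4 / ((n : ℝ) - 2)) * a / (u t x ^ (4 / ((n : ℝ) - 2)) * b)) fun i j hi hj => by
      rw [h.gram_eq hs', h.gram_eq ht', Matrix.smul_apply, Matrix.smul_apply, hsa i j hi hj,
        htb i j hi hj, smul_eq_mul, smul_eq_mul]
      field_simp
      simp only [x]
      ring
  have e2 := hsum_eq_zero (h.minimalBoundary s hs') hy hy0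
  rw [hsum] at e2
  dsimp only
  rw [e]
  simp only [Matrix.smul_apply, smul_eq_mul, mul_assoc, ← Finset.mul_sum]
  rw [e2, mul_zero]

theorem globalFam (h : NormalizedFlow T ε g gY u v) : GlobalFam (Ioo 0 ε) gY (velocity g u v) where
  metricFam := h.metricFam
  boundaryCond := h.boundaryCond

end NormalizedFlow

end Flow

/-! ### Integrals depending on time, in coordinates -/

section ParametricIntegral

variable {n : ℕ} [NeZero n] {Ω K : Set (Coord n)} {ε : ℝ} {F F' : ℝ → Coord n → ℝ}

theorem CFam.continuousOn_slice {J : Set ℝ} (hF : CFam J Ω 0 F) {t : ℝ} (ht : t ∈ J) :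
    ContinuousOn (F t) Ω :=
  ContinuousOn.comp (f := fun y => (t, y)) hF.continuousOn (by fun_prop) fun _ hy => ⟨ht, hy⟩

theorem CFam.exists_bound (hK : IsCompact K) (hKΩ : K ⊆ Ω)
    (hF : CFam (Ico 0 ε) Ω 0 F) (h0 : ∀ t ∈ Ico 0 ε, ∀ y ∈ Ω, y ∉ K → F t y = 0) {b : ℝ}
    (hb : b < ε) : ∃ C : ℝ, ∀ t ∈ Icc 0 b, ∀ y ∈ Ω, ‖F t y‖ ≤ K.indicator (fun _ => C) y := by
  have hs : Icc 0 b ⊆ Ico 0 ε := fun t ht => ⟨ht.1, ht.2.trans_lt hb⟩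
  obtain ⟨C, hC⟩ := (isCompact_Icc.prod hK).exists_bound_of_continuousOn
    (hF.continuousOn.mono (prod_mono hs hKΩ))
  refine ⟨C, fun t ht y hy => ?_⟩
  by_cases hyK : y ∈ K
  · rw [indicator_of_mem hyK]; exact hC (t, y) ⟨ht, hyK⟩
  · rw [indicator_of_notMem hyK, h0 t (hs ht) y hy hyK, norm_zero]

theorem integrable_indicator_const (hK : IsCompact K) (C : ℝ) :
    Integrable (K.indicator fun _ => C) (volume.restrict Ω) :=
  (integrable_indicator_iff hK.measurableSet).2
    (integrableOn_const (hK.measure_lt_top.trans_le' (Measure.restrict_le_self _)).ne)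

/-- Integrals of a continuous family with compact support depend continuously on time. -/
theorem CFam.continuousOn_integral (hΩ : RelOpen Ω) (hK : IsCompact K) (hKΩ : K ⊆ Ω)
    (hF : CFam (Ico 0 ε) Ω 0 F) (h0 : ∀ t ∈ Ico 0 ε, ∀ y ∈ Ω, y ∉ K → F t y = 0) :
    ContinuousOn (fun t => ∫ y in Ω, F t y) (Ico 0 ε) := by
  intro t ht
  -- Stopping at `b < ε` makes the time interval compact and includes the initial time; on its
  -- product with `K` the family has a uniform bound.
  obtain ⟨b, htb, hbε⟩ := exists_between ht.2
  obtain ⟨C, hC⟩ := hF.exists_bound hK hKΩ h0 hbε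
  have hev : ∀ᶠ s in 𝓝[Ico 0 ε] t, s ∈ Icc 0 b := by
    filter_upwards [self_mem_nhdsWithin, nhdsWithin_le_nhds (Iio_mem_nhds htb)] with s hs hs'
    exact ⟨hs.1, le_of_lt hs'⟩
  refine continuousWithinAt_of_dominated (bound := K.indicator fun _ => C) ?_ ?_
    (integrable_indicator_const hK C) ?_
  · filter_upwards [self_mem_nhdsWithin] with s hs
    exact (hF.continuousOn_slice hs).aestronglyMeasurable hΩ.measurableSet
  · filter_upwards [hev] with s hs
    filter_upwards [ae_restrict_mem hΩ.measurableSet] with y hy using hC s hs y hy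
  · filter_upwards [ae_restrict_mem hΩ.measurableSet] with y hy
    exact ContinuousWithinAt.comp (f := fun s => (s, y)) (hF.continuousOn (t, y) ⟨ht, hy⟩)
      (by fun_prop) fun s hs => ⟨hs, hy⟩

/-- Differentiation under the integral sign for a family with compact support. -/
theorem CFam.hasDerivAt_integral (hΩ : RelOpen Ω) (hK : IsCompact K) (hKΩ : K ⊆ Ω)
    (hF : CFam (Ico 0 ε) Ω 0 F) (hF' : CFam (Ico 0 ε) Ω 0 F')
    (h0 : ∀ t ∈ Ico 0 ε, ∀ y ∈ Ω, y ∉ K → F t y = 0)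
    (h0' : ∀ t ∈ Ico 0 ε, ∀ y ∈ Ω, y ∉ K → F' t y = 0)
    (hd : ∀ t ∈ Ioo 0 ε, ∀ y ∈ Ω, HasDerivAt (fun s => F s y) (F' t y) t) {t : ℝ}
    (ht : t ∈ Ioo 0 ε) : HasDerivAt (fun s => ∫ y in Ω, F s y) (∫ y in Ω, F' t y) t := by
  obtain ⟨b, htb, hbε⟩ := exists_between ht.2
  obtain ⟨C, hC⟩ := hF'.exists_bound hK hKΩ h0' hbε
  have ht' : t ∈ Ico 0 ε := ⟨ht.1.le, ht.2⟩
  refine (hasDerivAt_integral_of_dominated_loc_of_deriv_le (s := Ioo 0 b)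
    (bound := K.indicator fun _ => C) (isOpen_Ioo.mem_nhds ⟨ht.1, htb⟩) ?_ ?_ ?_ ?_
    (integrable_indicator_const hK C) ?_).2
  · filter_upwards [isOpen_Ioo.mem_nhds ht] with s hs
    exact (hF.continuousOn_slice ⟨hs.1.le, hs.2⟩).aestronglyMeasurable hΩ.measurableSet
  · exact integrableOn_of_isCompact hΩ hK hKΩ (hF.continuousOn_slice ht') (h0 t ht')
  · exact (hF'.continuousOn_slice ht').aestronglyMeasurable hΩ.measurableSet
  · filter_upwards [ae_restrict_mem hΩ.measurableSet] with y hy s hs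
    exact hC s ⟨hs.1.le, hs.2.le⟩ y hy
  · filter_upwards [ae_restrict_mem hΩ.measurableSet] with y hy s hs
    exact hd s ⟨hs.1, hs.2.trans hbε⟩ y hy

end ParametricIntegral

/-! ### Integrals depending on time, on the manifold -/

section Global

variable {n : ℕ} [NeZero n] {W : Type*} [TopologicalSpace W]
  [ChartedSpace (EuclideanHalfSpace n) W] [T2Space W] [CompactSpace W] [IsManifold (𝓡∂ n) ∞ W]
  {ε : ℝ} {γ : ℝ → SmoothMetric n W} (P : ChartPartition n W)

namespace ChartPartition

theorem isCompact_image (c : W) : IsCompact (extChartAt (𝓡∂ n) c '' tsupport (P.ρ c)) :=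
  (isClosed_tsupport _).isCompact.image_of_continuousOn
    ((continuousOn_extChartAt c).mono (P.subordinate c))

theorem image_subset (c : W) :
    extChartAt (𝓡∂ n) c '' tsupport (P.ρ c) ⊆ (extChartAt (𝓡∂ n) c).target := by
  rintro _ ⟨x, hx, rfl⟩
  exact (extChartAt (𝓡∂ n) c).map_source (P.subordinate c hx)

theorem loc_eq_zero_of_notMem {c : W} {y : Coord n} (hy : y ∈ (extChartAt (𝓡∂ n) c).target)
    (h : y ∉ extChartAt (𝓡∂ n) c '' tsupport (P.ρ c)) : P.loc c c y = 0 :=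
  P.loc_eq_zero fun hs => h ⟨_, hs, (extChartAt (𝓡∂ n) c).right_inv hy⟩

theorem cfam_loc (c : W) (J : Set ℝ) :
    CFam J (extChartAt (𝓡∂ n) c).target 0 (fun _ => P.loc c c) :=
  CFam.of_contDiffOn (relOpen_target c) ((P.contDiffOn_loc c c).of_le (by simp))

variable [MeasurableSpace W] [BorelSpace W]

theorem integral_congr_chart (g : SmoothMetric n W) [IsFiniteMeasure (riemVolume g)] {f : W → ℝ}
    (hf : Continuous f) {A : W → Coord n → ℝ} (hA : ∀ c, ∀ y ∈ (extChartAt (𝓡∂ n) c).target,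
      f ((extChartAt (𝓡∂ n) c).symm y) = A c y) :
    ∫ x, f x ∂(riemVolume g) = ∑ c ∈ P.index, ∫ y in (extChartAt (𝓡∂ n) c).target,
      P.loc c c y * (density (gram g c) y * A c y) := by
  rw [P.integral_eq g hf]
  refine Finset.sum_congr rfl fun c _ => setIntegral_congr_fun (measurableSet_target c) fun y hy => ?_
  rw [hA c y hy]

end ChartPartition

/-- Integrals of scalars that are continuous in time are continuous in time. -/
theorem continuousOn_integral_riemVolume [MeasurableSpace W] [BorelSpace W]
    (hγ : ∀ c, C2MetricFam (Ico 0 ε) (extChartAt (𝓡∂ n) c).target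
      (fun t => gram (γ t) c)) (hfin : ∀ t ∈ Ico 0 ε, IsFiniteMeasure (riemVolume (γ t)))
    {f : ℝ → W → ℝ} {A : W → ℝ → Coord n → ℝ}
    (hf : ∀ t ∈ Ico 0 ε, ∀ c, ∀ y ∈ (extChartAt (𝓡∂ n) c).target,
      f t ((extChartAt (𝓡∂ n) c).symm y) = A c t y)
    (hA : ∀ c, CFam (Ico 0 ε) (extChartAt (𝓡∂ n) c).target 0 (A c)) :
    ContinuousOn (fun t => ∫ x, f t x ∂(riemVolume (γ t))) (Ico 0 ε) := by
  obtain ⟨P⟩ := exists_chartPartition n W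
  have h1 : ContinuousOn (fun t => ∑ c ∈ P.index, ∫ y in (extChartAt (𝓡∂ n) c).target,
      P.loc c c y * (density (gram (γ t) c) y * A c t y)) (Ico 0 ε) :=
    continuousOn_finsetSum _ fun c _ => CFam.continuousOn_integral (relOpen_target c)
      (P.isCompact_image c) (P.image_subset c)
      ((P.cfam_loc c _).mul (relOpen_target c) ((hγ c).cfam_density.mul (relOpen_target c) (hA c)))
      fun t _ y hy hyK => by rw [P.loc_eq_zero_of_notMem hy hyK, zero_mul]
  refine h1.congr fun t ht => ?_
  have := hfin t ht
  exact P.integral_congr_chart (γ t)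
    (continuous_of_chart fun c => ((hA c).continuousOn_slice ht).congr (hf t ht c)) (hf t ht)

/-- The first variation of the volume. -/
theorem hasDerivAt_riemVolume [MeasurableSpace W] [BorelSpace W]
    (hγ : ∀ c, C2MetricFam (Ico 0 ε) (extChartAt (𝓡∂ n) c).target
      (fun t => gram (γ t) c)) (hfin : ∀ t ∈ Ico 0 ε, IsFiniteMeasure (riemVolume (γ t)))
    {H : W → ℝ → Coord n → Matrix (Fin n) (Fin n) ℝ}
    (hm : ∀ c, MetricFam (Ioo 0 ε) (extChartAt (𝓡∂ n) c).target (fun t => gram (γ t) c) (H c))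
    {f : ℝ → W → ℝ}
    (hf : ∀ t ∈ Ico 0 ε, ∀ c, ∀ y ∈ (extChartAt (𝓡∂ n) c).target,
      f t ((extChartAt (𝓡∂ n) c).symm y) = mtr (gram (γ t) c y) (H c t y))
    (hA : ∀ c, CFam (Ico 0 ε) (extChartAt (𝓡∂ n) c).target 0
      fun t y => mtr (gram (γ t) c y) (H c t y)) {t : ℝ} (ht : t ∈ Ioo 0 ε) :
    HasDerivAt (fun s => (riemVolume (γ s)).real univ)
      ((1 / 2) * ∫ x, f t x ∂(riemVolume (γ t))) t := by
  obtain ⟨P⟩ := exists_chartPartition n W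
  have ht' : t ∈ Ico 0 ε := ⟨ht.1.le, ht.2⟩
  have hro := fun c : W => relOpen_target (n := n) c
  have e1 : ∀ s ∈ Ioo 0 ε, (riemVolume (γ s)).real univ
      = ∑ c ∈ P.index, ∫ y in (extChartAt (𝓡∂ n) c).target,
        P.loc c c y * density (gram (γ s) c) y := fun s hs => by
    have := hfin s ⟨hs.1.le, hs.2⟩
    have h1 := P.integral_congr_chart (γ s) (f := fun _ => 1) continuous_const
      (A := fun _ _ => 1) fun _ _ _ => rfl
    simp only [mul_one] at h1
    rw [← h1, integral_const, smul_eq_mul, mul_one]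
  have e2 : (1 / 2) * ∫ x, f t x ∂(riemVolume (γ t))
      = ∑ c ∈ P.index, ∫ y in (extChartAt (𝓡∂ n) c).target,
        P.loc c c y * (density (gram (γ t) c) y * ((1 / 2) * mtr (gram (γ t) c y) (H c t y))) := by
    have := hfin t ht'
    rw [P.integral_congr_chart (γ t)
      (continuous_of_chart fun c => ((hA c).continuousOn_slice ht').congr (hf t ht' c)) (hf t ht'),
      Finset.mul_sum]
    refine Finset.sum_congr rfl fun c _ => ?_
    rw [← integral_const_mul]
    exact integral_congr_ae (ae_of_all _ fun y => by ring)
  rw [e2]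
  refine HasDerivAt.congr_of_eventuallyEq (HasDerivAt.fun_sum fun c _ => ?_)
    (by filter_upwards [isOpen_Ioo.mem_nhds ht] with s hs using e1 s hs)
  exact CFam.hasDerivAt_integral (F := fun s y => P.loc c c y * density (gram (γ s) c) y)
    (F' := fun s y => P.loc c c y
      * (density (gram (γ s) c) y * ((1 / 2) * mtr (gram (γ s) c y) (H c s y)))) (hro c)
    (P.isCompact_image c) (P.image_subset c)
    ((P.cfam_loc c _).mul (hro c) (hγ c).cfam_density)
    ((P.cfam_loc c _).mul (hro c) ((hγ c).cfam_density.mul (hro c) ((hA c).const_mul (hro c) _)))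
    (fun s _ y hy hyK => by rw [P.loc_eq_zero_of_notMem hy hyK, zero_mul])
    (fun s _ y hy hyK => by rw [P.loc_eq_zero_of_notMem hy hyK, zero_mul])
    (fun s hs y hy => ((hm c).hasDerivAt_density hs hy).const_mul _) ht

end Global

/-! ### Conformal invariance of the relative Yamabe constant -/

section Conformal

variable {n : ℕ} [NeZero n] {W : Type*} [TopologicalSpace W]
  [ChartedSpace (EuclideanHalfSpace n) W] [IsManifold (𝓡∂ n) ∞ W] {g g' : SmoothMetric n W}

theorem contMDiff_rpow {f : W → ℝ} (hf : ContMDiff (𝓡∂ n) 𝓘(ℝ, ℝ) ∞ f) (hpos : ∀ x, 0 < f x)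
    (q : ℝ) : ContMDiff (𝓡∂ n) 𝓘(ℝ, ℝ) ∞ (fun x => f x ^ q) := fun x =>
  ContMDiffAt.comp (g := fun z : ℝ => z ^ q) x
    (Real.contDiffAt_rpow_const_of_ne (hpos x).ne').contMDiffAt (hf x)

/-- The relative Yamabe constant is an invariant of the conformal class. -/
theorem yamabeConstant_eq_of_isMultiple [MeasurableSpace W] {f : W → ℝ}
    (hf : ContMDiff (𝓡∂ n) 𝓘(ℝ, ℝ) ∞ f) (hpos : ∀ x, 0 < f x) {q : ℝ}
    (h : IsMultiple (fun x => f x ^ q) g g') : yamabeConstant g = yamabeConstant g' := by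
  have key : ∀ k : SmoothMetric n W, Conformal g k ↔ Conformal g' k := fun k => by
    have hq : ∀ x, f x ^ (-q) * f x ^ q = 1 := fun x => by
      rw [← Real.rpow_add (hpos x), neg_add_cancel, Real.rpow_zero]
    constructor
    · rintro ⟨a, ha, ha0, hm⟩
      refine ⟨fun x => a x * f x ^ (-q), ha.mul (contMDiff_rpow hf hpos _),
        fun x => mul_pos (ha0 x) (Real.rpow_pos_of_pos (hpos x) _), fun x v w => ?_⟩
      rw [h x v w, hm x v w]
      linear_combination (-(a x) * g.inner x v w) * hq x
    · rintro ⟨a, ha, ha0, hm⟩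
      refine ⟨fun x => a x * f x ^ q, ha.mul (contMDiff_rpow hf hpos _),
        fun x => mul_pos (ha0 x) (Real.rpow_pos_of_pos (hpos x) _), fun x v w => ?_⟩
      rw [hm x v w, h x v w]
      ring
  simp only [yamabeConstant, key]

theorem riemVolume_congr [MeasurableSpace W] (h : ∀ c y, gram g c y = gram g' c y) :
    riemVolume g = riemVolume g' := by
  simp only [riemVolume, chartVolume, h]

end Conformal

/-! ### Algebra of the traceless Ricci tensor -/

section TracelessPart

variable {n : ℕ} [NeZero n] {Ω : Set (Coord n)} {G : Coord n → Matrix (Fin n) (Fin n) ℝ}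
  {y : Coord n}

theorem IsLocalMetric.frob_tracelessMat (h : IsLocalMetric Ω G) (hy : y ∈ Ω) :
    frob (G y) (tracelessMat G y) (tracelessMat G y)
      = frob (G y) (ricMat G y) (ricMat G y) - scal G y ^ 2 / n := by
  have hs := h.transpose_eq hy
  have hn : (n : ℝ) ≠ 0 := NeZero.ne _
  have hT : tracelessMat G y = ricMat G y + (-(scal G y / n)) • G y := by
    rw [tracelessMat, neg_smul, sub_eq_add_neg]
  have e : ∀ Q, frob (G y) (tracelessMat G y) Q
      = frob (G y) (ricMat G y) Q - scal G y / n * mtr (G y) Q := fun Q => by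
    rw [hT, frob_add_left, frob_smul_left, frob_self_left hs (h.det_ne_zero hy)]; ring
  have hm : mtr (G y) (tracelessMat G y) = 0 := by
    rw [← frob_self_left hs (h.det_ne_zero hy), frob_comm hs, e, frob_comm hs,
      frob_self_left hs (h.det_ne_zero hy), mtr_self (h.det_ne_zero hy), ← scal]
    field_simp; ring
  rw [e, hm, frob_comm hs, e, ← scal]
  ring

/-- In the orthogonal splitting `Ric = Ric⁰ + (R / n) G` the second part pairs with the variation to
`R / n` times its trace, and `Ric⁰` pairs only with the traceless part `-2 Ric⁰` of the variation.
-/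
theorem IsLocalMetric.frob_ric_variation (h : IsLocalMetric Ω G) (hy : y ∈ Ω) (w : ℝ) :
    frob (G y) (w • G y + (-2 : ℝ) • ricMat G y) (ricMat G y)
      = scal G y / n * mtr (G y) (w • G y + (-2 : ℝ) • ricMat G y)
        - 2 * frob (G y) (tracelessMat G y) (tracelessMat G y) := by
  have hs := h.transpose_eq hy
  have hd := h.det_ne_zero hy
  have hn : (n : ℝ) ≠ 0 := NeZero.ne _
  have hm : mtr (G y) (w • G y + (-2 : ℝ) • ricMat G y) = w * n - 2 * scal G y := by
    rw [← frob_self_left hs hd, frob_comm hs, frob_add_left, frob_smul_left, frob_smul_left,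
      frob_self_left hs hd, mtr_self hd, frob_comm hs, frob_self_left hs hd, ← scal]
    ring
  rw [h.frob_tracelessMat hy, hm, frob_add_left, frob_smul_left, frob_smul_left,
    frob_self_left hs hd, ← scal]
  field_simp
  ring

end TracelessPart

/-! ### The derivative of the scalar curvature constant -/

section Variation

variable {n : ℕ} [NeZero n] {W : Type*} [TopologicalSpace W]
  [ChartedSpace (EuclideanHalfSpace n) W] [T2Space W] [CompactSpace W] [IsManifold (𝓡∂ n) ∞ W]
  {T ε : ℝ} {g gY : ℝ → SmoothMetric n W} {u v : ℝ → W → ℝ} {t : ℝ}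

theorem velocity_trans (g : ℝ → SmoothMetric n W) (u v : ℝ → W → ℝ) (t : ℝ) {c c' : W} {y : Coord n}
    (hy : y ∈ overlap c c') : velocity g u v c t y
      = (jac (trans c c') y).transpose * velocity g u v c' t (trans c c' y) * jac (trans c c') y := by
  rw [velocity, velocity, symm_trans hy, gram_trans (g t) hy, ricMat_trans (g t) hy]
  simp only [Matrix.mul_add, Matrix.add_mul, Matrix.mul_smul, Matrix.smul_mul]

/-- The trace of the velocity. -/
def velocityTrace (g gY : ℝ → SmoothMetric n W) (u v : ℝ → W → ℝ) (t : ℝ) (x : W) : ℝ :=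
  mtr (gram (gY t) x (extChartAt (𝓡∂ n) x x)) (velocity g u v x t (extChartAt (𝓡∂ n) x x))

/-- The inner product of the velocity and the Ricci tensor. -/
def velocityRicci (g gY : ℝ → SmoothMetric n W) (u v : ℝ → W → ℝ) (t : ℝ) (x : W) : ℝ :=
  frob (gram (gY t) x (extChartAt (𝓡∂ n) x x)) (velocity g u v x t (extChartAt (𝓡∂ n) x x))
    (ricMat (gram (gY t) x) (extChartAt (𝓡∂ n) x x))

theorem velocityTrace_symm {c : W} {y : Coord n} (hy : y ∈ (extChartAt (𝓡∂ n) c).target) :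
    velocityTrace g gY u v t ((extChartAt (𝓡∂ n) c).symm y)
      = mtr (gram (gY t) c y) (velocity g u v c t y) :=
  mtr_conj (gramInv_trans (gY t) (overlap_symm_mem hy))
    (velocity_trans g u v t (overlap_symm_mem hy))

theorem velocityRicci_symm {c : W} {y : Coord n} (hy : y ∈ (extChartAt (𝓡∂ n) c).target) :
    velocityRicci g gY u v t ((extChartAt (𝓡∂ n) c).symm y)
      = frob (gram (gY t) c y) (velocity g u v c t y) (ricMat (gram (gY t) c) y) :=
  frob_conj (gramInv_trans (gY t) (overlap_symm_mem hy))
    (velocity_trans g u v t (overlap_symm_mem hy)) (ricMat_trans (gY t) (overlap_symm_mem hy))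

namespace NormalizedFlow

theorem cfam_velocityTrace (h : NormalizedFlow T ε g gY u v) (c : W) :
    CFam (Ico 0 ε) (extChartAt (𝓡∂ n) c).target 0
      fun t y => mtr (gram (gY t) c y) (velocity g u v c t y) :=
  (h.c2MetricFam c).cfam_mtr (h.cfam_velocity c)

theorem cfam_velocityRicci (h : NormalizedFlow T ε g gY u v) (c : W) :
    CFam (Ico 0 ε) (extChartAt (𝓡∂ n) c).target 0
      fun t y => frob (gram (gY t) c y) (velocity g u v c t y) (ricMat (gram (gY t) c) y) :=
  (h.c2MetricFam c).cfam_frob (h.cfam_velocity c) (h.c2MetricFam c).cfam_ricMat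

theorem continuous_velocityTrace (h : NormalizedFlow T ε g gY u v) (ht : t ∈ Ico 0 ε) :
    Continuous (velocityTrace g gY u v t) :=
  continuous_of_chart fun c => ((h.cfam_velocityTrace c).continuousOn_slice ht).congr
    fun _ hy => velocityTrace_symm hy

theorem continuous_velocityRicci (h : NormalizedFlow T ε g gY u v) (ht : t ∈ Ico 0 ε) :
    Continuous (velocityRicci g gY u v t) :=
  continuous_of_chart fun c => ((h.cfam_velocityRicci c).continuousOn_slice ht).congr
    fun _ hy => velocityRicci_symm hy

variable [MeasurableSpace W] [BorelSpace W]

/-- The trace of the velocity has vanishing integral, as the volume is constant. -/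
theorem integral_velocityTrace_eq_zero (h : NormalizedFlow T ε g gY u v) (hε : 0 < ε)
    (hvol : ∀ t ∈ Ico 0 ε, riemVolume (gY t) univ = 1) :
    ∫ x, velocityTrace g gY u v 0 x ∂(riemVolume (gY 0)) = 0 := by
  have hfin : ∀ t ∈ Ico 0 ε, IsFiniteMeasure (riemVolume (gY t)) := fun t ht =>
    ⟨by rw [hvol t ht]; exact ENNReal.one_lt_top⟩
  have hc := continuousOn_integral_riemVolume h.c2MetricFam hfin
    (f := velocityTrace g gY u v) (fun t _ c y hy => velocityTrace_symm hy) h.cfam_velocityTrace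
  have hz : ∀ t ∈ Ioo 0 ε, ∫ x, velocityTrace g gY u v t x ∂(riemVolume (gY t)) = 0 :=
    fun t ht => by
      have h1 := hasDerivAt_riemVolume h.c2MetricFam hfin h.metricFam
        (f := velocityTrace g gY u v) (fun t _ c y hy => velocityTrace_symm hy)
        h.cfam_velocityTrace ht
      have h2 : HasDerivAt (fun s => (riemVolume (gY s)).real univ) 0 t :=
        (hasDerivAt_const t (1 : ℝ)).congr_of_eventuallyEq (by
          filter_upwards [isOpen_Ioo.mem_nhds ht] with s hs
          rw [Measure.real, hvol s ⟨hs.1.le, hs.2⟩, ENNReal.toReal_one])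
      have h3 := h1.unique h2
      linarith
  -- The volume was differentiated only at positive times; continuity of the integral carries the
  -- identity to the initial time.
  have h0 := (hc 0 ⟨le_rfl, hε⟩).mono_left (nhdsWithin_mono 0 Ioo_subset_Ico_self)
  have : (𝓝[Ioo 0 ε] (0 : ℝ)).NeBot := by
    rw [nhdsWithin_Ioo_eq_nhdsGT hε]; infer_instance
  refine tendsto_nhds_unique h0 (tendsto_const_nhds.congr' ?_)
  filter_upwards [self_mem_nhdsWithin] with s hs using (hz s hs).symm

/-- The first variation of the scalar curvature constant. -/
theorem hasDerivAt_const_scal (h : NormalizedFlow T ε g gY u v) [Nonempty W]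
    (hvol : ∀ t ∈ Ico 0 ε, riemVolume (gY t) univ = 1) {Y : ℝ → ℝ}
    (hY : ∀ t ∈ Ico 0 ε, ∀ x, scalarCurv (gY t) x = Y t) (ht : t ∈ Ioo 0 ε) :
    HasDerivAt Y (-∫ x, velocityRicci g gY u v t x ∂(riemVolume (gY t))) t := by
  have ht' : t ∈ Ico 0 ε := ⟨ht.1.le, ht.2⟩
  have hprob : IsProbabilityMeasure (riemVolume (gY t)) := ⟨hvol t ht'⟩
  -- The scalar curvature at each point is the same function of time, so the linearization at any
  -- point computes the derivative of `Y`.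
  have key : ∀ c, ∀ y ∈ (extChartAt (𝓡∂ n) c).target, HasDerivAt Y
      (-velocityRicci g gY u v t ((extChartAt (𝓡∂ n) c).symm y)
        + divg (gram (gY t) c) (scalVec (gram (gY t) c) (velocity g u v c t)) y) t :=
    fun c y hy => by
      rw [velocityRicci_symm hy]
      refine ((h.metricFam c).hasDerivAt_scal ht hy).congr_of_eventuallyEq ?_
      filter_upwards [isOpen_Ioo.mem_nhds ht] with s hs
      rw [← scalarCurv_symm (gY s) hy, hY s ⟨hs.1.le, hs.2⟩]
  obtain ⟨x₀⟩ := ‹Nonempty W›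
  have hD := (key x₀ _ (mem_extChartAt_target x₀)).differentiableAt.hasDerivAt
  have hR := (h.continuous_velocityRicci ht').integrable_of_hasCompactSupport
    (μ := riemVolume (gY t)) (HasCompactSupport.of_compactSpace _)
  -- Solving for the divergence expresses it as `Y' + ⟨h, Ric⟩`, a continuous function defined
  -- without charts. With total volume one, its vanishing integral is the claim.
  have h0 := h.globalFam.integral_eq_zero ht
    (F := fun x => deriv Y t + velocityRicci g gY u v t x)
    (continuous_const.add (h.continuous_velocityRicci ht')) fun c y hy => by
      rw [(key c y hy).deriv]; ring
  rw [integral_add (integrable_const _) hR, integral_const, probReal_univ, one_smul] at h0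
  rwa [← eq_neg_of_add_eq_zero_left h0]

/-- The one-sided derivative of the scalar curvature constant at the initial time. -/
theorem hasDerivWithinAt_const_scal (h : NormalizedFlow T ε g gY u v) [Nonempty W] (hε : 0 < ε)
    (hvol : ∀ t ∈ Ico 0 ε, riemVolume (gY t) univ = 1) {Y : ℝ → ℝ}
    (hY : ∀ t ∈ Ico 0 ε, ∀ x, scalarCurv (gY t) x = Y t) :
    HasDerivWithinAt Y (-∫ x, velocityRicci g gY u v 0 x ∂(riemVolume (gY 0))) (Ici 0) 0 := by
  have hd := fun t (ht : t ∈ Ioo 0 ε) => h.hasDerivAt_const_scal hvol hY ht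
  have h00 : (0 : ℝ) ∈ Ico 0 ε := ⟨le_rfl, hε⟩
  -- Nothing is differentiated at time zero: continuity of `Y` there and convergence of the
  -- derivatives at positive times give the one-sided derivative.
  refine hasDerivWithinAt_Ici_of_tendsto_deriv (s := Ioo 0 ε)
    (fun t ht => (hd t ht).differentiableAt.differentiableWithinAt) ?_ (Ioo_mem_nhdsGT hε) ?_
  · obtain ⟨x₀⟩ := ‹Nonempty W›
    have hy := mem_extChartAt_target (I := 𝓡∂ n) x₀
    have h1 : ContinuousOn (fun t => scal (gram (gY t) x₀) (extChartAt (𝓡∂ n) x₀ x₀)) (Ico 0 ε) :=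
      ContinuousOn.comp (f := fun t : ℝ => (t, extChartAt (𝓡∂ n) x₀ x₀))
        ((h.c2MetricFam x₀).cfam_mtr (h.c2MetricFam x₀).cfam_ricMat).continuousOn (by fun_prop)
        fun t ht => ⟨ht, hy⟩
    have h2 : ContinuousOn Y (Ico 0 ε) := h1.congr fun t ht => by
      dsimp only
      rw [← scalarCurv_symm (gY t) hy, hY t ht]
    exact (h2 0 h00).mono Ioo_subset_Ico_self
  · have hfin : ∀ t ∈ Ico 0 ε, IsFiniteMeasure (riemVolume (gY t)) := fun t ht =>
      ⟨by rw [hvol t ht]; exact ENNReal.one_lt_top⟩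
    have hc := continuousOn_integral_riemVolume h.c2MetricFam hfin
      (f := velocityRicci g gY u v) (fun t _ c y hy => velocityRicci_symm hy) h.cfam_velocityRicci
    have h0 := ((hc 0 h00).mono_left (nhdsWithin_mono 0 Ioo_subset_Ico_self)).neg
    rw [nhdsWithin_Ioo_eq_nhdsGT hε] at h0
    refine h0.congr' ?_
    filter_upwards [Ioo_mem_nhdsGT hε] with s hs using (hd s hs).deriv.symm

end NormalizedFlow

end Variation

/-! ### Vanishing of the traceless Ricci tensor and Einstein metrics -/

section Einstein

variable {n : ℕ} [NeZero n] {W : Type*} [TopologicalSpace W]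
  [ChartedSpace (EuclideanHalfSpace n) W] [IsManifold (𝓡∂ n) ∞ W] (g : SmoothMetric n W)

theorem tracelessRicciNormSq_nonneg (x : W) : 0 ≤ tracelessRicciNormSq g x := by
  rw [tracelessRicciNormSq_self]
  exact (frob_self_nonneg (gram_posDef g (mem_extChartAt_target x))).1

theorem continuous_tracelessRicciNormSq : Continuous (tracelessRicciNormSq g) :=
  continuous_of_chart fun c => by
    have h : C2MetricFam univ (extChartAt (𝓡∂ n) c).target (fun _ => gram g c) :=
      ⟨relOpen_target c, fun _ _ => isLocalMetric_gram g c, fun i j =>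
        CFam.of_contDiffOn (relOpen_target c) ((contDiffOn_gram g c i j).of_le (by norm_cast))⟩
    have hs := h.cfam_mtr h.cfam_ricMat
    have hT : ∀ i j, CFam univ (extChartAt (𝓡∂ n) c).target 0
        (fun _ y => tracelessMat (gram g c) y i j) := fun i j =>
      ((h.cfam_ricMat i j).sub h.relOpen ((hs.const_mul h.relOpen (1 / (n : ℝ))).mul h.relOpen
        ((h.cfam i j).of_le zero_le_two))).congr h.relOpen fun _ _ y _ => by
          rw [tracelessMat, Matrix.sub_apply, Matrix.smul_apply, smul_eq_mul, scal]; ring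
    exact ((h.cfam_frob hT hT).continuousOn_slice (mem_univ (0 : ℝ))).congr
      fun y hy => tracelessRicciNormSq_symm g hy

theorem ricci_eq_of_tracelessRicciNormSq_eq_zero {x : W} (h : tracelessRicciNormSq g x = 0)
    (v w : TangentSpace (𝓡∂ n) x) : ricci g x v w = scalarCurv g x / n * g.inner x v w := by
  rw [tracelessRicciNormSq_self] at h
  have h1 := (frob_self_nonneg (gram_posDef g (mem_extChartAt_target x))).2 h
  have h2 : ∀ i j, ricciCoeff g x (extChartAt (𝓡∂ n) x x) i j
      = scalarCurv g x / n * innMat g x i j := fun i j => by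
    have := congrFun (congrFun h1 i) j
    rw [tracelessMat, Matrix.sub_apply, Matrix.smul_apply, Matrix.zero_apply, smul_eq_mul,
      gram_self, ← scalarCurv_eq_scal_self] at this
    rw [ricciCoeff_eq]
    linarith
  have h3 := inn_eq_sum g x v w
  change g.inner x v w = _ at h3
  rw [h3, ricci, Finset.mul_sum]
  refine Finset.sum_congr rfl fun i _ => ?_
  rw [Finset.mul_sum]
  refine Finset.sum_congr rfl fun j _ => ?_
  rw [h2, comp, comp]
  ring

theorem tracelessRicciNormSq_eq_zero_of_isEinstein (h : IsEinstein g) (x : W) :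
    tracelessRicciNormSq g x = 0 := by
  obtain ⟨a, ha⟩ := h
  have hy := mem_extChartAt_target (I := 𝓡∂ n) x
  have hm := isLocalMetric_gram g x
  have h1 : ricMat (gram g x) (extChartAt (𝓡∂ n) x x)
      = a • gram g x (extChartAt (𝓡∂ n) x x) := by
    ext i j
    rw [← ricci_coordVec g hy]
    exact ha _ _ _
  have hn : (n : ℝ) ≠ 0 := NeZero.ne _
  have h2 : scal (gram g x) (extChartAt (𝓡∂ n) x x) = a * n := by
    rw [scal, h1, ← frob_self_left (hm.transpose_eq hy) (hm.det_ne_zero hy),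
      frob_comm (hm.transpose_eq hy), frob_smul_left,
      frob_self_left (hm.transpose_eq hy) (hm.det_ne_zero hy), mtr_self (hm.det_ne_zero hy)]
  rw [tracelessRicciNormSq_self, tracelessMat, h1, h2, mul_div_assoc, div_self hn, mul_one, sub_self]
  simp [frob]

end Einstein

end RelYamabe

end

/-! ### The derivative of the relative Yamabe constant at a Yamabe metric -/

theorem theoremA {n : ℕ} [NeZero n] (hn : 3 ≤ n)
    {W : Type*} [TopologicalSpace W] [T2Space W] [CompactSpace W]
    [ChartedSpace (EuclideanHalfSpace n) W] [IsManifold (𝓡∂ n) ∞ W]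
    [MeasurableSpace W] [BorelSpace W]
    (hM : ((𝓡∂ n).boundary W).Nonempty)
    (T : ℝ) (g : ℝ → SmoothMetric n W) (hg : RelYamabe.IsRicciFlow T g)
    (hg0 : RelYamabe.IsYamabeMetric (g 0))
    (ε : ℝ) (hε : 0 < ε) (hεT : ε ≤ T) (u : ℝ → W → ℝ)
    (hu : RelYamabe.IsC1Family n (Ico 0 ε) u)
    (hu_smooth : ∀ t ∈ Ico 0 ε, ContMDiff (𝓡∂ n) 𝓘(ℝ, ℝ) ∞ (u t))
    (hu_pos : ∀ t ∈ Ico 0 ε, ∀ x, 0 < u t x)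
    (hu0 : ∀ x, u 0 x = 1)
    (gY : ℝ → SmoothMetric n W)
    (hgY : ∀ t ∈ Ico 0 ε,
      RelYamabe.IsMultiple (fun x => u t x ^ (4 / ((n : ℝ) - 2))) (g t) (gY t))
    (hYam : ∀ t ∈ Ico 0 ε, RelYamabe.IsYamabeMetric (gY t)) :
    Integrable (RelYamabe.tracelessRicciNormSq (g 0)) (RelYamabe.riemVolume (g 0)) ∧
    HasDerivWithinAt (fun t => RelYamabe.yamabeConstant (g t))
      (2 * ∫ x, RelYamabe.tracelessRicciNormSq (g 0) x ∂(RelYamabe.riemVolume (g 0)))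
      (Ici 0) 0 ∧
    0 ≤ 2 * ∫ x, RelYamabe.tracelessRicciNormSq (g 0) x ∂(RelYamabe.riemVolume (g 0)) ∧
    (2 * ∫ x, RelYamabe.tracelessRicciNormSq (g 0) x ∂(RelYamabe.riemVolume (g 0)) = 0 ↔
      RelYamabe.IsEinstein (g 0)) := by
  open RelYamabe in
  obtain ⟨v, hv, hd, hcu, hcv⟩ := hu
  have : Nonempty W := ⟨hM.some⟩
  have h00 : (0 : ℝ) ∈ Ico 0 ε := ⟨le_rfl, hε⟩
  have hF : NormalizedFlow T ε g gY u v :=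
    ⟨hg, hεT, hu_smooth, hv, hu_pos, hd, hcu, hcv, hgY, fun t ht => (hYam t ht).minimalBoundary⟩
  have hgram : ∀ c y, gram (gY 0) c y = gram (g 0) c y := fun c y => by
    rw [hF.gram_eq h00, hu0, Real.one_rpow, one_smul]
  have hvol : riemVolume (gY 0) = riemVolume (g 0) := riemVolume_congr hgram
  have hfin : IsFiniteMeasure (riemVolume (g 0)) :=
    ⟨by rw [hg0.unitVolume]; exact ENNReal.one_lt_top⟩
  have hcont := continuous_tracelessRicciNormSq (g 0)
  have hint : Integrable (tracelessRicciNormSq (g 0)) (riemVolume (g 0)) :=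
    hcont.integrable_of_hasCompactSupport (HasCompactSupport.of_compactSpace _)
  have hnonneg : 0 ≤ 2 * ∫ x, tracelessRicciNormSq (g 0) x ∂(riemVolume (g 0)) :=
    mul_nonneg zero_le_two (integral_nonneg fun x => tracelessRicciNormSq_nonneg (g 0) x)
  refine ⟨hint, ?_, hnonneg, ?_⟩
  -- The metrics `gY t` and `g t` lie in one conformal class, so the constant scalar curvature of
  -- the former is the Yamabe constant of the latter.
  · have hY : ∀ t ∈ Ico 0 ε, ∀ x, scalarCurv (gY t) x = yamabeConstant (g t) := fun t ht x => by
      rw [(hYam t ht).scalarCurv_eq x,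
        yamabeConstant_eq_of_isMultiple (hu_smooth t ht) (hu_pos t ht) (hgY t ht)]
    have hvol1 : ∀ t ∈ Ico 0 ε, riemVolume (gY t) univ = 1 := fun t ht => (hYam t ht).unitVolume
    have h1 := hF.hasDerivWithinAt_const_scal hε hvol1 hY
    have h2 := hF.integral_velocityTrace_eq_zero hε hvol1
    -- Because `u 0 = 1`, the initial velocity is a multiple of the metric minus twice its Ricci
    -- tensor. The coefficient of the trace is constant on `W`, so that term integrates to zero by
    -- `h2`.
    have h3 : ∀ x, velocityRicci g gY u v 0 x = yamabeConstant (g 0) / n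
        * velocityTrace g gY u v 0 x - 2 * tracelessRicciNormSq (g 0) x := fun x => by
      have hy := mem_extChartAt_target (I := 𝓡∂ n) x
      have hR : scal (gram (g 0) x) (extChartAt (𝓡∂ n) x x) = yamabeConstant (g 0) := by
        rw [← scalarCurv_eq_scal_self, hg0.scalarCurv_eq]
      have hG : gram (gY 0) x = gram (g 0) x := funext (hgram x)
      rw [velocityRicci, velocityTrace, hG, velocity, hu0, Real.one_rpow, one_smul,
        (isLocalMetric_gram (g 0) x).frob_ric_variation hy, hR, tracelessRicciNormSq_self]
    refine h1.congr_deriv ?_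
    have hT := (hF.continuous_velocityTrace h00).integrable_of_hasCompactSupport
      (μ := riemVolume (g 0)) (HasCompactSupport.of_compactSpace _)
    rw [hvol] at h2 ⊢
    simp only [h3]
    rw [integral_sub (hT.const_mul _) (hint.const_mul _), integral_const_mul, integral_const_mul, h2]
    ring
  · rw [mul_eq_zero, or_iff_right two_ne_zero]
    constructor
    · intro h0
      have hz : ∀ x, tracelessRicciNormSq (g 0) x = 0 := by
        by_contra! hne
        obtain ⟨x, hx⟩ := hne
        -- The volume charges every nonempty open set, so a continuous nonnegative function that is
        -- positive somewhere has positive integral.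
        have : (riemVolume (g 0)).IsOpenPosMeasure :=
          ⟨fun U hU hUne => (riemVolume_pos (g 0) hU hUne).ne'⟩
        exact (hcont.integral_pos_of_hasCompactSupport_nonneg_nonzero
          (HasCompactSupport.of_compactSpace _) (tracelessRicciNormSq_nonneg (g 0)) hx).ne' h0
      -- The factor `R / n` is a constant because a Yamabe metric has constant scalar curvature.
      refine ⟨yamabeConstant (g 0) / n, fun x v w => ?_⟩
      rw [ricci_eq_of_tracelessRicciNormSq_eq_zero (g 0) (hz x), hg0.scalarCurv_eq]
    · intro hE
      simp only [tracelessRicciNormSq_eq_zero_of_isEinstein (g 0) hE, integral_zero]
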